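/- **Setting.** Labels: $Y=X\theta^*+w$ with $X\in\mathbb R^{n\times d}$, where $\theta^*\in\mathbb R^d$ has support exactly $S$, $|S|=s\ge1$, and $|\theta^*_i|\ge\beta$ for $i\in S$; the entries of $w$ are i.i.d., centred and sub-Gaussian with parameter $\sigma$. A design is *regular* for $S$ if, with constants $\alpha_1<1$, $\alpha_2>0$, $\alpha'\ge0$, $c_{\min}>0$, $C_0>0$: $\max_{j\notin S}\|(X_S^\top X_S)^{-1}X_S^\top x_j\|_1\le\alpha_1$; $\lambda_{\min}(X_S^\top X_S/n)\ge c_{\min}$; $\|\tfrac1nX^\top Xz\|_\infty\ge\alpha_2\|z\|_\infty$ whenever $\|z_{S^c}\|_1\le\alpha'\|z_S\|_1$; and $\|x_j\|_2\le C_0\sqrt n$ for all columns $x_j$. *Human comparisons.* The utility of a model $v\in\mathbb R^d$ is $u(v)=-D(v,\theta^*)$ for a (measurable) distance $D$. When the $i$-th coordinate of $v$ is queried, the human is shown models $c^-(v),c^+(v)$ that differ from $v$ only in coordinate $i$, lie on opposite sides of $v$ at the same distance $\Delta/2$, and are such that $D(y,c^+)<D(y,c^-)$ iff $y_i>v_i$,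 and $D(y,c^-)<D(y,c^+)$ iff $y_i<v_i$, for all $y$. The human picks the model with the larger value of $u+\xi$, with fresh i.i.d. Gumbel noises $\xi$ of scale $\gamma$. For all $v$ with $v=0$ off $S$ and $|v_j-\theta^*_j|\le\beta$ for all $j$, and all $i\in S$: the pair shown is as above, $|u(c^+(v))-u(c^-(v))|\ge\lambda|v_i-\theta_i^*|^\kappa$ if $|v_i-\theta_i^*|\le a$, and $|u(c^+(v))-u(c^-(v))|\ge\nu$ if $|v_i-\theta_i^*|\ge a$; here $0<\kappa\le1$ and $a,\lambda,\nu>0$. *SL+LHF.* Stage 1 computes a Lasso estimate $\hat\theta$ from $n_1$ labels. Stage 2 refines the coordinates $i$ with $\hat\theta_i\ne0$ one after the other by probabilistic bisection, started from the uniform distribution on $[\hat\theta_i-w_0,\hat\theta_i+w_0]$, $0<w_0\le\beta$: in horizontal step $k=0,1,\dots,K_2-1$ the median $t$ of the current distribution is queried repeatedly, with answers $\pm1$ and partial sums $S_m$; if $k\ge K_1$ and $m\ge M$, the bisection stops and returns $t$; otherwise, as soon as $|S_m|\ge\sqrt{2m(\ln(m+1)-\ln\eta)}$, the density is multiplied by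 $2p$ on the side of $t$ indicated by the sign of $S_m$ and by $2(1-p)$ on the other side, and the next horizontal step begins. After $K_2$ steps the median is returned. Here $0<\eta<1$, $\tfrac12<p<1-\eta/2$, $K_1\le K_2$. The sample size is $n_1$ plus the number of comparisons. *$(\varepsilon,\delta)$-alignment* means returning $\hat\theta$ with $\Pr(\|\hat\theta-\theta^*\|_2\le\varepsilon)\ge1-\delta$. *Pure SL solves it with $n$ samples* if, for some regular $n\times d$ design and some regularization parameter $>0$, a (measurable) Lasso estimator achieves this for every $\theta^*$ with support $S$ and $|\theta_i^*|\ge\beta$ on $S$, and every admissible noise law. **Proposition.** Fix $\kappa,a,\lambda,\gamma,\beta,\alpha_1,\alpha_2,\alpha',c_{\min},C_0$ as above, with $\beta,\gamma>0$, and $\bar\delta<1$. There are $C>0$ and $q\in\mathbb N$ depending only on these such that for all $\nu,r>0$ there is $\varepsilon_0>0$ with the following property. Let $1\le s\le d$, $\sigma>0$, $0<\delta\le\bar\delta$, and put $L=\ln\frac{d}{\varepsilon\delta}$. Let $\varepsilon>0$ be so small that $\varepsilon\le\varepsilon_0$ and $\varepsilon L\le\varepsilon_0$, and suppose that $$\frac{\sigma^2}{s^\kappa}\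 \ge\ C\,L^q\,\varepsilon^{2-2\kappa}.$$ Then the parameters of SL+LHF (Lasso regularization, $n_1,w_0,\eta,p,K_1,K_2,M$) can be chosen, independently of $S$, of the designs, of $\theta^*$, of the noise law and of the human's utility, such that for every $S$ with $|S|=s$, all stage-1 designs $X_n\in\mathbb R^{n\times d}$ that are regular for every $n\ge rs$, every (measurable) Lasso estimator, and all $\theta^*$, noise laws and humans as above, SL+LHF terminates and returns a model within Euclidean distance $\varepsilon$ of $\theta^*$ with probability at least $1-\delta$, and its expected sample size is strictly less than $n$ for every $n$ with which pure SL solves the $(\varepsilon,\delta)$-alignment problem. -/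

import Mathlib

open MeasureTheory ProbabilityTheory
open scoped ENNReal

noncomputable section

/-! ### Supervised learning: the Lasso on a sparse linear model -/

/-- The Lasso objective `(1/2n) ‖y - X θ‖₂² + reg ‖θ‖₁`. -/
def lassoObjective {n d : ℕ} (X : Matrix (Fin n) (Fin d) ℝ) (y : Fin n → ℝ) (reg : ℝ)
    (θ : Fin d → ℝ) : ℝ :=
  (1 / (2 * (n : ℝ))) * ∑ k, (y k - X.mulVec θ k) ^ 2 + reg * ∑ j, |θ j|

/-- A (measurable) Lasso estimator: for every response vector it returns a minimizer of the
Lasso objective. -/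
def IsLassoEstimator {n d : ℕ} (X : Matrix (Fin n) (Fin d) ℝ) (reg : ℝ)
    (est : (Fin n → ℝ) → (Fin d → ℝ)) : Prop :=
  Measurable est ∧
    ∀ y, IsMinOn (lassoObjective X y reg) Set.univ (est y)

/-- The columns of `X` indexed by `S`. -/
def colsOn {n d : ℕ} (X : Matrix (Fin n) (Fin d) ℝ) (S : Finset (Fin d)) :
    Matrix (Fin n) S ℝ :=
  X.submatrix id Subtype.val

/-- The standard conditions on a Lasso design with relevant feature set `S`. The norm of
`Fin d → ℝ` is the sup norm. -/
structure LassoDesign {n d : ℕ} (X : Matrix (Fin n) (Fin d) ℝ) (S : Finset (Fin d))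
    (α₁ α₂ α' cmin Ccol : ℝ) : Prop where
  /-- mutual incoherence: `max_{j ∉ S} ‖(X_Sᵀ X_S)⁻¹ X_Sᵀ x_j‖₁ ≤ α₁` -/
  incoherence : ∀ j, j ∉ S →
    ∑ i, |((((colsOn X S).transpose * colsOn X S)⁻¹ * (colsOn X S).transpose).mulVec
      (fun k => X k j)) i| ≤ α₁
  /-- lower eigenvalue: `λ_min (X_Sᵀ X_S / n) ≥ cmin` (Rayleigh quotient) -/
  lower_eigenvalue : ∀ z : S → ℝ,
    cmin * ∑ i, z i ^ 2 ≤ (1 / (n : ℝ)) * ∑ k, ((colsOn X S).mulVec z k) ^ 2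
  /-- `ℓ_∞`-curvature of `V = Xᵀ X / n` on the cone `‖z_{Sᶜ}‖₁ ≤ α' ‖z_S‖₁` -/
  curvature : ∀ z : Fin d → ℝ, ∑ j ∈ Sᶜ, |z j| ≤ α' * ∑ j ∈ S, |z j| →
    α₂ * ‖z‖ ≤ ‖(1 / (n : ℝ)) • (X.transpose * X).mulVec z‖
  /-- column normalization: `max_j ‖x_j‖₂ / √n ≤ Ccol` -/
  columns : ∀ j, ∑ k, X k j ^ 2 ≤ Ccol ^ 2 * n

/-- The parameters with support exactly `S` whose nonzero entries are at least `β` in modulus. -/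
def sparseClass {d : ℕ} (S : Finset (Fin d)) (β : ℝ) : Set (Fin d → ℝ) :=
  {θ | (∀ i ∈ S, β ≤ |θ i|) ∧ ∀ i, i ∉ S → θ i = 0}

/-- A law on `ℝ` that is centred and sub-Gaussian with parameter `σ`. -/
structure IsLabelNoise (ρ : Measure ℝ) (σ : ℝ) : Prop where
  prob : IsProbabilityMeasure ρ
  centred : ∫ x, x ∂ρ = 0
  subGaussian : HasSubgaussianMGF id (σ ^ 2).toNNReal ρ

/-- The law of `n` i.i.d. label noises. -/
def noiseLaw (n : ℕ) (ρ : Measure ℝ) : Measure (Fin n → ℝ) := Measure.pi fun _ => ρ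

/-- The Euclidean distance on `ℝ^d`. -/
def l2dist {d : ℕ} (x y : Fin d → ℝ) : ℝ := Real.sqrt (∑ j, (x j - y j) ^ 2)

/-- Pure Lasso-based supervised learning with the `n` feature vectors in `X` solves the
`(ε, δ)`-alignment problem: for some regularization parameter, a Lasso estimator is within `ε` of
the true parameter with probability at least `1 - δ`, for every true parameter of the class and
every admissible noise law. -/
def PureSLSolves {n d : ℕ} (X : Matrix (Fin n) (Fin d) ℝ) (S : Finset (Fin d))
    (β σ ε δ : ℝ) : Prop :=
  ∃ reg : ℝ, 0 < reg ∧ ∃ est, IsLassoEstimator X reg est ∧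
    ∀ θ ∈ sparseClass S β, ∀ ρ : Measure ℝ, IsLabelNoise ρ σ →
      noiseLaw n ρ {w | ¬ l2dist (est (X.mulVec θ + w)) θ ≤ ε} ≤ ENNReal.ofReal δ

/-! ### Human comparisons: the random utility model -/

/-- The Gumbel law with scale `γ`, i.e. the law of `-γ log E` with `E` standard exponential. -/
def gumbelMeasure (γ : ℝ) : Measure ℝ := (expMeasure 1).map fun x => -γ * Real.log x

instance (γ : ℝ) : IsProbabilityMeasure (gumbelMeasure γ) := by
  have := isProbabilityMeasure_expMeasure (r := 1) one_pos
  exact Measure.isProbabilityMeasure_map (by fun_prop)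

/-- What is needed to query a human about models `θ ∈ ℝ^d`: a measurable distance on models, the
comparison granularity, and for a query point `v` and a coordinate `i` the `i`-th coordinates
`lo v i` and `hi v i` of the two models `c⁻` and `c⁺` that are shown (the other coordinates are
those of `v`). -/
structure HumanModel (d : ℕ) where
  dist : (Fin d → ℝ) → (Fin d → ℝ) → ℝ
  dist_eq_zero : ∀ x y, dist x y = 0 ↔ x = y
  dist_comm : ∀ x y, dist x y = dist y x
  dist_triangle : ∀ x y z, dist x z ≤ dist x y + dist y z
  measurable_dist : ∀ y, Measurable fun x => dist x y
  gran : ℝ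
  gran_pos : 0 < gran
  lo : (Fin d → ℝ) → Fin d → ℝ
  hi : (Fin d → ℝ) → Fin d → ℝ
  measurable_lo : ∀ i, Measurable fun v => lo v i
  measurable_hi : ∀ i, Measurable fun v => hi v i

namespace HumanModel

variable {d : ℕ} (H : HumanModel d)

/-- The model `c⁻(v)` shown when the query point is `v` and coordinate `i` is being refined. -/
def cMinus (v : Fin d → ℝ) (i : Fin d) : Fin d → ℝ := Function.update v i (H.lo v i)

/-- The model `c⁺(v)` shown when the query point is `v` and coordinate `i` is being refined. -/
def cPlus (v : Fin d → ℝ) (i : Fin d) : Fin d → ℝ := Function.update v i (H.hi v i)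

/-- The utility of a model is minus its distance to the true model. -/
def utility (θ v : Fin d → ℝ) : ℝ := -H.dist v θ

/-- `c⁻(v)` and `c⁺(v)` lie on opposite sides of `v` at distance `gran / 2`, and `v` is a point
of bisection: the models at equal distance from both form the hyperplane through `v` orthogonal
to the `i`-th axis, with one half-space nearer to each of them. -/
structure IsQueryPair (v : Fin d → ℝ) (i : Fin d) : Prop where
  lo_lt : H.lo v i < v i
  lt_hi : v i < H.hi v i
  dist_lo : H.dist (H.cMinus v i) v = H.gran / 2
  dist_hi : H.dist (H.cPlus v i) v = H.gran / 2
  above : ∀ y, H.dist y (H.cPlus v i) < H.dist y (H.cMinus v i) ↔ v i < y i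
  below : ∀ y, H.dist y (H.cMinus v i) < H.dist y (H.cPlus v i) ↔ y i < v i

/-- The feasible query points: same support as the truth `θ`, all coordinates within `β`. -/
def feasible (S : Finset (Fin d)) (β : ℝ) (θ : Fin d → ℝ) : Set (Fin d → ℝ) :=
  {v | (∀ i, i ∉ S → v i = 0) ∧ ∀ i, |v i - θ i| ≤ β}

/-- Comparison accuracy at the truth `θ`: on feasible query points the shown models are genuine
query pairs; the utility gap is at least `lam |v_i - θ_i|^κ` when `v_i` is within `a` of `θ_i`,
and at least `ν` farther away. -/
structure Accurate (S : Finset (Fin d)) (θ : Fin d → ℝ) (β a lam κ ν : ℝ) : Prop where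
  pair : ∀ v ∈ feasible S β θ, ∀ i ∈ S, H.IsQueryPair v i
  near : ∀ v ∈ feasible S β θ, ∀ i ∈ S, |v i - θ i| ≤ a →
    lam * |v i - θ i| ^ κ ≤ |H.utility θ (H.cPlus v i) - H.utility θ (H.cMinus v i)|
  far : ∀ v ∈ feasible S β θ, ∀ i ∈ S, a ≤ |v i - θ i| →
    ν ≤ |H.utility θ (H.cPlus v i) - H.utility θ (H.cMinus v i)|

end HumanModel

/-- Index of a random utility noise: coordinate, horizontal step, vertical step, and which of the
two shown models it perturbs (`true` for `c⁺`). Each index is used at most once. -/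
abbrev NoiseIndex (d : ℕ) : Type := Fin d × ℕ × ℕ × Bool

/-- The law of i.i.d. Gumbel utility noises. -/
def humanLaw (d : ℕ) (γ : ℝ) : Measure (NoiseIndex d → ℝ) :=
  Measure.infinitePi fun _ => gumbelMeasure γ

/-- The human's answer to the `m`-th repetition of the comparison made in horizontal step `k` of
the refinement of coordinate `i`, when the current model is `v` and the queried value of the
coordinate is `t`: `+1` if the perturbed utility of `c⁺` exceeds that of `c⁻`, else `-1`. -/
def answer {d : ℕ} (H : HumanModel d) (θ : Fin d → ℝ) (ξ : NoiseIndex d → ℝ) (i : Fin d)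
    (v : Fin d → ℝ) (t : ℝ) (k m : ℕ) : ℤ :=
  let q := Function.update v i t
  open Classical in
  if H.utility θ (H.cMinus q i) + ξ (i, k, m, false)
      < H.utility θ (H.cPlus q i) + ξ (i, k, m, true) then 1 else -1

/-! ### Model alignment through probabilistic bisection in one dimension -/

/-- Parameters of the bisection: `η` and `p`, the number `localSteps` of horizontal moves after
which the cap on vertical moves is in force, the total number `maxSteps` of horizontal moves, and
the cap `cap` on vertical moves. -/
structure BisectionParams where
  η : ℝ
  p : ℝ
  localSteps : ℕ
  maxSteps : ℕ
  cap : ℕ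

/-- `η ∈ (0,1)`, and the update weight `p` lies between `1/2` and the accuracy `1 - η/2`. -/
structure BisectionParams.Valid (P : BisectionParams) : Prop where
  η_pos : 0 < P.η
  η_lt_one : P.η < 1
  half_lt_p : 1 / 2 < P.p
  p_lt : P.p < 1 - P.η / 2
  steps_le : P.localSteps ≤ P.maxSteps

/-- The walk `S_m` formed by the first `m` answers. -/
def walk (z : ℕ → ℤ) (m : ℕ) : ℤ := ∑ j ∈ Finset.range m, z j

/-- The boundary `(2 m (ln (m+1) - ln η))^{1/2}` of the power-one test. -/
def testBoundary (η : ℝ) (m : ℕ) : ℝ :=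
  Real.sqrt (2 * m * (Real.log (m + 1) - Real.log η))

/-- After `m` comparisons in horizontal step `k` the cap on vertical moves is reached. -/
def capReached (P : BisectionParams) (k m : ℕ) : Prop := P.localSteps ≤ k ∧ P.cap ≤ m

/-- The vertical move of horizontal step `k` ends after `m` comparisons at the latest. -/
def verticalStop (P : BisectionParams) (z : ℕ → ℤ) (k m : ℕ) : Prop :=
  1 ≤ m ∧ (capReached P k m ∨ testBoundary P.η m ≤ |(walk z m : ℝ)|)

/-- The median of a probability measure on the line. -/
def median (μ : Measure ℝ) : ℝ := sInf {x | 1 / 2 ≤ μ (Set.Iic x)}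

/-- The posterior update: the density on the indicated side of the query point `t` is multiplied
by `2p`, on the other side by `2(1-p)`. -/
def posteriorUpdate (p : ℝ) (up : Prop) (t : ℝ) (μ : Measure ℝ) : Measure ℝ :=
  open Classical in
  μ.withDensity fun x => ENNReal.ofReal (if (up ↔ t ≤ x) then 2 * p else 2 * (1 - p))

/-- State of the algorithm: current distribution, number of comparisons so far, and the returned
point once it has terminated before the last horizontal move. -/
structure BisectionState where
  post : Measure ℝ
  cost : ℝ≥0∞
  result : Option ℝ

/-- Horizontal step `k`, where `ans t k m` is the answer to the `m`-th comparison at `t`. If the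
vertical move never ends, the number of comparisons is infinite. -/
def bisectionStep (P : BisectionParams) (ans : ℝ → ℕ → ℕ → ℤ) (k : ℕ) (st : BisectionState) :
    BisectionState :=
  open Classical in
  match st.result with
  | some _ => st
  | none =>
    let t := median st.post
    if h : ∃ m, verticalStop P (ans t k) k m then
      let m := Nat.find h
      if capReached P k m then ⟨st.post, st.cost + m, some t⟩
      else ⟨posteriorUpdate P.p (0 < walk (ans t k) m) t st.post, st.cost + m, none⟩
    else ⟨st.post, ⊤, some t⟩

/-- The state after the first `k` horizontal steps. -/
def bisectionRun (P : BisectionParams) (prior : Measure ℝ) (ans : ℝ → ℕ → ℕ → ℤ) :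
    ℕ → BisectionState
  | 0 => ⟨prior, 0, none⟩
  | k + 1 => bisectionStep P ans k (bisectionRun P prior ans k)

/-- The returned point and the total number of comparisons. -/
def bisection (P : BisectionParams) (prior : Measure ℝ) (ans : ℝ → ℕ → ℕ → ℤ) : ℝ × ℝ≥0∞ :=
  let st := bisectionRun P prior ans P.maxSteps
  (st.result.getD (median st.post), st.cost)

/-! ### The two-stage framework -/

/-- Tuning of the two-stage framework: number of labels and Lasso regularization of the first
stage; radius of the range searched around each selected coefficient and parameters of the
bisection of the second stage. -/
structure Tuning where
  labels : ℕ
  reg : ℝ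
  radius : ℝ
  bis : BisectionParams

/-- The regularization and the radius are positive, the latter at most `β`. -/
structure Tuning.Valid (T : Tuning) (β : ℝ) : Prop where
  reg_pos : 0 < T.reg
  radius_pos : 0 < T.radius
  radius_le : T.radius ≤ β
  bis_valid : T.bis.Valid

/-- Second stage, started from the Lasso estimate `θ₀`: the coordinates selected by the Lasso are
refined one after the other, each by a bisection with uniform prior on the interval of the given
radius around the Lasso estimate. Returns the final model and the number of comparisons. -/
def refine {d : ℕ} (T : Tuning) (H : HumanModel d) (θ : Fin d → ℝ) (ξ : NoiseIndex d → ℝ)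
    (θ₀ : Fin d → ℝ) : (Fin d → ℝ) × ℝ≥0∞ :=
  open Classical in
  (List.finRange d).foldl
    (fun st i =>
      if θ₀ i = 0 then st
      else
        let r := bisection T.bis
          (ProbabilityTheory.cond volume (Set.Icc (θ₀ i - T.radius) (θ₀ i + T.radius)))
          (answer H θ ξ i st.1)
        (Function.update st.1 i r.1, st.2 + r.2))
    (θ₀, 0)

/-- The joint law of label noises and utility noises. -/
def jointLaw (n d : ℕ) (ρ : Measure ℝ) (γ : ℝ) :
    Measure ((Fin n → ℝ) × (NoiseIndex d → ℝ)) :=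
  (noiseLaw n ρ).prod (humanLaw d γ)

/-- The two-stage procedure on label noises `ω.1` and utility noises `ω.2`: the final model and
the number of human comparisons. -/
def twoStage {d : ℕ} (T : Tuning) (X : Matrix (Fin T.labels) (Fin d) ℝ)
    (est : (Fin T.labels → ℝ) → (Fin d → ℝ)) (H : HumanModel d) (θ : Fin d → ℝ)
    (ω : (Fin T.labels → ℝ) × (NoiseIndex d → ℝ)) : (Fin d → ℝ) × ℝ≥0∞ :=
  refine T H θ ω.2 (est (X.mulVec θ + ω.1))

/-- The two-stage procedure terminates and is within `ε` of the truth. -/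
def Aligned {d : ℕ} (ε : ℝ) (θ : Fin d → ℝ) (out : (Fin d → ℝ) × ℝ≥0∞) : Prop :=
  out.2 < ⊤ ∧ l2dist out.1 θ ≤ ε

/-- The expected number of samples of the two-stage procedure: labels plus comparisons. -/
def expectedSamples {d : ℕ} (T : Tuning) (X : Matrix (Fin T.labels) (Fin d) ℝ)
    (est : (Fin T.labels → ℝ) → (Fin d → ℝ)) (H : HumanModel d) (θ : Fin d → ℝ)
    (ρ : Measure ℝ) (γ : ℝ) : ℝ≥0∞ :=
  (T.labels : ℝ≥0∞) + ∫⁻ ω, (twoStage T X est H θ ω).2 ∂(jointLaw T.labels d ρ γ)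

/-- The logarithmic factor `ln (d / (ε δ))`. -/
def logFactor (d : ℕ) (ε δ : ℝ) : ℝ := Real.log (d / (ε * δ))

end

/-! ### Support recovery and sup-norm accuracy of the Lasso -/

/-! Two costs are compared. Pure supervised learning needs at least of order s σ²/ε² labels
(`pureSL_sample_lower_bound`). The two-stage procedure buys labels only for the constant accuracy
β/2, about σ² L + r s of them, and gets the remaining precision from comparisons, whose price does
not involve σ. Each of the s relevant coordinates is brought to precision ε/√s in O(L) bisection
steps, and a step costs O(L) over the squared utility gap, that is O(L s^κ ε^(-2κ)). The lower bound
assumed on σ²/s^κ says exactly that s · L² s^κ ε^(-2κ) is a small fraction of s σ²/ε²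
(`SmallPrecision.cost_le`); hence the exponent 2 of L.

Lower bound. Of the Lasso only measurability is used. Take Gaussian noise and a uniform prior of
width about ε/√s on the relevant coefficients. Replacing the true signal by a fixed one costs a
factor e^s, outside an event controlled by the mean signal energy. After that the data carry no
information on the parameter, so success has at most the prior mass of an ε-ball, (const/R)^s, which
beats e^s once the prior is wide enough.

First stage. `lasso_recovery` is deterministic: if every column has correlation at most τ with the
noise, pairing the residual with the part of the irrelevant columns orthogonal to the relevant ones
forces the error off S to vanish, and curvature then bounds it in sup norm.

Second stage. Answers are logistic in the utility gap. Hoeffding and a union bound over the times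
before the cap show that the walk does not cross on the wrong side, and does cross if the query is
far from the truth (`humanLaw_not_faithful_le`). Since η = 1 - p = e^(-16L), a union bound over all
coordinates and steps is affordable, and when all moves are correct the posterior concentrates
deterministically (`abs_signQuery_sub_le`). Query points depend on earlier noise, but every step
uses a fresh block of noise, so the query can be frozen (`infinitePi_diagonal_le`). The cap is in
force from the first step, so the cost is bounded surely, even when the first stage fails. -/

lemma nonpos_of_forall_le_mul {a b : ℝ} (h : ∀ u : ℝ, 0 < u → u < 1 → a ≤ b * u) : a ≤ 0 := by
  by_contra! ha
  have hb : 0 < 2 * (|b| + 1) := by positivity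
  have h1 := h (min (1 / 2) (a / (2 * (|b| + 1)))) (by positivity)
    (lt_of_le_of_lt (min_le_left _ _) (by norm_num))
  have h2 : b * min (1 / 2) (a / (2 * (|b| + 1))) ≤ (|b| + 1) * (a / (2 * (|b| + 1))) := by
    have : b ≤ |b| + 1 := by linarith [le_abs_self b]
    exact mul_le_mul this (min_le_right _ _) (by positivity) (by positivity)
  have h3 : (|b| + 1) * (a / (2 * (|b| + 1))) = a / 2 := by
    have : |b| + 1 ≠ 0 := by positivity
    field_simp
  linarith

/-- First-order optimality conditions for a quadratic plus a multiple of the modulus. -/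
lemma scalar_kkt {A c reg x : ℝ} (hreg : 0 < reg)
    (h : ∀ t : ℝ, 0 ≤ A * t ^ 2 - c * t + reg * (|x + t| - |x|)) :
    |c| ≤ reg ∧ c * x = reg * |x| := by
  have hc : |c| ≤ reg := by
    rw [abs_le]
    constructor
    · suffices -c - reg ≤ 0 by linarith
      refine nonpos_of_forall_le_mul (b := A) fun u hu _ => ?_
      have h1 := h (-u)
      have h2 : |x + -u| - |x| ≤ u := by
        have := abs_add_le x (-u); rw [abs_neg, abs_of_pos hu] at this; linarith
      have h3 : reg * (|x + -u| - |x|) ≤ reg * u := by gcongr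
      have : (-c - reg) * u ≤ A * u * u := by nlinarith
      exact le_of_mul_le_mul_right this hu
    · suffices c - reg ≤ 0 by linarith
      refine nonpos_of_forall_le_mul (b := A) fun u hu _ => ?_
      have h1 := h u
      have h2 : |x + u| - |x| ≤ u := by
        have := abs_add_le x u; rw [abs_of_pos hu] at this; linarith
      have h3 : reg * (|x + u| - |x|) ≤ reg * u := by gcongr
      have : (c - reg) * u ≤ A * u * u := by nlinarith
      exact le_of_mul_le_mul_right this hu
  refine ⟨hc, le_antisymm ?_ ?_⟩
  · calc c * x ≤ |c * x| := le_abs_self _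
      _ = |c| * |x| := abs_mul _ _
      _ ≤ reg * |x| := by gcongr
  -- Shrinking `x` by the factor `1 - u` saves `reg * u * |x|` in the penalty; this direction gives
  -- the equality part.
  · suffices reg * |x| - c * x ≤ 0 by linarith
    refine nonpos_of_forall_le_mul (b := A * x ^ 2) fun u hu hu1 => ?_
    have h1 := h (-(x * u))
    have h2 : |x + -(x * u)| = (1 - u) * |x| := by
      rw [show x + -(x * u) = (1 - u) * x by ring, abs_mul, abs_of_pos (by linarith)]
    rw [h2] at h1
    have : (reg * |x| - c * x) * u ≤ A * x ^ 2 * u * u := by nlinarith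
    exact le_of_mul_le_mul_right this hu

lemma mulVec_add_single {n d : ℕ} (X : Matrix (Fin n) (Fin d) ℝ) (θ : Fin d → ℝ) (j : Fin d)
    (t : ℝ) (k : Fin n) :
    X.mulVec (θ + Pi.single j t) k = X.mulVec θ k + t * X k j := by
  rw [Matrix.mulVec_add, Pi.add_apply, Matrix.mulVec_single]
  simp [mul_comm]

/-- The normalized inner product of the `j`-th column with a vector. -/
noncomputable def colCorr {n d : ℕ} (X : Matrix (Fin n) (Fin d) ℝ) (r : Fin n → ℝ) (j : Fin d) :
    ℝ :=
  (1 / (n : ℝ)) * ∑ k, X k j * r k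

/-- The Karush-Kuhn-Tucker conditions at a minimizer of the Lasso objective. -/
lemma lasso_kkt {n d : ℕ} {X : Matrix (Fin n) (Fin d) ℝ} {y : Fin n → ℝ} {reg : ℝ}
    {θ : Fin d → ℝ} (hreg : 0 < reg) (hmin : IsMinOn (lassoObjective X y reg) Set.univ θ)
    (j : Fin d) :
    |colCorr X (y - X.mulVec θ) j| ≤ reg ∧
      colCorr X (y - X.mulVec θ) j * θ j = reg * |θ j| := by
  refine scalar_kkt (A := (1 / (2 * (n : ℝ))) * ∑ k, X k j ^ 2) hreg fun t => ?_
  have h := hmin (Set.mem_univ (θ + Pi.single j t))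
  simp only [Set.mem_ofPred_eq, lassoObjective, mulVec_add_single] at h
  have h1 : ∑ i, |(θ + Pi.single j t : Fin d → ℝ) i| = (∑ i, |θ i|) + (|θ j + t| - |θ j|) := by
    rw [← Finset.add_sum_erase _ _ (Finset.mem_univ j),
      ← Finset.add_sum_erase _ (fun i => |θ i|) (Finset.mem_univ j)]
    have : ∑ i ∈ Finset.univ.erase j, |(θ + Pi.single j t : Fin d → ℝ) i|
        = ∑ i ∈ Finset.univ.erase j, |θ i| := by
      refine Finset.sum_congr rfl fun i hi => ?_
      simp [Pi.single_eq_of_ne (Finset.ne_of_mem_erase hi)]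
    rw [this]
    simp
    ring
  have h2 : ∑ k, (y k - (X.mulVec θ k + t * X k j)) ^ 2
      = ∑ k, (y k - X.mulVec θ k) ^ 2 - 2 * t * ∑ k, X k j * (y - X.mulVec θ) k
        + t ^ 2 * ∑ k, X k j ^ 2 := by
    rw [Finset.mul_sum, Finset.mul_sum, ← Finset.sum_sub_distrib, ← Finset.sum_add_distrib]
    refine Finset.sum_congr rfl fun k _ => ?_
    simp only [Pi.sub_apply]
    ring
  rw [h1, h2] at h
  have h3 : (1 / (2 * (n : ℝ))) * (2 * t * ∑ k, X k j * (y - X.mulVec θ) k)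
      = colCorr X (y - X.mulVec θ) j * t := by
    unfold colCorr
    rw [one_div, one_div, mul_inv]
    ring
  linarith [h3, mul_add (1 / (2 * (n : ℝ))) (∑ k, (y k - X.mulVec θ k) ^ 2
    - 2 * t * ∑ k, X k j * (y - X.mulVec θ) k) (t ^ 2 * ∑ k, X k j ^ 2),
    mul_sub (1 / (2 * (n : ℝ))) (∑ k, (y k - X.mulVec θ k) ^ 2)
    (2 * t * ∑ k, X k j * (y - X.mulVec θ) k), mul_add reg (∑ i, |θ i|) (|θ j + t| - |θ j|),
    show (1 / (2 * (n : ℝ))) * (t ^ 2 * ∑ k, X k j ^ 2)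
      = (1 / (2 * (n : ℝ))) * (∑ k, X k j ^ 2) * t ^ 2 by ring]

/-- The coefficients of the regression of an irrelevant column on the relevant ones. -/
lemma LassoDesign.exists_regression {n d : ℕ} {X : Matrix (Fin n) (Fin d) ℝ}
    {S : Finset (Fin d)} {α₁ α₂ α' cmin Ccol : ℝ} (hX : LassoDesign X S α₁ α₂ α' cmin Ccol)
    (hcmin : 0 < cmin) {j : Fin d} (hj : j ∉ S) :
    ∃ b : S → ℝ, ∑ i, |b i| ≤ α₁ ∧
      ∀ i : S, ∑ k, X k i * (X k j - ∑ i' : S, X k i' * b i') = 0 := by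
  set Z := colsOn X S with hZ
  -- The inverse in the incoherence condition is meaningful only for an invertible Gram matrix: a
  -- null vector is killed by `Z` and hence vanishes by the lower eigenvalue bound.
  have hunit : IsUnit (Z.transpose * Z) := by
    rw [← Matrix.mulVec_injective_iff_isUnit]
    refine (injective_iff_map_eq_zero (Z.transpose * Z).mulVecLin).2 fun z hz => ?_
    have hz0 : Z.mulVec z = 0 := by
      have h1 : dotProduct z ((Z.transpose * Z).mulVec z) = 0 := by
        rw [show (Z.transpose * Z).mulVec z = 0 from hz, dotProduct_zero]
      rw [← Matrix.mulVec_mulVec, Matrix.dotProduct_mulVec, Matrix.vecMul_transpose] at h1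
      exact dotProduct_self_eq_zero.1 h1
    have h2 := hX.lower_eigenvalue z
    rw [← hZ, hz0] at h2
    simp only [Pi.zero_apply, ne_eq, OfNat.ofNat_ne_zero, not_false_eq_true, zero_pow,
      Finset.sum_const_zero, mul_zero] at h2
    have h3 : ∑ i, z i ^ 2 = 0 :=
      le_antisymm (by nlinarith) (Finset.sum_nonneg fun i _ => sq_nonneg _)
    funext i
    simpa using (Finset.sum_eq_zero_iff_of_nonneg fun i _ => sq_nonneg (z i)).1 h3 i
      (Finset.mem_univ i)
  refine ⟨_, hX.incoherence j hj, fun i => ?_⟩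
  have h1 : (Z.transpose * Z).mulVec
      (((Z.transpose * Z)⁻¹ * Z.transpose).mulVec fun k => X k j)
      = Z.transpose.mulVec fun k => X k j := by
    rw [Matrix.mulVec_mulVec, ← Matrix.mul_assoc,
      Matrix.mul_nonsing_inv _ ((Matrix.isUnit_iff_isUnit_det _).1 hunit), Matrix.one_mul]
  rw [← Matrix.mulVec_mulVec] at h1
  have h2 := congrFun h1 i
  simp only [Matrix.mulVec, dotProduct, Matrix.transpose_apply] at h2
  simp only [mul_sub, Finset.sum_sub_distrib]
  rw [sub_eq_zero]
  exact h2.symm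

/-- On the event that the noise is nearly uncorrelated with all columns, every Lasso solution
vanishes off the support and is close to the truth in sup norm. -/
lemma lasso_recovery {n d : ℕ} {X : Matrix (Fin n) (Fin d) ℝ} {S : Finset (Fin d)}
    {α₁ α₂ α' cmin Ccol reg τ α : ℝ} (hX : LassoDesign X S α₁ α₂ α' cmin Ccol)
    (hcmin : 0 < cmin) (hα₂ : 0 < α₂) (hα' : 0 ≤ α') (hreg : 0 < reg)
    (hα : α₁ ≤ α) (hτ : τ * (1 + α) < reg * (1 - α)) (hτ0 : 0 ≤ τ)
    {θ θhat : Fin d → ℝ} (hθ : ∀ i, i ∉ S → θ i = 0) {w : Fin n → ℝ}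
    (hw : ∀ j, |colCorr X w j| ≤ τ)
    (hmin : IsMinOn (lassoObjective X (X.mulVec θ + w) reg) Set.univ θhat) :
    (∀ j, j ∉ S → θhat j = 0) ∧ ∀ j, |θhat j - θ j| ≤ (reg + τ) / α₂ := by
  classical
  set r : Fin n → ℝ := X.mulVec θ + w - X.mulVec θhat with hr
  have hkkt := lasso_kkt hreg hmin
  rw [← hr] at hkkt
  set z : Fin d → ℝ := θhat - θ with hz
  have hrz : r = w - X.mulVec z := by rw [hr, hz, Matrix.mulVec_sub]; abel
  have hzN : ∀ j, j ∉ S → z j = θhat j := fun j hj => by simp [hz, hθ j hj]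
  have hex : ∀ j, ∃ b : S → ℝ, j ∉ S → (∑ i, |b i| ≤ α₁ ∧
      ∀ i : S, ∑ k, X k i * (X k j - ∑ i' : S, X k i' * b i') = 0) := fun j => by
    by_cases hj : j ∈ S
    · exact ⟨0, fun h => absurd hj h⟩
    · obtain ⟨b, hb⟩ := hX.exists_regression hcmin hj
      exact ⟨b, fun _ => hb⟩
  choose b hb using hex
  -- the part of `X z` that is orthogonal to the relevant columns
  let h : Fin n → ℝ := fun k => ∑ j ∈ Sᶜ, z j * (X k j - ∑ i : S, X k i * b j i)
  have hXz : ∀ k, X.mulVec z k = h k + ∑ i : S, X k i * (z i + ∑ j ∈ Sᶜ, z j * b j i) := by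
    intro k
    have h1 : X.mulVec z k = ∑ i : S, X k i * z i + ∑ j ∈ Sᶜ, X k j * z j := by
      rw [Matrix.mulVec, dotProduct, ← Finset.sum_add_sum_compl S,
        ← Finset.sum_coe_sort S (fun i => X k i * z i)]
    have h2 : ∑ i : S, X k i * ∑ j ∈ Sᶜ, z j * b j i
        = ∑ j ∈ Sᶜ, z j * ∑ i : S, X k i * b j i := by
      simp only [Finset.mul_sum]
      rw [Finset.sum_comm]
      exact Finset.sum_congr rfl fun j _ => Finset.sum_congr rfl fun i _ => by ring
    have h3 : h k = ∑ j ∈ Sᶜ, X k j * z j - ∑ j ∈ Sᶜ, z j * ∑ i : S, X k i * b j i := by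
      rw [← Finset.sum_sub_distrib]
      exact Finset.sum_congr rfl fun j _ => by ring
    simp only [mul_add, Finset.sum_add_distrib]
    rw [h1, h2, h3]; ring
  have horth : ∀ i : S, ∑ k, X k i * h k = 0 := by
    intro i
    have : ∑ k, X k i * h k
        = ∑ j ∈ Sᶜ, z j * ∑ k, X k i * (X k j - ∑ i' : S, X k i' * b j i') := by
      simp only [h, Finset.mul_sum]
      rw [Finset.sum_comm]
      exact Finset.sum_congr rfl fun j _ => Finset.sum_congr rfl fun k _ => by ring
    rw [this]
    exact Finset.sum_eq_zero fun j hj => by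
      rw [(hb j (Finset.mem_compl.1 hj)).2 i, mul_zero]
  have hcorr : ∀ v : Fin n → ℝ, (1 / (n : ℝ)) * ∑ k, h k * v k
      = ∑ j ∈ Sᶜ, z j * (colCorr X v j - ∑ i : S, b j i * colCorr X v i) := by
    intro v
    have h1 : ∀ j, colCorr X v j - ∑ i : S, b j i * colCorr X v i
        = (1 / (n : ℝ)) * ∑ k, (X k j - ∑ i : S, X k i * b j i) * v k := by
      intro j
      simp only [colCorr, sub_mul, Finset.sum_sub_distrib, mul_sub, Finset.sum_mul]
      congr 1
      rw [Finset.sum_comm, Finset.mul_sum]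
      refine Finset.sum_congr rfl fun i _ => ?_
      simp only [Finset.mul_sum]
      exact Finset.sum_congr rfl fun k _ => by ring
    have h2 : ∑ k, h k * v k
        = ∑ j ∈ Sᶜ, z j * ∑ k, (X k j - ∑ i : S, X k i * b j i) * v k := by
      rw [Finset.sum_congr rfl fun k _ => Finset.sum_mul _ _ _, Finset.sum_comm]
      refine Finset.sum_congr rfl fun j _ => ?_
      rw [Finset.mul_sum]
      exact Finset.sum_congr rfl fun k _ => by ring
    rw [h2, Finset.mul_sum]
    refine Finset.sum_congr rfl fun j _ => ?_
    rw [h1]; ring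
  have hhr : ∑ k, h k * r k = ∑ k, h k * w k - ∑ k, h k ^ 2 := by
    have h1 : ∑ k, h k * (∑ i : S, X k i * (z i + ∑ j ∈ Sᶜ, z j * b j i)) = 0 := by
      rw [Finset.sum_congr rfl fun k _ => Finset.mul_sum _ _ _, Finset.sum_comm]
      refine Finset.sum_eq_zero fun i _ => ?_
      have : ∑ k, h k * (X k i * (z i + ∑ j ∈ Sᶜ, z j * b j i))
          = (∑ k, X k i * h k) * (z i + ∑ j ∈ Sᶜ, z j * b j i) := by
        rw [Finset.sum_mul]
        exact Finset.sum_congr rfl fun k _ => by ring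
      rw [this, horth i, zero_mul]
    have h2 : ∑ k, h k * r k = ∑ k, h k * w k - ∑ k, h k ^ 2
        - ∑ k, h k * (∑ i : S, X k i * (z i + ∑ j ∈ Sᶜ, z j * b j i)) := by
      rw [← Finset.sum_sub_distrib, ← Finset.sum_sub_distrib]
      refine Finset.sum_congr rfl fun k _ => ?_
      rw [hrz, Pi.sub_apply, hXz k]; ring
    rw [h2, h1, sub_zero]
  have hbound : ∀ (v : Fin n → ℝ) (B : ℝ), (∀ j, |colCorr X v j| ≤ B) → ∀ j, j ∉ S →
      |∑ i : S, b j i * colCorr X v i| ≤ α * B := by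
    intro v B hB j hj
    calc |∑ i : S, b j i * colCorr X v i| ≤ ∑ i : S, |b j i| * |colCorr X v i| := by
          refine (Finset.abs_sum_le_sum_abs _ _).trans (le_of_eq ?_)
          exact Finset.sum_congr rfl fun i _ => abs_mul _ _
      _ ≤ ∑ i : S, |b j i| * B := by gcongr with i _; exact hB i
      _ = (∑ i : S, |b j i|) * B := by rw [Finset.sum_mul]
      _ ≤ α * B := by
          have : 0 ≤ B := (abs_nonneg _).trans (hB j)
          gcongr
          exact (hb j hj).1.trans hα
  -- By stationarity the penalty of the error off `S` equals its pairing with the residual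
  -- correlations. Splitting each irrelevant column into regression plus orthogonal part bounds this
  -- by the pairing of `h` with `w`, at most `τ * (1 + α)` times the ℓ₁ error, plus `α * reg` times
  -- that error; the term `-‖h‖²` only helps. The margin `τ * (1 + α) < reg * (1 - α)` then leaves
  -- only zero.
  have hz1 : ∑ j ∈ Sᶜ, |z j| = 0 := by
    have e1 : reg * ∑ j ∈ Sᶜ, |z j| = ∑ j ∈ Sᶜ, z j * colCorr X r j := by
      rw [Finset.mul_sum]
      refine Finset.sum_congr rfl fun j hj => ?_
      rw [hzN j (Finset.mem_compl.1 hj), ← (hkkt j).2, mul_comm]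
    have e2 : ∑ j ∈ Sᶜ, z j * colCorr X r j ≤ (1 / (n : ℝ)) * ∑ k, h k * r k
        + α * reg * ∑ j ∈ Sᶜ, |z j| := by
      rw [hcorr r, Finset.mul_sum, ← Finset.sum_add_distrib]
      refine Finset.sum_le_sum fun j hj => ?_
      have := hbound r reg (fun j => (hkkt j).1) j (Finset.mem_compl.1 hj)
      have h3 : z j * ∑ i : S, b j i * colCorr X r i ≤ |z j| * (α * reg) := by
        refine (le_abs_self _).trans ?_
        rw [abs_mul]; gcongr
      linarith [mul_sub (z j) (colCorr X r j) (∑ i : S, b j i * colCorr X r i)]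
    have e3 : (1 / (n : ℝ)) * ∑ k, h k * r k ≤ (1 / (n : ℝ)) * ∑ k, h k * w k := by
      rw [hhr]
      have : 0 ≤ ∑ k, h k ^ 2 := Finset.sum_nonneg fun k _ => sq_nonneg _
      gcongr
      linarith
    have e4 : (1 / (n : ℝ)) * ∑ k, h k * w k ≤ τ * (1 + α) * ∑ j ∈ Sᶜ, |z j| := by
      rw [hcorr w, Finset.mul_sum]
      refine Finset.sum_le_sum fun j hj => ?_
      have h3 := hbound w τ hw j (Finset.mem_compl.1 hj)
      calc z j * (colCorr X w j - ∑ i : S, b j i * colCorr X w i)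
          ≤ |z j| * |colCorr X w j - ∑ i : S, b j i * colCorr X w i| := by
            rw [← abs_mul]; exact le_abs_self _
        _ ≤ |z j| * (τ + α * τ) := by
            gcongr
            exact (abs_sub _ _).trans (add_le_add (hw j) h3)
        _ = τ * (1 + α) * |z j| := by ring
    have e5 : 0 ≤ ∑ j ∈ Sᶜ, |z j| := Finset.sum_nonneg fun j _ => abs_nonneg _
    nlinarith
  refine ⟨fun j hj => ?_, fun j => ?_⟩
  · have := (Finset.sum_eq_zero_iff_of_nonneg fun j _ => abs_nonneg (z j)).1 hz1 j
      (Finset.mem_compl.2 hj)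
    rw [hzN j hj] at this
    exact abs_eq_zero.1 this
  -- The cone condition is trivial because the error off `S` is already known to vanish.
  · have hcone : ∑ j ∈ Sᶜ, |z j| ≤ α' * ∑ j ∈ S, |z j| := by
      rw [hz1]
      exact mul_nonneg hα' (Finset.sum_nonneg fun j _ => abs_nonneg _)
    have h1 := hX.curvature z hcone
    have h2 : ‖(1 / (n : ℝ)) • (X.transpose * X).mulVec z‖ ≤ reg + τ := by
      rw [pi_norm_le_iff_of_nonneg (by positivity)]
      intro j
      have : ((1 / (n : ℝ)) • (X.transpose * X).mulVec z) j = colCorr X w j - colCorr X r j := by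
        rw [hrz, ← Matrix.mulVec_mulVec]
        simp only [Pi.smul_apply, smul_eq_mul, colCorr, Matrix.mulVec, dotProduct,
          Matrix.transpose_apply, Pi.sub_apply, mul_sub, Finset.sum_sub_distrib]
        ring
      rw [this, Real.norm_eq_abs]
      linarith [abs_sub (colCorr X w j) (colCorr X r j), hw j, (hkkt j).1]
    rw [le_div_iff₀ hα₂]
    have h3 : |z j| ≤ ‖z‖ := norm_le_pi_norm z j
    have h4 : |θhat j - θ j| = |z j| := rfl
    rw [h4]
    nlinarith

/-! ### Concentration of linear functionals of the label noise -/

/-- Scaling a coordinate by `u k` multiplies its sub-Gaussian parameter by `u k ^ 2`, and the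
parameters of independent summands add. -/
lemma IsLabelNoise.hasSubgaussianMGF_linear {ρ : Measure ℝ} {σ : ℝ} (hρ : IsLabelNoise ρ σ)
    {n : ℕ} (u : Fin n → ℝ) :
    HasSubgaussianMGF (fun w : Fin n → ℝ => ∑ k, u k * w k)
      (σ ^ 2 * ∑ k, u k ^ 2).toNNReal (noiseLaw n ρ) := by
  have := hρ.prob
  have h0 : ∀ k : Fin n, HasSubgaussianMGF (fun w : Fin n → ℝ => w k) (σ ^ 2).toNNReal
      (noiseLaw n ρ) := fun k => by
    refine HasSubgaussianMGF.of_map (Y := fun w : Fin n → ℝ => w k) (X := id)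
      (measurable_pi_apply k).aemeasurable ?_
    have : (noiseLaw n ρ).map (fun w : Fin n → ℝ => w k) = ρ :=
      (measurePreserving_eval (fun _ : Fin n => ρ) k).map_eq
    rw [this]
    exact hρ.subGaussian
  have hind : iIndepFun (fun k (w : Fin n → ℝ) => u k * w k) (noiseLaw n ρ) :=
    iIndepFun_pi (X := fun k x => u k * x) fun k => by fun_prop
  have h1 := HasSubgaussianMGF.sum_of_iIndepFun hind (s := Finset.univ)
    fun k _ => (h0 k).const_mul (u k)
  convert h1 using 1
  ext
  push_cast
  rw [Real.coe_toNNReal _ (by positivity), Finset.mul_sum]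
  refine Finset.sum_congr rfl fun k _ => ?_
  refine (mul_comm _ _).trans (Eq.trans ?_ (NNReal.coe_mul _ _).symm)
  rw [Real.coe_toNNReal _ (by positivity)]
  rfl

lemma IsLabelNoise.measure_linear_ge_le {ρ : Measure ℝ} {σ : ℝ} (hρ : IsLabelNoise ρ σ)
    {n : ℕ} (u : Fin n → ℝ) {x : ℝ} (hx : 0 ≤ x) :
    noiseLaw n ρ {w | x ≤ ∑ k, u k * w k}
      ≤ ENNReal.ofReal (Real.exp (-x ^ 2 / (2 * (σ ^ 2 * ∑ k, u k ^ 2)))) := by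
  have := hρ.prob
  have : IsProbabilityMeasure (noiseLaw n ρ) := by unfold noiseLaw; infer_instance
  have h := (hρ.hasSubgaussianMGF_linear u).measure_ge_le hx
  rw [Real.coe_toNNReal _ (by positivity)] at h
  rw [← ENNReal.ofReal_toReal (measure_ne_top (noiseLaw n ρ) _)]
  exact ENNReal.ofReal_le_ofReal h

lemma measurable_colCorr {n d : ℕ} (X : Matrix (Fin n) (Fin d) ℝ) (j : Fin d) :
    Measurable fun w : Fin n → ℝ => colCorr X w j := by
  unfold colCorr
  fun_prop

/-- With high probability the noise is nearly uncorrelated with every column. -/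
lemma measure_colCorr_gt_le {n d : ℕ} {X : Matrix (Fin n) (Fin d) ℝ} {σ Ccol τ : ℝ}
    {ρ : Measure ℝ} (hρ : IsLabelNoise ρ σ) (hσ : 0 < σ) (hC : 0 < Ccol) (hτ : 0 < τ)
    (hn : 0 < n) (hX : ∀ j, ∑ k, X k j ^ 2 ≤ Ccol ^ 2 * n) :
    noiseLaw n ρ {w | ∃ j, τ < |colCorr X w j|}
      ≤ ENNReal.ofReal (2 * d * Real.exp (-(n * τ ^ 2 / (2 * (σ ^ 2 * Ccol ^ 2))))) := by
  have hn' : (0 : ℝ) < n := by exact_mod_cast hn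
  set E := ENNReal.ofReal (Real.exp (-(n * τ ^ 2 / (2 * (σ ^ 2 * Ccol ^ 2))))) with hE
  have key : ∀ u : Fin n → ℝ, ∑ k, u k ^ 2 ≤ Ccol ^ 2 * n →
      noiseLaw n ρ {w | n * τ < ∑ k, u k * w k} ≤ E := by
    intro u hu
    rcases (Finset.sum_nonneg fun k _ => sq_nonneg (u k) :
      0 ≤ ∑ k, u k ^ 2).eq_or_lt with h0 | h0
    -- For a zero column the tail bound degenerates: division by the zero variance proxy yields the
    -- bound 1. The event is empty since `n * τ > 0`.
    · have : {w : Fin n → ℝ | n * τ < ∑ k, u k * w k} = ∅ := by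
        have hu0 : ∀ k, u k = 0 := fun k => by
          simpa using (Finset.sum_eq_zero_iff_of_nonneg fun k _ => sq_nonneg (u k)).1 h0.symm k
            (Finset.mem_univ k)
        ext w
        simp only [hu0, zero_mul, Finset.sum_const_zero, Set.mem_ofPred_eq, Set.mem_empty_iff_false,
          iff_false, not_lt]
        positivity
      rw [this]; simp
    · refine (measure_mono fun w hw => ?_).trans
        ((hρ.measure_linear_ge_le u (x := n * τ) (by positivity)).trans ?_)
      · exact (show n * τ < ∑ k, u k * w k from hw).le
      · refine ENNReal.ofReal_le_ofReal (Real.exp_le_exp.2 ?_)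
        rw [neg_div, neg_le_neg_iff, div_le_div_iff₀ (by positivity) (by positivity)]
        have : n * τ ^ 2 * (2 * (σ ^ 2 * ∑ k, u k ^ 2))
            ≤ n * τ ^ 2 * (2 * (σ ^ 2 * (Ccol ^ 2 * n))) := by gcongr
        linarith
  have hsub : {w : Fin n → ℝ | ∃ j, τ < |colCorr X w j|} ⊆
      ⋃ j : Fin d, ({w | n * τ < ∑ k, X k j * w k} ∪ {w | n * τ < ∑ k, -X k j * w k}) := by
    rintro w ⟨j, hj⟩
    refine Set.mem_iUnion.2 ⟨j, ?_⟩
    have hc : ∑ k, X k j * w k = n * colCorr X w j := by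
      unfold colCorr; field_simp
    rcases lt_abs.1 hj with h | h
    · left
      rw [Set.mem_ofPred_eq, hc]
      gcongr
    · right
      simp only [Set.mem_ofPred_eq, neg_mul, Finset.sum_neg_distrib]
      rw [hc]
      nlinarith
  calc noiseLaw n ρ {w | ∃ j, τ < |colCorr X w j|}
      ≤ ∑ j : Fin d, noiseLaw n ρ
          ({w | n * τ < ∑ k, X k j * w k} ∪ {w | n * τ < ∑ k, -X k j * w k}) :=
        (measure_mono hsub).trans (measure_iUnion_fintype_le _ _)
    _ ≤ ∑ _j : Fin d, (E + E) := by
        gcongr with j _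
        refine (measure_union_le _ _).trans (add_le_add (key _ (hX j)) (key _ ?_))
        simpa using hX j
    _ = ENNReal.ofReal (2 * d * Real.exp (-(n * τ ^ 2 / (2 * (σ ^ 2 * Ccol ^ 2))))) := by
        rw [Finset.sum_const, Finset.card_univ, Fintype.card_fin, nsmul_eq_mul, ← two_mul, hE,
          ENNReal.ofReal_mul (by positivity), ENNReal.ofReal_mul (by positivity)]
        simp only [ENNReal.ofReal_natCast, ENNReal.ofReal_ofNat]
        ring

/-! ### Gaussian shifts and the sample complexity of pure supervised learning -/

lemma lintegral_pi_prod_eq {ι : Type*} [Fintype ι] {E : ι → Type*} [∀ i, MeasurableSpace (E i)]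
    (μ : ∀ i, Measure (E i)) [∀ i, IsProbabilityMeasure (μ i)] {f : ∀ i, E i → ℝ≥0∞}
    (hf : ∀ i, Measurable (f i)) :
    ∫⁻ x, ∏ i, f i (x i) ∂(Measure.pi μ) = ∏ i, ∫⁻ x, f i x ∂(μ i) := by
  rw [lintegral_prod_eq_prod_lintegral_of_indepFun (μ := Measure.pi μ) Finset.univ
    (fun i (x : ∀ i, E i) => f i (x i)) (iIndepFun_pi fun i => (hf i).aemeasurable)
    (fun i => (hf i).comp (measurable_pi_apply i))]
  refine Finset.prod_congr rfl fun i _ => ?_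
  exact (measurePreserving_eval μ i).lintegral_comp (hf i)

/-- The density of a shifted centred Gaussian with respect to the original one. -/
noncomputable def shiftDensity (σ u x : ℝ) : ℝ := Real.exp ((u * x - u ^ 2 / 2) / σ ^ 2)

lemma measurable_shiftDensity (σ u : ℝ) : Measurable (shiftDensity σ u) := by
  unfold shiftDensity; fun_prop

lemma gaussianReal_map_shift {σ : ℝ} (hσ : 0 < σ) (u : ℝ) :
    (gaussianReal 0 (σ ^ 2).toNNReal).map (fun x => x + u)
      = (gaussianReal 0 (σ ^ 2).toNNReal).withDensity
        fun x => ENNReal.ofReal (shiftDensity σ u x) := by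
  have hv : (σ ^ 2).toNNReal ≠ 0 := by
    simp only [ne_eq, Real.toNNReal_eq_zero, not_le]; positivity
  rw [gaussianReal_map_add_const, gaussianReal_of_var_ne_zero _ hv,
    gaussianReal_of_var_ne_zero _ hv, ← withDensity_mul _ (measurable_gaussianPDF _ _)
      (measurable_shiftDensity σ u).ennreal_ofReal]
  congr 1
  funext x
  rw [Pi.mul_apply, gaussianPDF, gaussianPDF,
    ← ENNReal.ofReal_mul (gaussianPDFReal_nonneg _ _ _)]
  congr 1
  rw [gaussianPDFReal, gaussianPDFReal, shiftDensity, Real.coe_toNNReal _ (by positivity)]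
  conv_rhs => rw [mul_assoc, ← Real.exp_add]
  congr 2
  field_simp
  ring

/-- Finite-dimensional Cameron–Martin formula. It suffices to test boxes, where indicator times
density factors over the coordinates. -/
lemma noiseLaw_gaussian_map_shift {σ : ℝ} (hσ : 0 < σ) {n : ℕ} (u : Fin n → ℝ) :
    (noiseLaw n (gaussianReal 0 (σ ^ 2).toNNReal)).map (fun w => w + u)
      = (noiseLaw n (gaussianReal 0 (σ ^ 2).toNNReal)).withDensity
        fun w => ∏ k, ENNReal.ofReal (shiftDensity σ (u k) (w k)) := by
  have h1 : (noiseLaw n (gaussianReal 0 (σ ^ 2).toNNReal)).map (fun w => w + u)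
      = Measure.pi fun k => (gaussianReal 0 (σ ^ 2).toNNReal).map (fun x => x + u k) := by
    have : ∀ k, IsProbabilityMeasure
        ((gaussianReal 0 (σ ^ 2).toNNReal).map (fun x => x + u k)) := fun k =>
      Measure.isProbabilityMeasure_map (by fun_prop)
    exact Measure.pi_map_pi (f := fun k x => x + u k) fun k => by fun_prop
  rw [h1]
  have : ∀ k, IsProbabilityMeasure
      ((gaussianReal 0 (σ ^ 2).toNNReal).map (fun x => x + u k)) := fun k =>
    Measure.isProbabilityMeasure_map (by fun_prop)
  refine Measure.pi_eq fun s hs => ?_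
  rw [withDensity_apply _ (MeasurableSet.univ_pi hs),
    ← lintegral_indicator (MeasurableSet.univ_pi hs)]
  have h2 : ∀ w : Fin n → ℝ, (Set.univ.pi s).indicator
      (fun w => ∏ k, ENNReal.ofReal (shiftDensity σ (u k) (w k))) w
      = ∏ k, (s k).indicator (fun x => ENNReal.ofReal (shiftDensity σ (u k) x)) (w k) := by
    intro w
    by_cases hw : w ∈ Set.univ.pi s
    · rw [Set.indicator_of_mem hw]
      exact Finset.prod_congr rfl fun k _ =>
        (Set.indicator_of_mem (hw k (Set.mem_univ k))
          fun x => ENNReal.ofReal (shiftDensity σ (u k) x)).symm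
    · rw [Set.indicator_of_notMem hw]
      simp only [Set.mem_univ_pi, not_forall] at hw
      obtain ⟨k, hk⟩ := hw
      exact (Finset.prod_eq_zero (Finset.mem_univ k) (Set.indicator_of_notMem hk _)).symm
  simp only [h2]
  unfold noiseLaw
  rw [lintegral_pi_prod_eq (f := fun k => (s k).indicator
    fun x => ENNReal.ofReal (shiftDensity σ (u k) x)) _
    fun k => (measurable_shiftDensity σ (u k)).ennreal_ofReal.indicator (hs k)]
  refine Finset.prod_congr rfl fun k _ => ?_
  rw [lintegral_indicator (hs k), gaussianReal_map_shift hσ, withDensity_apply _ (hs k)]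

/-- Change of measure: shifting Gaussian noise by `u` increases probabilities by a factor of at
most `exp ℓ`, up to the event that the log-likelihood ratio exceeds `ℓ`. -/
lemma noiseLaw_gaussian_shift_le {σ : ℝ} (hσ : 0 < σ) {n : ℕ} (u : Fin n → ℝ) (l : ℝ)
    {A : Set (Fin n → ℝ)} (hA : MeasurableSet A) :
    noiseLaw n (gaussianReal 0 (σ ^ 2).toNNReal) {w | w + u ∈ A}
      ≤ noiseLaw n (gaussianReal 0 (σ ^ 2).toNNReal)
          {w | σ ^ 2 * l - (∑ k, u k ^ 2) / 2 < ∑ k, u k * w k}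
        + ENNReal.ofReal (Real.exp l)
          * noiseLaw n (gaussianReal 0 (σ ^ 2).toNNReal) A := by
  set γ := noiseLaw n (gaussianReal 0 (σ ^ 2).toNNReal) with hγ
  set D : (Fin n → ℝ) → ℝ≥0∞ := fun w => ∏ k, ENNReal.ofReal (shiftDensity σ (u k) (w k))
    with hD
  have hDm : Measurable D := by
    refine Finset.measurable_fun_prod _ fun k _ => ?_
    exact ((measurable_shiftDensity σ (u k)).comp (measurable_pi_apply k)).ennreal_ofReal
  set B : Set (Fin n → ℝ) := {w | D w ≤ ENNReal.ofReal (Real.exp l)} with hB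
  have hBm : MeasurableSet B := hDm measurableSet_Iic
  have hDw : ∀ w, D w
      = ENNReal.ofReal (Real.exp ((∑ k, u k * w k - (∑ k, u k ^ 2) / 2) / σ ^ 2)) := by
    intro w
    change ∏ k, ENNReal.ofReal (shiftDensity σ (u k) (w k)) = _
    rw [← ENNReal.ofReal_prod_of_nonneg fun k _ => by unfold shiftDensity; positivity]
    simp only [shiftDensity]
    rw [← Real.exp_sum, ← Finset.sum_div, Finset.sum_sub_distrib, Finset.sum_div]
  -- The likelihood ratio is evaluated at the shifted point `w + u`, which adds `‖u‖²` to the inner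
  -- product. This turns `-‖u‖²/2` into `+‖u‖²/2` and explains the threshold.
  have hsub : {w | w + u ∈ A} ⊆ {w | σ ^ 2 * l - (∑ k, u k ^ 2) / 2 < ∑ k, u k * w k}
      ∪ (fun w => w + u) ⁻¹' (A ∩ B) := by
    intro w hw
    by_cases h : w + u ∈ B
    · exact Or.inr ⟨hw, h⟩
    · left
      rw [hB, Set.mem_ofPred_eq, not_le, hDw,
        ENNReal.ofReal_lt_ofReal_iff (Real.exp_pos _), Real.exp_lt_exp,
        lt_div_iff₀ (by positivity)] at h
      have h3 : ∑ k, u k * (w + u) k = ∑ k, u k * w k + ∑ k, u k ^ 2 := by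
        rw [← Finset.sum_add_distrib]
        exact Finset.sum_congr rfl fun k _ => by rw [Pi.add_apply]; ring
      rw [h3] at h
      rw [Set.mem_ofPred_eq]
      linarith
  refine (measure_mono hsub).trans ((measure_union_le _ _).trans ?_)
  gcongr
  have hm : Measurable fun w : Fin n → ℝ => w + u := by fun_prop
  rw [← Measure.map_apply hm (hA.inter hBm), hγ, noiseLaw_gaussian_map_shift hσ,
    withDensity_apply _ (hA.inter hBm), ← hγ]
  calc ∫⁻ w in A ∩ B, D w ∂γ ≤ ∫⁻ _ in A ∩ B, ENNReal.ofReal (Real.exp l) ∂γ :=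
        setLIntegral_mono measurable_const fun w hw => hw.2
    _ = ENNReal.ofReal (Real.exp l) * γ (A ∩ B) := by rw [setLIntegral_const]
    _ ≤ ENNReal.ofReal (Real.exp l) * γ A := by
        gcongr; exact Set.inter_subset_left

lemma isLabelNoise_gaussianReal (σ : ℝ) : IsLabelNoise (gaussianReal 0 (σ ^ 2).toNNReal) σ where
  prob := inferInstance
  centred := by simp
  subGaussian :=
    { integrable_exp_mul := fun t => integrable_exp_mul_gaussianReal t
      mgf_le := fun t => by rw [mgf_id_gaussianReal]; simp }

/-- The log-likelihood ratio of a shift is rarely large. -/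
lemma noiseLaw_logLikelihood_gt_le {σ l : ℝ} (hσ : 0 < σ) (hl : 1 ≤ l) {n : ℕ} (u : Fin n → ℝ) :
    noiseLaw n (gaussianReal 0 (σ ^ 2).toNNReal)
        {w | σ ^ 2 * l - (∑ k, u k ^ 2) / 2 < ∑ k, u k * w k}
      ≤ ENNReal.ofReal (9 / (σ ^ 2 * l) * ∑ k, u k ^ 2) := by
  set γ := noiseLaw n (gaussianReal 0 (σ ^ 2).toNNReal) with hγ
  have : IsProbabilityMeasure γ := by rw [hγ]; unfold noiseLaw; infer_instance
  set Q := ∑ k, u k ^ 2 with hQ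
  have hQ0 : 0 ≤ Q := Finset.sum_nonneg fun k _ => sq_nonneg _
  -- If `Q ≥ σ² l`, the claimed bound exceeds 1. Otherwise the threshold is at least `σ² l / 2`, and
  -- the Gaussian tail is relaxed by `exp (-y) ≤ 1 / y`. The result is linear in `Q` on purpose, so
  -- that it can be averaged over a prior.
  rcases le_or_gt (σ ^ 2 * l) Q with h | h
  · refine prob_le_one.trans (ENNReal.one_le_ofReal.2 ?_)
    rw [div_mul_eq_mul_div, le_div_iff₀ (by positivity)]
    linarith
  · rcases hQ0.eq_or_lt with h0 | h0
    · have hu0 : ∀ k, u k = 0 := fun k => by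
        simpa using (Finset.sum_eq_zero_iff_of_nonneg fun k _ => sq_nonneg (u k)).1 h0.symm k
          (Finset.mem_univ k)
      have : {w : Fin n → ℝ | σ ^ 2 * l - Q / 2 < ∑ k, u k * w k} = ∅ := by
        ext w
        simp only [hu0, zero_mul, Finset.sum_const_zero, Set.mem_ofPred_eq,
          Set.mem_empty_iff_false, iff_false, not_lt]
        linarith
      rw [this]; simp
    · refine (measure_mono fun w hw => ?_).trans
        (((isLabelNoise_gaussianReal σ).measure_linear_ge_le u
          (x := σ ^ 2 * l / 2) (by positivity)).trans (ENNReal.ofReal_le_ofReal ?_))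
      · have : σ ^ 2 * l - Q / 2 < ∑ k, u k * w k := hw
        rw [Set.mem_ofPred_eq]
        linarith
      · rw [← hQ]
        have hy : -(σ ^ 2 * l / 2) ^ 2 / (2 * (σ ^ 2 * Q)) = -(σ ^ 2 * l ^ 2 / (8 * Q)) := by
          field_simp; ring
        rw [hy, Real.exp_neg]
        have h1 : σ ^ 2 * l ^ 2 / (8 * Q) ≤ Real.exp (σ ^ 2 * l ^ 2 / (8 * Q)) := by
          linarith [Real.add_one_le_exp (σ ^ 2 * l ^ 2 / (8 * Q))]
        calc (Real.exp (σ ^ 2 * l ^ 2 / (8 * Q)))⁻¹ ≤ (σ ^ 2 * l ^ 2 / (8 * Q))⁻¹ :=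
              inv_anti₀ (by positivity) h1
          _ = 8 / (σ ^ 2 * (l * l)) * Q := by rw [inv_div]; ring
          _ ≤ 9 / (σ ^ 2 * l) * Q := by
              gcongr
              · norm_num
              · nlinarith

/-- The uniform law on `[-b, b]`. -/
noncomputable def symmUniform (b : ℝ) : Measure ℝ := cond volume (Set.Icc (-b) b)

lemma isProbabilityMeasure_symmUniform {b : ℝ} (hb : 0 < b) :
    IsProbabilityMeasure (symmUniform b) := by
  refine cond_isProbabilityMeasure_of_finite ?_ ?_
  · rw [Real.volume_Icc, ne_eq, ENNReal.ofReal_eq_zero, not_le]; linarith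
  · rw [Real.volume_Icc]; exact ENNReal.ofReal_ne_top

lemma ae_symmUniform_abs_le (b : ℝ) : ∀ᵐ x ∂symmUniform b, |x| ≤ b := by
  have : ∀ᵐ x ∂symmUniform b, x ∈ Set.Icc (-b) b :=
    ae_cond_mem measurableSet_Icc
  filter_upwards [this] with x hx
  exact abs_le.2 hx

lemma memLp_id_symmUniform {b : ℝ} (hb : 0 < b) : MemLp (fun x : ℝ => x) 2 (symmUniform b) := by
  have := isProbabilityMeasure_symmUniform hb
  exact MemLp.of_bound (by fun_prop) b (ae_symmUniform_abs_le b)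

lemma integral_id_symmUniform {b : ℝ} (hb : 0 < b) : ∫ x, x ∂symmUniform b = 0 := by
  unfold symmUniform ProbabilityTheory.cond
  rw [integral_smul_measure, integral_Icc_eq_integral_Ioc,
    ← intervalIntegral.integral_of_le (by linarith), integral_id]
  simp

lemma variance_symmUniform_le {b : ℝ} (hb : 0 < b) : Var[fun x : ℝ => x; symmUniform b] ≤ b ^ 2 := by
  have := isProbabilityMeasure_symmUniform hb
  have h := variance_le_sq_of_bounded (μ := symmUniform b) (X := fun x : ℝ => x) (a := -b) (b := b)
    (by filter_upwards [ae_symmUniform_abs_le b] with x hx using abs_le.1 hx) (by fun_prop)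
  calc _ ≤ ((b - -b) / 2) ^ 2 := h
    _ = b ^ 2 := by ring

/-- The coordinates are independent and centred, so the second moment is a variance and adds up over
them. -/
lemma integral_sq_linear_symmUniform_le {b : ℝ} (hb : 0 < b) {d : ℕ} (c : Fin d → ℝ) :
    Integrable (fun g : Fin d → ℝ => (∑ j, c j * g j) ^ 2) (Measure.pi fun _ => symmUniform b) ∧
    ∫ g, (∑ j, c j * g j) ^ 2 ∂(Measure.pi fun _ : Fin d => symmUniform b)
      ≤ (∑ j, c j ^ 2) * b ^ 2 := by
  have := isProbabilityMeasure_symmUniform hb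
  set π := Measure.pi fun _ : Fin d => symmUniform b with hπ
  have hmem1 : ∀ j, MemLp (fun x : ℝ => c j * x) 2 (symmUniform b) := fun j =>
    (memLp_id_symmUniform hb).const_mul (c j)
  have hmem : ∀ j, MemLp (fun g : Fin d → ℝ => c j * g j) 2 π := fun j =>
    (hmem1 j).comp_measurePreserving (measurePreserving_eval (fun _ => symmUniform b) j)
  have hsum : MemLp (fun g : Fin d → ℝ => ∑ j, c j * g j) 2 π :=
    memLp_finsetSum Finset.univ fun j _ => hmem j
  refine ⟨hsum.integrable_sq, ?_⟩
  have hmean : ∫ g, ∑ j, c j * g j ∂π = 0 := by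
    rw [integral_finsetSum _ fun j _ => (hmem j).integrable (by norm_num)]
    refine Finset.sum_eq_zero fun j _ => ?_
    rw [integral_const_mul]
    have h1 : ∫ g, g j ∂π = ∫ x, x ∂symmUniform b := by
      have := integral_map (μ := π) (φ := Function.eval j) (f := fun x : ℝ => x)
        (measurable_pi_apply j).aemeasurable (by fun_prop)
      rw [hπ, (measurePreserving_eval (fun _ : Fin d => symmUniform b) j).map_eq] at this
      exact this.symm
    rw [h1, integral_id_symmUniform hb, mul_zero]
  have hvar := variance_of_integral_eq_zero hsum.aestronglyMeasurable.aemeasurable hmean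
  have hvs := variance_sum_pi (μ := fun _ : Fin d => symmUniform b)
    (X := fun j x => c j * x) hmem1
  have hfun : (∑ j, fun g : Fin d → ℝ => c j * g j) = fun g => ∑ j, c j * g j := by
    funext g; simp
  rw [hfun, ← hπ, hvar] at hvs
  rw [hvs, Finset.sum_mul]
  refine Finset.sum_le_sum fun j _ => ?_
  rw [variance_const_mul]
  gcongr
  exact variance_symmUniform_le hb

/-- One coordinate's factor in an exponential Markov bound for the mass of a ball: extend the
Gaussian integral to the whole line and divide by the length `2 * b`. -/
lemma lintegral_exp_symmUniform_le {b q : ℝ} (hb : 0 < b) (hq : 0 < q) (a : ℝ) :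
    ∫⁻ x, ENNReal.ofReal (Real.exp (1 - q * (x - a) ^ 2)) ∂symmUniform b
      ≤ ENNReal.ofReal (Real.exp 1 * √(Real.pi / q) / (2 * b)) := by
  unfold symmUniform ProbabilityTheory.cond
  have h0 : Integrable fun x : ℝ => Real.exp (1 - q * (x - a) ^ 2) := by
    have := ((integrable_exp_neg_mul_sq hq).comp_sub_right a).const_mul (Real.exp 1)
    refine this.congr (ae_of_all _ fun x => ?_)
    simp only
    rw [← Real.exp_add]; congr 1; ring
  have h1 : ∫⁻ x, ENNReal.ofReal (Real.exp (1 - q * (x - a) ^ 2))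
      = ENNReal.ofReal (Real.exp 1 * √(Real.pi / q)) := by
    rw [← ofReal_integral_eq_lintegral_ofReal h0 (ae_of_all _ fun x => (Real.exp_pos _).le)]
    congr 1
    rw [← integral_gaussian q, ← integral_const_mul,
      ← integral_sub_right_eq_self (fun x => Real.exp 1 * Real.exp (-q * x ^ 2)) a]
    refine integral_congr_ae (ae_of_all _ fun x => ?_)
    simp only
    rw [← Real.exp_add]; congr 1; ring
  rw [lintegral_smul_measure, Real.volume_Icc, smul_eq_mul]
  calc (ENNReal.ofReal (b - -b))⁻¹ * ∫⁻ x in Set.Icc (-b) b,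
        ENNReal.ofReal (Real.exp (1 - q * (x - a) ^ 2))
      ≤ (ENNReal.ofReal (b - -b))⁻¹ * ENNReal.ofReal (Real.exp 1 * √(Real.pi / q)) := by
        gcongr
        exact (setLIntegral_le_lintegral _ _).trans h1.le
    _ = ENNReal.ofReal (Real.exp 1 * √(Real.pi / q) / (2 * b)) := by
        rw [← ENNReal.ofReal_inv_of_pos (by linarith), ← ENNReal.ofReal_mul (by
          rw [inv_nonneg]; linarith)]
        congr 1
        rw [show b - -b = 2 * b by ring]
        ring

/-- Restriction of a vector to a set of coordinates. -/
def maskOn {d : ℕ} (S : Finset (Fin d)) (g : Fin d → ℝ) : Fin d → ℝ :=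
  fun i => if i ∈ S then g i else 0

lemma measurable_maskOn {d : ℕ} (S : Finset (Fin d)) : Measurable (maskOn S) := by
  unfold maskOn
  refine measurable_pi_lambda _ fun i => ?_
  split_ifs <;> fun_prop

lemma measurable_l2dist {d : ℕ} :
    Measurable fun p : (Fin d → ℝ) × (Fin d → ℝ) => l2dist p.1 p.2 := by
  unfold l2dist
  fun_prop

/-- A uniform prior puts little mass on a Euclidean ball. -/
lemma prior_ball_le {b ε : ℝ} (hb : 0 < b) (hε : 0 < ε) {d : ℕ} {S : Finset (Fin d)}
    (hS : 1 ≤ S.card) (t c : Fin d → ℝ) :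
    (Measure.pi fun _ : Fin d => symmUniform b) {g | l2dist t (c + maskOn S g) ≤ ε}
      ≤ ENNReal.ofReal
        ((Real.exp 1 * √(Real.pi / (S.card / ε ^ 2)) / (2 * b)) ^ S.card) := by
  have := isProbabilityMeasure_symmUniform hb
  -- Exponential Markov inequality. With this `q`, the sum over `S` of `1 - q * (·)²` is nonnegative
  -- on the ball of radius `ε`, so a product of one-dimensional functions dominates its indicator.
  -- Coordinates off `S` contribute the factor 1.
  set q : ℝ := S.card / ε ^ 2 with hq
  have hS' : (0 : ℝ) < S.card := by exact_mod_cast hS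
  have hq0 : 0 < q := by positivity
  let f : Fin d → ℝ → ℝ≥0∞ := fun i x =>
    if i ∈ S then ENNReal.ofReal (Real.exp (1 - q * (x - (t i - c i)) ^ 2)) else 1
  have hfm : ∀ i, Measurable (f i) := fun i => by
    by_cases hi : i ∈ S
    · simp only [f, hi, if_true]; fun_prop
    · simp only [f, hi, if_false]; fun_prop
  have hfprod : ∀ F : Fin d → ℝ≥0∞, (∀ i, i ∉ S → F i = 1) → ∏ i, F i = ∏ i ∈ S, F i :=
    fun F hF => (Finset.prod_subset (Finset.subset_univ S) fun i _ hi => hF i hi).symm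
  have hle : ∀ g : Fin d → ℝ,
      {g : Fin d → ℝ | l2dist t (c + maskOn S g) ≤ ε}.indicator (fun _ => (1 : ℝ≥0∞)) g
        ≤ ∏ i, f i (g i) := by
    intro g
    by_cases hg : l2dist t (c + maskOn S g) ≤ ε
    · rw [Set.indicator_of_mem (show g ∈ {g | l2dist t (c + maskOn S g) ≤ ε} from hg),
        hfprod _ fun i hi => by simp [f, hi]]
      have h1 : ∏ i ∈ S, f i (g i)
          = ENNReal.ofReal (Real.exp (∑ i ∈ S, (1 - q * (g i - (t i - c i)) ^ 2))) := by
        rw [Real.exp_sum, ENNReal.ofReal_prod_of_nonneg fun i _ => (Real.exp_pos _).le]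
        exact Finset.prod_congr rfl fun i hi => by simp [f, hi]
      rw [h1, ENNReal.one_le_ofReal, Real.one_le_exp_iff, Finset.sum_sub_distrib,
        ← Finset.mul_sum, Finset.sum_const, nsmul_eq_mul, mul_one, sub_nonneg]
      have h2 : ∑ j, (t j - (c + maskOn S g) j) ^ 2 ≤ ε ^ 2 := by
        unfold l2dist at hg
        exact (Real.sqrt_le_left hε.le).1 hg
      have h3 : ∑ i ∈ S, (g i - (t i - c i)) ^ 2 ≤ ε ^ 2 := by
        refine le_trans ?_ h2
        refine le_trans (le_of_eq ?_) (Finset.sum_le_sum_of_subset_of_nonneg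
          (Finset.subset_univ S) fun i _ _ => sq_nonneg _)
        refine Finset.sum_congr rfl fun i hi => ?_
        simp only [Pi.add_apply, maskOn, hi, if_true]
        ring
      calc q * ∑ i ∈ S, (g i - (t i - c i)) ^ 2 ≤ q * ε ^ 2 := by gcongr
        _ = S.card := by rw [hq]; field_simp
    · rw [Set.indicator_of_notMem (show g ∉ {g | l2dist t (c + maskOn S g) ≤ ε} from hg)]
      exact zero_le
  have hmeas : MeasurableSet {g : Fin d → ℝ | l2dist t (c + maskOn S g) ≤ ε} := by
    have h1 : Measurable fun g : Fin d → ℝ => (t, c + maskOn S g) := by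
      have := measurable_maskOn S
      fun_prop
    exact (measurable_l2dist.comp h1) measurableSet_Iic
  rw [← lintegral_indicator_one hmeas]
  calc _ ≤ ∫⁻ g, ∏ i, f i (g i) ∂(Measure.pi fun _ : Fin d => symmUniform b) :=
        lintegral_mono hle
    _ = ∏ i, ∫⁻ x, f i x ∂symmUniform b := lintegral_pi_prod_eq _ hfm
    _ = ∏ i ∈ S, ∫⁻ x, f i x ∂symmUniform b := hfprod _ fun i hi => by simp [f, hi]
    _ ≤ ∏ i ∈ S, ENNReal.ofReal (Real.exp 1 * √(Real.pi / q) / (2 * b)) := by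
        gcongr with i hi
        simp only [f, hi, if_true]
        exact lintegral_exp_symmUniform_le hb hq0 _
    _ = _ := by
        rw [Finset.prod_const, ENNReal.ofReal_pow (by positivity)]

/-- The average energy of the signal under the uniform prior. -/
lemma lintegral_signal_energy_le {b Ccol K : ℝ} (hb : 0 < b) (hK : 0 ≤ K) {n d : ℕ}
    {S : Finset (Fin d)} {X : Matrix (Fin n) (Fin d) ℝ}
    (hX : ∀ j, ∑ k, X k j ^ 2 ≤ Ccol ^ 2 * n) :
    ∫⁻ g, ENNReal.ofReal (K * ∑ k, X.mulVec (maskOn S g) k ^ 2)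
        ∂(Measure.pi fun _ : Fin d => symmUniform b)
      ≤ ENNReal.ofReal (K * (S.card * (Ccol ^ 2 * n) * b ^ 2)) := by
  have := isProbabilityMeasure_symmUniform hb
  set π := Measure.pi fun _ : Fin d => symmUniform b with hπ
  have hmul : ∀ (g : Fin d → ℝ) k, X.mulVec (maskOn S g) k
      = ∑ j, (if j ∈ S then X k j else 0) * g j := by
    intro g k
    rw [Matrix.mulVec, dotProduct]
    refine Finset.sum_congr rfl fun j _ => ?_
    simp only [maskOn]
    split_ifs <;> simp
  simp only [hmul]
  have hint := fun k : Fin n =>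
    integral_sq_linear_symmUniform_le hb fun j : Fin d => if j ∈ S then X k j else 0
  rw [← ofReal_integral_eq_lintegral_ofReal
    ((integrable_finsetSum _ fun k _ => (hint k).1).const_mul K)
    (ae_of_all _ fun g => mul_nonneg hK (Finset.sum_nonneg fun k _ => sq_nonneg _))]
  refine ENNReal.ofReal_le_ofReal ?_
  rw [integral_const_mul, integral_finsetSum _ fun k _ => (hint k).1]
  gcongr
  calc _ ≤ ∑ k, (∑ j, (if j ∈ S then X k j else 0) ^ 2) * b ^ 2 :=
        Finset.sum_le_sum fun k _ => (hint k).2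
    _ = (∑ j ∈ S, ∑ k, X k j ^ 2) * b ^ 2 := by
        rw [← Finset.sum_mul, Finset.sum_comm]
        congr 1
        rw [← Finset.sum_subset (Finset.subset_univ S) (fun j _ hj => by simp [hj])]
        exact Finset.sum_congr rfl fun j hj => by simp [hj]
    _ ≤ (∑ _j ∈ S, Ccol ^ 2 * n) * b ^ 2 := by
        gcongr with j _
        exact hX j
    _ = _ := by rw [Finset.sum_const, nsmul_eq_mul]

/-- The price per coordinate in the lower bound: `e` from the change of measure times `e √π / 2`
from the mass of the ball. -/
lemma exp_two_mul_sqrt_pi_div_two_le : Real.exp 1 * (Real.exp 1 * √Real.pi) / 2 ≤ 7 := by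
  have h1 : Real.exp 1 ≤ 2.72 := by linarith [Real.exp_one_lt_d9]
  have h2 : √Real.pi ≤ 1.8 := by
    rw [Real.sqrt_le_left (by norm_num)]
    linarith [Real.pi_lt_d2]
  have h3 : 0 < Real.exp 1 := Real.exp_pos 1
  have h4 : Real.exp 1 * (Real.exp 1 * √Real.pi) ≤ 2.72 * (2.72 * 1.8) := by gcongr
  linarith

/-- **Sample complexity of pure supervised learning.** Any estimator that solves the alignment
problem needs a number of labels of order `s σ² / ε²`. -/
theorem pureSL_sample_lower_bound {Ccol δbar : ℝ} (hC : 0 < Ccol) (hδ0 : 0 < δbar)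
    (hδ1 : δbar < 1) :
    ∃ c : ℝ, 0 < c ∧ ∀ {n d : ℕ} {X : Matrix (Fin n) (Fin d) ℝ} {S : Finset (Fin d)}
      {β σ ε δ : ℝ}, 1 ≤ S.card → 0 < β → 0 < σ → 0 < ε → 0 < δ → δ ≤ δbar →
      (∀ j, ∑ k, X k j ^ 2 ≤ Ccol ^ 2 * n) → PureSLSolves X S β σ ε δ →
      c * (S.card * σ ^ 2 / ε ^ 2) < n := by
  set η := 1 - δbar with hη
  have hη0 : 0 < η := by linarith
  have hη1 : η < 1 := by linarith
  -- Width of the prior in units of `ε / √s`: it makes the factor per coordinate at most `7 / R = η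
  -- / 4`.
  set R := 28 / η with hR
  have hR0 : 0 < R := by positivity
  -- Chosen so that, with at most this multiple of `s σ² / ε²` labels, the averaged energy term is
  -- at most `η / 4`. Both error terms together are then `η / 2`, less than `1 - δ ≥ η`.
  refine ⟨η / (36 * Ccol ^ 2 * R ^ 2), by positivity, ?_⟩
  intro n d X S β σ ε δ hS hβ hσ hε hδpos hδ hX hsolve
  by_contra! hn
  obtain ⟨reg, -, est, ⟨hest, -⟩, hsucc⟩ := hsolve
  set s : ℝ := (S.card : ℝ) with hs
  have hs1 : 1 ≤ s := by rw [hs]; exact_mod_cast hS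
  have hs0 : 0 < s := by linarith
  set b := R * ε / √s with hb
  have hsq : 0 < √s := Real.sqrt_pos.2 hs0
  have hb0 : 0 < b := by positivity
  have hb2 : b ^ 2 = R ^ 2 * ε ^ 2 / s := by
    rw [hb, div_pow, Real.sq_sqrt hs0.le, mul_pow]
  have := isProbabilityMeasure_symmUniform hb0
  set π := Measure.pi fun _ : Fin d => symmUniform b with hπ
  set ρ := gaussianReal 0 (σ ^ 2).toNNReal with hρ
  set γ := noiseLaw n ρ with hγ
  have : IsProbabilityMeasure γ := by rw [hγ]; unfold noiseLaw; infer_instance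
  -- The base point lies `b` above the threshold, so that every perturbation by at most `b` stays in
  -- the parameter class.
  set θ₀ : Fin d → ℝ := fun i => if i ∈ S then β + b else 0 with hθ₀
  set A : (Fin d → ℝ) → Set (Fin n → ℝ) := fun g =>
    {w | l2dist (est (X.mulVec θ₀ + w)) (θ₀ + maskOn S g) ≤ ε} with hA
  have hjoint : MeasurableSet {p : (Fin d → ℝ) × (Fin n → ℝ) | p.2 ∈ A p.1} := by
    have h1 : Measurable fun p : (Fin d → ℝ) × (Fin n → ℝ) =>
        (est (X.mulVec θ₀ + p.2), θ₀ + maskOn S p.1) := by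
      have := measurable_maskOn S
      refine Measurable.prodMk (hest.comp (by fun_prop)) (by fun_prop)
    exact (measurable_l2dist.comp h1) measurableSet_Iic
  have hAm : ∀ g, MeasurableSet (A g) := fun g => measurable_prodMk_left hjoint
  have hclass : ∀ᵐ g ∂π, θ₀ + maskOn S g ∈ sparseClass S β := by
    have h1 : ∀ j, ∀ᵐ g ∂π, |g j| ≤ b := fun j =>
      (measurePreserving_eval (fun _ : Fin d => symmUniform b) j).quasiMeasurePreserving.ae
        (ae_symmUniform_abs_le b)
    filter_upwards [ae_all_iff.2 h1] with g hg
    refine ⟨fun i hi => ?_, fun i hi => ?_⟩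
    · simp only [hθ₀, Pi.add_apply, maskOn, hi, if_true]
      have := (abs_le.1 (hg i)).1
      rw [le_abs]; left; linarith
    · simp [hθ₀, maskOn, hi]
  -- Data with parameter `θ₀ + maskOn S g` are data with parameter `θ₀` whose noise is shifted by
  -- `u`. Changing measure at log-likelihood level `s` makes the law of the data independent of `g`.
  have hpoint : ∀ᵐ g ∂π, ENNReal.ofReal (1 - δ)
      ≤ ENNReal.ofReal (9 / (σ ^ 2 * s) * ∑ k, X.mulVec (maskOn S g) k ^ 2)
        + ENNReal.ofReal (Real.exp s) * γ (A g) := by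
    filter_upwards [hclass] with g hg
    set u := X.mulVec (maskOn S g) with hu
    have h1 := hsucc _ hg ρ (isLabelNoise_gaussianReal σ)
    have h2 : {w | w + u ∈ A g}ᶜ
        = {w | ¬ l2dist (est (X.mulVec (θ₀ + maskOn S g) + w)) (θ₀ + maskOn S g) ≤ ε} := by
      ext w
      simp only [hA, Set.mem_compl_iff, Set.mem_ofPred_eq]
      rw [Matrix.mulVec_add, ← hu, add_assoc, add_comm u w]
    rw [← hγ, ← h2] at h1
    have hm : MeasurableSet {w | w + u ∈ A g} :=
      (show Measurable fun w : Fin n → ℝ => w + u by fun_prop) (hAm g)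
    have h3 : ENNReal.ofReal (1 - δ) ≤ γ {w | w + u ∈ A g} := by
      have h4 := prob_add_prob_compl (μ := γ) hm
      rw [ENNReal.ofReal_sub _ hδpos.le, ENNReal.ofReal_one, tsub_le_iff_right, ← h4]
      gcongr
    refine h3.trans ((noiseLaw_gaussian_shift_le hσ u s (hAm g)).trans ?_)
    gcongr
    exact noiseLaw_logLikelihood_gt_le hσ hs1 u
  -- Fubini: for fixed data the estimate is a fixed point, and only the prior mass of the ball
  -- around it counts.
  have hball : ∫⁻ g, γ (A g) ∂π
      ≤ ENNReal.ofReal ((Real.exp 1 * √(Real.pi / (s / ε ^ 2)) / (2 * b)) ^ S.card) := by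
    have h1 : ∫⁻ g, γ (A g) ∂π = ∫⁻ w, π {g | w ∈ A g} ∂γ := by
      have e1 := Measure.prod_apply (μ := π) (ν := γ) hjoint
      have e2 := Measure.prod_apply_symm (μ := π) (ν := γ) hjoint
      rw [e1] at e2
      exact e2
    rw [h1]
    calc _ ≤ ∫⁻ _, ENNReal.ofReal
          ((Real.exp 1 * √(Real.pi / (s / ε ^ 2)) / (2 * b)) ^ S.card) ∂γ :=
        lintegral_mono fun w => prior_ball_le hb0 hε hS _ θ₀
      _ = _ := by rw [lintegral_const, measure_univ, mul_one]
  have htotal : ENNReal.ofReal (1 - δ)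
      ≤ ENNReal.ofReal (9 / (σ ^ 2 * s) * (s * (Ccol ^ 2 * n) * b ^ 2))
        + ENNReal.ofReal (Real.exp s) * ENNReal.ofReal
          ((Real.exp 1 * √(Real.pi / (s / ε ^ 2)) / (2 * b)) ^ S.card) := by
    have hAmeas : Measurable fun g => γ (A g) := measurable_measure_prodMk_left hjoint
    calc ENNReal.ofReal (1 - δ) = ∫⁻ _, ENNReal.ofReal (1 - δ) ∂π := by
          rw [lintegral_const, measure_univ, mul_one]
      _ ≤ ∫⁻ g, (ENNReal.ofReal (9 / (σ ^ 2 * s) * ∑ k, X.mulVec (maskOn S g) k ^ 2)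
          + ENNReal.ofReal (Real.exp s) * γ (A g)) ∂π := lintegral_mono_ae hpoint
      _ = ∫⁻ g, ENNReal.ofReal (9 / (σ ^ 2 * s) * ∑ k, X.mulVec (maskOn S g) k ^ 2) ∂π
          + ENNReal.ofReal (Real.exp s) * ∫⁻ g, γ (A g) ∂π := by
          rw [lintegral_add_right _ (hAmeas.const_mul _), lintegral_const_mul _ hAmeas]
      _ ≤ _ := by
          gcongr
          exact lintegral_signal_energy_le hb0 (by positivity) hX
  rw [← ENNReal.ofReal_mul (Real.exp_pos _).le,
    ← ENNReal.ofReal_add (by positivity) (by positivity),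
    ENNReal.ofReal_le_ofReal_iff (by positivity)] at htotal
  have hfirst : 9 / (σ ^ 2 * s) * (s * (Ccol ^ 2 * n) * b ^ 2) ≤ η / 4 := by
    have h1 : 9 / (σ ^ 2 * s) * (s * (Ccol ^ 2 * n) * b ^ 2)
        = 9 * Ccol ^ 2 * R ^ 2 * ε ^ 2 / (s * σ ^ 2) * n := by
      rw [hb2]; field_simp
    rw [h1]
    calc 9 * Ccol ^ 2 * R ^ 2 * ε ^ 2 / (s * σ ^ 2) * n
        ≤ 9 * Ccol ^ 2 * R ^ 2 * ε ^ 2 / (s * σ ^ 2)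
          * (η / (36 * Ccol ^ 2 * R ^ 2) * (s * σ ^ 2 / ε ^ 2)) := by gcongr
      _ = η / 4 := by field_simp; norm_num
  have hsecond : Real.exp s * (Real.exp 1 * √(Real.pi / (s / ε ^ 2)) / (2 * b)) ^ S.card
      ≤ η / 4 := by
    have h1 : √(Real.pi / (s / ε ^ 2)) = √Real.pi * ε / √s := by
      rw [Real.sqrt_div Real.pi_pos.le, Real.sqrt_div hs0.le, Real.sqrt_sq hε.le]
      field_simp
    have h2 : Real.exp s = Real.exp 1 ^ S.card := by
      rw [← Real.exp_nat_mul, mul_one]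
    rw [h2, ← mul_pow]
    have h3 : Real.exp 1 * (Real.exp 1 * √(Real.pi / (s / ε ^ 2)) / (2 * b))
        = Real.exp 1 * (Real.exp 1 * √Real.pi) / 2 / R := by
      rw [h1, hb]; field_simp
    have h4 : Real.exp 1 * (Real.exp 1 * √Real.pi) / 2 / R ≤ η / 4 := by
      calc _ ≤ 7 / R := by gcongr; exact exp_two_mul_sqrt_pi_div_two_le
        _ = η / 4 := by rw [hR]; field_simp; norm_num
    rw [h3]
    calc _ ≤ (η / 4) ^ S.card := by gcongr
      _ ≤ (η / 4) ^ 1 := pow_le_pow_of_le_one (by positivity) (by linarith) hS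
      _ = η / 4 := pow_one _
  linarith

/-! ### The law of the human's answers -/

lemma expMeasure_real_lt {x : ℝ} (hx : 0 ≤ x) :
    expMeasure 1 (Set.Iio x) = ENNReal.ofReal (1 - Real.exp (-x)) := by
  have := isProbabilityMeasure_expMeasure (r := 1) one_pos
  have h1 : expMeasure 1 (Set.Iio x) = expMeasure 1 (Set.Iic x) := by
    have h0 : expMeasure 1 ≪ volume := withDensity_absolutelyContinuous volume _
    exact measure_congr (h0.ae_eq Iio_ae_eq_Iic)
  rw [h1, ← ENNReal.ofReal_toReal (measure_ne_top (expMeasure 1) (Set.Iic x))]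
  have h2 := cdf_expMeasure_eq (r := 1) one_pos x
  rw [cdf_eq_real, if_pos hx, one_mul] at h2
  rw [← h2]; rfl

lemma lintegral_expMeasure {f : ℝ → ℝ≥0∞} (hf : Measurable f) :
    ∫⁻ x, f x ∂expMeasure 1 = ∫⁻ x in Set.Ioi 0, ENNReal.ofReal (Real.exp (-x)) * f x := by
  have h1 : expMeasure 1 = volume.withDensity (exponentialPDF 1) := rfl
  rw [h1, lintegral_withDensity_eq_lintegral_mul _
    (show Measurable (exponentialPDF 1) from
      (measurable_exponentialPDFReal 1).ennreal_ofReal) hf,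
    ← lintegral_indicator measurableSet_Ioi]
  refine lintegral_congr_ae ?_
  have h0 : ∀ᵐ x : ℝ, x ≠ 0 := by
    rw [ae_iff]; simp
  filter_upwards [h0] with x hx
  by_cases hx0 : 0 < x
  · rw [Set.indicator_of_mem (Set.mem_Ioi.2 hx0), Pi.mul_apply,
      exponentialPDF_of_nonneg hx0.le]
    simp
  · rw [Set.indicator_of_notMem (by simpa using hx0), Pi.mul_apply,
      exponentialPDF_of_neg (lt_of_le_of_ne (not_lt.1 hx0) hx), zero_mul]

lemma ae_expMeasure_pos : ∀ᵐ x ∂expMeasure 1, 0 < x := by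
  have h : Measurable fun x : ℝ => (Set.Iic (0 : ℝ)).indicator (fun _ => (1 : ℝ≥0∞)) x :=
    measurable_const.indicator measurableSet_Iic
  rw [ae_iff]
  have h1 : {x : ℝ | ¬ 0 < x} = Set.Iic 0 := by ext; simp
  rw [h1, ← lintegral_indicator_one measurableSet_Iic]
  change ∫⁻ x, (Set.Iic (0 : ℝ)).indicator (fun _ => (1 : ℝ≥0∞)) x ∂expMeasure 1 = 0
  rw [lintegral_expMeasure h]
  refine (setLIntegral_congr_fun measurableSet_Ioi fun x hx => ?_).trans lintegral_zero
  rw [Set.indicator_of_notMem (by simpa using hx), mul_zero]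

/-- Two independent standard exponentials: the probability that one is smaller than `c` times the
other. -/
lemma expMeasure_prod_lt {c : ℝ} (hc : 0 < c) :
    ((expMeasure 1).prod (expMeasure 1)) {p | p.2 < c * p.1}
      = ENNReal.ofReal (c / (1 + c)) := by
  have := isProbabilityMeasure_expMeasure (r := 1) one_pos
  have hm : MeasurableSet {p : ℝ × ℝ | p.2 < c * p.1} :=
    measurableSet_lt measurable_snd (measurable_fst.const_mul c)
  rw [Measure.prod_apply hm, lintegral_expMeasure (measurable_measure_prodMk_left hm)]
  have h1 : ∀ x ∈ Set.Ioi (0 : ℝ), ENNReal.ofReal (Real.exp (-x))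
      * expMeasure 1 (Prod.mk x ⁻¹' {p | p.2 < c * p.1})
      = ENNReal.ofReal (Real.exp (-1 * x) - Real.exp (-(1 + c) * x)) := by
    intro x hx
    have h2 : Prod.mk x ⁻¹' {p : ℝ × ℝ | p.2 < c * p.1} = Set.Iio (c * x) := rfl
    rw [h2, expMeasure_real_lt (mul_nonneg hc.le (Set.mem_Ioi.1 hx).le),
      ← ENNReal.ofReal_mul (Real.exp_pos _).le, mul_sub, ← Real.exp_add]
    congr 3 <;> ring_nf
  rw [setLIntegral_congr_fun measurableSet_Ioi h1]
  have i1 : IntegrableOn (fun x : ℝ => Real.exp (-1 * x)) (Set.Ioi 0) :=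
    integrableOn_exp_mul_Ioi (by norm_num) 0
  have i2 : IntegrableOn (fun x : ℝ => Real.exp (-(1 + c) * x)) (Set.Ioi 0) :=
    integrableOn_exp_mul_Ioi (by linarith) 0
  rw [← ofReal_integral_eq_lintegral_ofReal
    (f := fun x => Real.exp (-1 * x) - Real.exp (-(1 + c) * x)) (i1.sub i2)]
  · congr 1
    rw [integral_sub i1 i2, integral_exp_mul_Ioi (by norm_num), integral_exp_mul_Ioi (by linarith)]
    simp only [mul_zero, Real.exp_zero]
    field_simp
    ring
  · refine (ae_restrict_iff' measurableSet_Ioi).2 (ae_of_all _ fun x hx => ?_)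
    simp only [Pi.zero_apply, sub_nonneg, Real.exp_le_exp]
    have : 0 < x := hx
    nlinarith

/-- The difference of two independent Gumbel variables is logistic. -/
lemma gumbelMeasure_prod_lt {γ : ℝ} (hγ : 0 < γ) (g : ℝ) :
    ((gumbelMeasure γ).prod (gumbelMeasure γ)) {p | p.1 < p.2 + g}
      = ENNReal.ofReal (Real.exp (g / γ) / (1 + Real.exp (g / γ))) := by
  have := isProbabilityMeasure_expMeasure (r := 1) one_pos
  have hlog : Measurable fun x : ℝ => -γ * Real.log x := by fun_prop
  have hm : MeasurableSet {p : ℝ × ℝ | p.1 < p.2 + g} :=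
    measurableSet_lt measurable_fst (measurable_snd.add_const g)
  unfold gumbelMeasure
  rw [Measure.map_prod_map _ _ hlog hlog, Measure.map_apply (by fun_prop) hm,
    ← expMeasure_prod_lt (Real.exp_pos (g / γ))]
  refine measure_congr ?_
  -- Positivity is needed to undo the logarithms: the event becomes that one exponential is smaller
  -- than `exp (g / γ)` times the other.
  have hpos : ∀ᵐ p ∂(expMeasure 1).prod (expMeasure 1), 0 < p.1 ∧ 0 < p.2 := by
    have h1 := Measure.quasiMeasurePreserving_fst (μ := expMeasure 1) (ν := expMeasure 1)
    have h2 := Measure.quasiMeasurePreserving_snd (μ := expMeasure 1) (ν := expMeasure 1)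
    filter_upwards [h1.ae ae_expMeasure_pos, h2.ae ae_expMeasure_pos] with p hp1 hp2
    exact ⟨hp1, hp2⟩
  filter_upwards [hpos] with p ⟨hp1, hp2⟩
  refine propext ?_
  change -γ * Real.log p.1 < -γ * Real.log p.2 + g ↔ p.2 < Real.exp (g / γ) * p.1
  rw [← Real.log_lt_log_iff hp2 (by positivity), Real.log_mul (Real.exp_ne_zero _) hp1.ne',
    Real.log_exp]
  constructor
  · intro h
    have : γ * (Real.log p.2 - Real.log p.1) < g := by linarith
    have := (lt_div_iff₀' hγ).2 this
    linarith
  · intro h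
    have : Real.log p.2 - Real.log p.1 < g / γ := by linarith
    have := (lt_div_iff₀' hγ).1 this
    linarith

instance (d : ℕ) (γ : ℝ) : IsProbabilityMeasure (humanLaw d γ) := by
  unfold humanLaw; infer_instance

/-- The outcome of a comparison with utility gap `g` under the utility noises `x`. -/
noncomputable def comparison (g : ℝ) (x : Bool → ℝ) : ℝ :=
  open Classical in if x false < x true + g then 1 else -1

lemma measurableSet_comparison (g : ℝ) : MeasurableSet {x : Bool → ℝ | x false < x true + g} :=
  measurableSet_lt (by fun_prop) (by fun_prop)

lemma measurable_comparison (g : ℝ) : Measurable (comparison g) := by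
  classical
  unfold comparison
  exact Measurable.ite (measurableSet_comparison g) measurable_const measurable_const

/-- The utility noises used in one horizontal step of one coordinate are independent over the
vertical steps. -/
lemma iIndepFun_stepNoise (d : ℕ) (γ : ℝ) (i : Fin d) (k : ℕ) :
    iIndepFun (fun m (ξ : NoiseIndex d → ℝ) (b : Bool) => ξ (i, k, m, b)) (humanLaw d γ) := by
  rw [iIndepFun_iff_map_fun_eq_infinitePi_map (by fun_prop)]
  have hinj : Function.Injective fun p : ℕ × Bool => ((i, k, p.1, p.2) : NoiseIndex d) := by
    rintro ⟨m, b⟩ ⟨m', b'⟩ h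
    simpa using h
  have hinj' : ∀ m : ℕ, Function.Injective fun b : Bool => ((i, k, m, b) : NoiseIndex d) := by
    intro m b b' h
    simpa using h
  have h1 : (humanLaw d γ).map (fun ξ (p : ℕ × Bool) => ξ (i, k, p.1, p.2))
      = Measure.infinitePi fun _ => gumbelMeasure γ :=
    Measure.map_infinitePi_infinitePi_of_inj (P := fun _ : NoiseIndex d => gumbelMeasure γ) hinj
  have h2 : ∀ m, (humanLaw d γ).map (fun ξ (b : Bool) => ξ (i, k, m, b))
      = Measure.infinitePi fun _ => gumbelMeasure γ := fun m =>
    Measure.map_infinitePi_infinitePi_of_inj (P := fun _ : NoiseIndex d => gumbelMeasure γ)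
      (hinj' m)
  simp only [h2]
  rw [← Measure.infinitePi_map_curry (fun (_ : ℕ) (_ : Bool) => gumbelMeasure γ), ← h1,
    Measure.map_map (MeasurableEquiv.measurable _) (by fun_prop)]
  rfl

/-- The probability of the answer `+1`. -/
lemma humanLaw_comparison_pos {γ : ℝ} (hγ : 0 < γ) (d : ℕ) (i : Fin d) (k m : ℕ) (g : ℝ) :
    humanLaw d γ {ξ | ξ (i, k, m, false) < ξ (i, k, m, true) + g}
      = ENNReal.ofReal (Real.exp (g / γ) / (1 + Real.exp (g / γ))) := by
  rw [← gumbelMeasure_prod_lt hγ g]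
  have h := Measure.infinitePi_map_eval_prod (P := fun _ : NoiseIndex d => gumbelMeasure γ)
    (i := (i, k, m, false)) (j := (i, k, m, true)) (by simp)
  rw [← h, Measure.map_apply (by fun_prop)
    (measurableSet_lt measurable_fst (measurable_snd.add_const g))]
  rfl

lemma integral_comparison {γ : ℝ} (hγ : 0 < γ) (d : ℕ) (i : Fin d) (k m : ℕ) (g : ℝ) :
    ∫ ξ, comparison g (fun b => ξ (i, k, m, b)) ∂humanLaw d γ
      = (Real.exp (g / γ) - 1) / (Real.exp (g / γ) + 1) := by
  classical
  set A : Set (NoiseIndex d → ℝ) := {ξ | ξ (i, k, m, false) < ξ (i, k, m, true) + g} with hA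
  have hAm : MeasurableSet A := measurableSet_lt (by fun_prop) (by fun_prop)
  have h1 : ∀ ξ : NoiseIndex d → ℝ, comparison g (fun b => ξ (i, k, m, b))
      = A.indicator (fun _ => (2 : ℝ)) ξ - 1 := by
    intro ξ
    by_cases h : ξ ∈ A
    · rw [Set.indicator_of_mem h, comparison,
        if_pos (show ξ (i, k, m, false) < ξ (i, k, m, true) + g from h)]; norm_num
    · rw [Set.indicator_of_notMem h, comparison,
        if_neg (show ¬ ξ (i, k, m, false) < ξ (i, k, m, true) + g from h)]; norm_num
  simp only [h1]
  rw [integral_sub ((integrable_const _).indicator hAm) (integrable_const _),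
    integral_indicator_const _ hAm, integral_const, probReal_univ, Measure.real, hA,
    humanLaw_comparison_pos hγ, ENNReal.toReal_ofReal (by positivity)]
  simp only [smul_eq_mul, mul_one]
  have := Real.exp_pos (g / γ)
  field_simp
  ring

/-- The expected answer points in the direction of the utility gap. -/
lemma drift_le_integral_comparison {γ : ℝ} (hγ : 0 < γ) (d : ℕ) (i : Fin d) (k m : ℕ)
    {g g₀ e : ℝ} (he : e = 1 ∨ e = -1) (hg0 : 0 ≤ g₀) (hg2 : g₀ ≤ 2 * γ) (hg : g₀ ≤ e * g) :
    g₀ / (4 * γ) ≤ e * ∫ ξ, comparison g (fun b => ξ (i, k, m, b)) ∂humanLaw d γ := by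
  rw [integral_comparison hγ]
  -- With `x = g₀ / γ` in `[0, 2]` and `exp y ≥ 1 + x`, the quotient is at least `x / (x + 2) ≥ x /
  -- 4`. This is where the cap `g₀ ≤ 2 * γ` on the gap enters.
  have key : ∀ y : ℝ, g₀ / γ ≤ y → g₀ / (4 * γ) ≤ (Real.exp y - 1) / (Real.exp y + 1) := by
    intro y hy
    have h1 : 1 + g₀ / γ ≤ Real.exp y := by linarith [Real.add_one_le_exp y]
    have h2 : g₀ / γ ≤ 2 := (div_le_iff₀ hγ).2 hg2
    have h3 : 0 ≤ g₀ / γ := by positivity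
    have h4 : g₀ / (4 * γ) = g₀ / γ / 4 := by field_simp
    rw [h4, le_div_iff₀ (by positivity)]
    nlinarith
  rcases he with rfl | rfl
  · rw [one_mul]
    exact key _ (by gcongr; linarith)
  · have h1 := key (-(g / γ)) (by rw [← neg_div]; gcongr; linarith)
    rw [Real.exp_neg] at h1
    refine h1.trans (le_of_eq ?_)
    have := Real.exp_pos (g / γ)
    field_simp
    ring

/-- Hoeffding bound for a walk with drift at least `μ₀` in direction `e`. -/
lemma measure_walk_le {γ : ℝ} (hγ : 0 < γ) (d : ℕ) (i : Fin d) (k n : ℕ)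
    {g g₀ e x : ℝ} (he : e = 1 ∨ e = -1) (hg0 : 0 ≤ g₀) (hg2 : g₀ ≤ 2 * γ) (hg : g₀ ≤ e * g)
    (hx : 0 ≤ x) :
    humanLaw d γ {ξ | e * ∑ m ∈ Finset.range n, comparison g (fun b => ξ (i, k, m, b))
        ≤ n * (g₀ / (4 * γ)) - x}
      ≤ ENNReal.ofReal (Real.exp (-x ^ 2 / (2 * n))) := by
  set μ := humanLaw d γ with hμ
  set Z : ℕ → (NoiseIndex d → ℝ) → ℝ := fun m ξ => -e * comparison g (fun b => ξ (i, k, m, b))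
    with hZ
  have hZm : ∀ m, Measurable (Z m) := fun m =>
    ((measurable_comparison g).comp (by fun_prop)).const_mul (-e)
  have hZb : ∀ m ξ, Z m ξ ∈ Set.Icc (-1 : ℝ) 1 := by
    intro m ξ
    simp only [hZ, comparison]
    rcases he with rfl | rfl <;> split_ifs <;> norm_num
  have hind : iIndepFun (fun m ξ => Z m ξ - μ[Z m]) μ := by
    have := (iIndepFun_stepNoise d γ i k).comp (fun m x => -e * comparison g x - μ[Z m])
      fun m => ((measurable_comparison g).const_mul (-e)).sub_const _
    exact this
  have hsub : ∀ m < n, HasSubgaussianMGF (fun ξ => Z m ξ - μ[Z m]) 1 μ := by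
    intro m _
    have h1 := hasSubgaussianMGF_of_mem_Icc (μ := μ) (hZm m).aemeasurable
      (ae_of_all _ (hZb m))
    convert h1 using 1
    ext
    norm_num
  have hH := HasSubgaussianMGF.measure_sum_range_ge_le_of_iIndepFun hind hsub hx
  have hmean : ∀ m, μ[Z m] ≤ -(g₀ / (4 * γ)) := by
    intro m
    have := drift_le_integral_comparison hγ d i k m he hg0 hg2 hg
    simp only [hZ]
    rw [integral_const_mul]
    linarith
  refine (measure_mono (t := {ξ | x ≤ ∑ m ∈ Finset.range n, (Z m ξ - μ[Z m])}) fun ξ hξ => ?_).trans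
    ?_
  · have hξ' : e * ∑ m ∈ Finset.range n, comparison g (fun b => ξ (i, k, m, b))
        ≤ n * (g₀ / (4 * γ)) - x := hξ
    rw [Set.mem_ofPred_eq, Finset.sum_sub_distrib]
    have h1 : ∑ m ∈ Finset.range n, Z m ξ
        = -(e * ∑ m ∈ Finset.range n, comparison g (fun b => ξ (i, k, m, b))) := by
      simp only [hZ]
      rw [← Finset.mul_sum]; ring
    have h2 : ∑ m ∈ Finset.range n, μ[Z m] ≤ ∑ m ∈ Finset.range n, -(g₀ / (4 * γ)) :=
      Finset.sum_le_sum fun m _ => hmean m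
    rw [Finset.sum_const, Finset.card_range, nsmul_eq_mul] at h2
    rw [h1]
    linarith
  · rw [← ENNReal.ofReal_toReal (measure_ne_top μ _)]
    refine ENNReal.ofReal_le_ofReal (hH.trans (le_of_eq ?_))
    norm_num

/-- The utility gap of the comparison at the query point `q` for coordinate `i`. -/
noncomputable def utilityGap {d : ℕ} (H : HumanModel d) (θ q : Fin d → ℝ) (i : Fin d) : ℝ :=
  H.utility θ (H.cPlus q i) - H.utility θ (H.cMinus q i)

lemma walk_answer_eq {d : ℕ} (H : HumanModel d) (θ : Fin d → ℝ) (ξ : NoiseIndex d → ℝ)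
    (i : Fin d) (v : Fin d → ℝ) (t : ℝ) (k n : ℕ) :
    (walk (answer H θ ξ i v t k) n : ℝ) = ∑ m ∈ Finset.range n,
      comparison (utilityGap H θ (Function.update v i t) i) (fun b => ξ (i, k, m, b)) := by
  classical
  unfold walk
  push_cast
  refine Finset.sum_congr rfl fun m _ => ?_
  simp only [answer, comparison, utilityGap]
  split_ifs with h1 h2 h2
  · rw [Int.cast_one]; exact (if_pos h2).symm
  · exact absurd (by linarith) h2
  · exact absurd (by linarith) h1
  · rw [Int.cast_neg, Int.cast_one]; exact (if_neg h2).symm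

/-- The answers `z` to a query at `t` do not mislead a search for `x`: before the cap `M` the walk
does not cross the boundary on the wrong side, and if `t` is not `ε`-close to `x` it does cross. -/
structure Faithful (η : ℝ) (M : ℕ) (x ε t : ℝ) (z : ℕ → ℤ) : Prop where
  of_lt : t < x → ∀ m, 1 ≤ m → m < M → -testBoundary η m < (walk z m : ℝ)
  of_gt : x < t → ∀ m, 1 ≤ m → m < M → (walk z m : ℝ) < testBoundary η m
  cross : ε < |t - x| → testBoundary η (M - 1) ≤ |(walk z (M - 1) : ℝ)|

lemma testBoundary_nonneg (η : ℝ) (m : ℕ) : 0 ≤ testBoundary η m := Real.sqrt_nonneg _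

lemma sq_testBoundary {η : ℝ} (hη : 0 < η) (hη1 : η < 1) (m : ℕ) :
    testBoundary η m ^ 2 = 2 * m * (Real.log (m + 1) - Real.log η) := by
  refine Real.sq_sqrt ?_
  have h1 : 0 ≤ Real.log ((m : ℝ) + 1) := Real.log_nonneg (by
    have : (0 : ℝ) ≤ m := Nat.cast_nonneg m
    linarith)
  have h2 : Real.log η < 0 := Real.log_neg hη hη1
  have : 0 ≤ Real.log ((m : ℝ) + 1) - Real.log η := by linarith
  positivity

/-- The boundary is built so that the Hoeffding bound at time `m` equals `η / (m + 1)`. The factor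
`1 / (m + 1)` is given away, because the cap makes a crude union bound over `m` sufficient. -/
lemma exp_neg_sq_testBoundary_le {η : ℝ} (hη : 0 < η) (hη1 : η < 1) {m : ℕ} (hm : 1 ≤ m) :
    Real.exp (-testBoundary η m ^ 2 / (2 * m)) ≤ η := by
  have hm' : (0 : ℝ) < m := by exact_mod_cast hm
  rw [sq_testBoundary hη hη1]
  have h1 : -(2 * m * (Real.log (m + 1) - Real.log η)) / (2 * (m : ℝ))
      = Real.log η - Real.log (m + 1) := by field_simp; ring
  rw [h1]
  have h2 : 0 ≤ Real.log ((m : ℝ) + 1) := Real.log_nonneg (by linarith)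
  calc Real.exp (Real.log η - Real.log (m + 1)) ≤ Real.exp (Real.log η) := by
        gcongr; linarith
    _ = η := Real.exp_log hη

/-- The answers to a fixed query are faithful with high probability. -/
lemma humanLaw_not_faithful_le {γ η g₀ x ε t : ℝ} (hγ : 0 < γ) (hη : 0 < η) (hη1 : η < 1)
    (hg0 : 0 ≤ g₀) (hg2 : g₀ ≤ 2 * γ) {M : ℕ} (hM : 2 ≤ M)
    (hMg : 2 * testBoundary η (M - 1) ≤ ((M - 1 : ℕ) : ℝ) * (g₀ / (4 * γ)))
    {d : ℕ} (H : HumanModel d) (θ : Fin d → ℝ) (i : Fin d) (v : Fin d → ℝ) (k : ℕ) (hε : 0 ≤ ε)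
    (hlt : t < x → 0 ≤ utilityGap H θ (Function.update v i t) i)
    (hgt : x < t → utilityGap H θ (Function.update v i t) i ≤ 0)
    (hgap : ε < |t - x| → g₀ ≤ |utilityGap H θ (Function.update v i t) i|) :
    humanLaw d γ {ξ | ¬ Faithful η M x ε t (answer H θ ξ i v t k)}
      ≤ ENNReal.ofReal (M * η) := by
  set g := utilityGap H θ (Function.update v i t) i with hg
  set μ := humanLaw d γ with hμ
  let W : (NoiseIndex d → ℝ) → ℕ → ℝ := fun ξ n =>
    ∑ m ∈ Finset.range n, comparison g (fun b => ξ (i, k, m, b))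
  have hW : ∀ ξ n, (walk (answer H θ ξ i v t k) n : ℝ) = W ξ n := fun ξ n =>
    walk_answer_eq H θ ξ i v t k n
  rcases eq_or_ne t x with rfl | htx
  · have : {ξ : NoiseIndex d → ℝ | ¬ Faithful η M t ε t (answer H θ ξ i v t k)} = ∅ := by
      ext ξ
      simp only [Set.mem_ofPred_eq, Set.mem_empty_iff_false, iff_false, not_not]
      exact ⟨fun h => absurd h (lt_irrefl _), fun h => absurd h (lt_irrefl _),
        fun h => absurd h (by simpa using hε)⟩
    rw [this]; simp
  obtain ⟨e, he, het, hee⟩ : ∃ e : ℝ, (e = 1 ∨ e = -1) ∧ 0 ≤ e * g ∧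
      ((t < x → e = 1) ∧ (x < t → e = -1)) := by
    rcases lt_or_gt_of_ne htx with h | h
    · exact ⟨1, Or.inl rfl, by linarith [hlt h], fun _ => rfl, fun h' => absurd h' h.not_gt⟩
    · exact ⟨-1, Or.inr rfl, by linarith [hgt h], fun h' => absurd h' h.not_gt, fun _ => rfl⟩
  have habs : |g| = e * g := by
    rcases he with rfl | rfl
    · rw [abs_of_nonneg (by linarith)]; ring
    · rw [abs_of_nonpos (by linarith)]; ring
  -- A wrong-side crossing at one of the `M - 1` times before the cap needs only nonnegative drift
  -- in direction `e`. At the last such time the mean is at least twice the boundary when `t` is far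
  -- from `x`, so failing to cross is again a deviation by one boundary. This makes `M` events in
  -- all.
  have hsub : {ξ : NoiseIndex d → ℝ | ¬ Faithful η M x ε t (answer H θ ξ i v t k)}
      ⊆ (⋃ m ∈ Finset.Ico 1 M, {ξ | e * W ξ m ≤ m * (0 / (4 * γ)) - testBoundary η m})
        ∪ {ξ | ε < |t - x| ∧ e * W ξ (M - 1)
            ≤ ((M - 1 : ℕ) : ℝ) * (g₀ / (4 * γ)) - testBoundary η (M - 1)} := by
    intro ξ hξ
    by_contra hcon
    simp only [Set.mem_union, Set.mem_iUnion, Finset.mem_Ico, Set.mem_ofPred_eq, not_or,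
      not_exists, not_and, not_le, zero_div, mul_zero, zero_sub] at hcon
    obtain ⟨h1, h2⟩ := hcon
    refine hξ ⟨fun h m hm1 hmM => ?_, fun h m hm1 hmM => ?_, fun h => ?_⟩
    · have := h1 m ⟨hm1, hmM⟩
      rw [hee.1 h] at this
      rw [hW]; linarith
    · have := h1 m ⟨hm1, hmM⟩
      rw [hee.2 h] at this
      rw [hW]; linarith
    · have := h2 h
      rw [hW]
      have h3 : e * W ξ (M - 1) ≤ |W ξ (M - 1)| := by
        rcases he with rfl | rfl
        · rw [one_mul]; exact le_abs_self _
        · rw [neg_one_mul]; exact neg_le_abs _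
      linarith
  have hone : ∀ m ∈ Finset.Ico 1 M,
      μ {ξ | e * W ξ m ≤ m * (0 / (4 * γ)) - testBoundary η m} ≤ ENNReal.ofReal η := by
    intro m hm
    refine (measure_walk_le hγ d i k m he le_rfl (by positivity) het
      (testBoundary_nonneg η m)).trans (ENNReal.ofReal_le_ofReal ?_)
    exact exp_neg_sq_testBoundary_le hη hη1 (Finset.mem_Ico.1 hm).1
  have htwo : μ {ξ | ε < |t - x| ∧ e * W ξ (M - 1)
      ≤ ((M - 1 : ℕ) : ℝ) * (g₀ / (4 * γ)) - testBoundary η (M - 1)} ≤ ENNReal.ofReal η := by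
    by_cases h : ε < |t - x|
    · simp only [h, true_and]
      refine (measure_walk_le hγ d i k (M - 1) he hg0 hg2 (habs ▸ hgap h)
        (testBoundary_nonneg η (M - 1))).trans (ENNReal.ofReal_le_ofReal ?_)
      exact exp_neg_sq_testBoundary_le hη hη1 (by omega)
    · simp [h]
  calc μ {ξ | ¬ Faithful η M x ε t (answer H θ ξ i v t k)}
      ≤ ∑ m ∈ Finset.Ico 1 M, μ {ξ | e * W ξ m ≤ m * (0 / (4 * γ)) - testBoundary η m}
        + μ {ξ | ε < |t - x| ∧ e * W ξ (M - 1)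
            ≤ ((M - 1 : ℕ) : ℝ) * (g₀ / (4 * γ)) - testBoundary η (M - 1)} :=
        (measure_mono hsub).trans ((measure_union_le _ _).trans
          (add_le_add_left (measure_biUnion_finset_le _ _) _))
    _ ≤ ∑ _m ∈ Finset.Ico 1 M, ENNReal.ofReal η + ENNReal.ofReal η := by
        gcongr with m hm
        exact hone m hm
    _ = ENNReal.ofReal (M * η) := by
        rw [Finset.sum_const, Nat.card_Ico, nsmul_eq_mul, ENNReal.ofReal_mul (by positivity),
          ENNReal.ofReal_natCast]
        have : (M : ℝ≥0∞) = ((M - 1 : ℕ) : ℝ≥0∞) + 1 := by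
          exact_mod_cast (by omega : M = M - 1 + 1)
        rw [this]; ring

/-! ### Medians and posterior updates -/

section Median

variable {μ : Measure ℝ} [IsProbabilityMeasure μ]

lemma half_le_measure_iff (x : ℝ) : 1 / 2 ≤ μ (Set.Iic x) ↔ 1 / 2 ≤ cdf μ x := by
  rw [cdf_eq_real, Measure.real, ← ENNReal.ofReal_le_iff_le_toReal (measure_ne_top _ _),
    ENNReal.ofReal_div_of_pos two_pos, ENNReal.ofReal_one, ENNReal.ofReal_ofNat]

lemma isGLB_median (μ : Measure ℝ) [IsProbabilityMeasure μ] :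
    IsGLB {x | 1 / 2 ≤ cdf μ x} (median μ) := by
  have h0 : {x | 1 / 2 ≤ μ (Set.Iic x)} = {x | 1 / 2 ≤ cdf μ x} := by
    ext x; exact half_le_measure_iff x
  rw [median, h0]
  refine isGLB_csInf ?_ ?_
  · obtain ⟨x, hx⟩ := ((tendsto_cdf_atTop μ).eventually
      (lt_mem_nhds (show (1 / 2 : ℝ) < 1 by norm_num))).exists
    exact ⟨x, hx.le⟩
  · obtain ⟨y, hy⟩ := ((tendsto_cdf_atBot μ).eventually
      (gt_mem_nhds (show (0 : ℝ) < 1 / 2 by norm_num))).exists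
    refine ⟨y, fun x hx => ?_⟩
    by_contra! hlt
    have := monotone_cdf μ hlt.le
    have hx' : 1 / 2 ≤ cdf μ x := hx
    linarith

/-- Right continuity gives `≥`. The absence of atoms identifies the value with the left limit, which
gives `≤`. -/
lemma cdf_median (hμ : μ ≪ volume) : cdf μ (median μ) = 1 / 2 := by
  have hglb := isGLB_median μ
  refine le_antisymm ?_ ?_
  · have h1 : μ (Set.Iic (median μ)) = μ (Set.Iio (median μ)) :=
      (measure_congr (hμ.ae_eq Iio_ae_eq_Iic)).symm
    have h2 : μ (Set.Iio (median μ)) = ENNReal.ofReal (Function.leftLim (cdf μ) (median μ) - 0) := by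
      have := (cdf μ).measure_Iio (tendsto_cdf_atBot μ) (median μ)
      rwa [measure_cdf] at this
    have h3 : Function.leftLim (cdf μ) (median μ) ≤ 1 / 2 := by
      refine le_of_tendsto ((monotone_cdf μ).tendsto_leftLim _) ?_
      filter_upwards [self_mem_nhdsWithin] with x hx
      by_contra! h
      exact absurd (hglb.1 h.le) (not_le.2 hx)
    rw [cdf_eq_real, Measure.real, h1, h2]
    refine ENNReal.toReal_le_of_le_ofReal (by norm_num) (ENNReal.ofReal_le_ofReal ?_)
    linarith
  · have hrc := (cdf μ).right_continuous (median μ)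
    have h1 : Filter.Tendsto (cdf μ) (nhdsWithin (median μ) (Set.Ioi (median μ)))
        (nhds (cdf μ (median μ))) := hrc.mono_left (nhdsWithin_mono _ Set.Ioi_subset_Ici_self)
    refine ge_of_tendsto h1 ?_
    filter_upwards [self_mem_nhdsWithin] with x hx
    obtain ⟨y, hy, hyx⟩ := (isGLB_lt_iff hglb).1 hx
    exact le_trans hy (monotone_cdf μ hyx.le)

lemma real_Iio_median (hμ : μ ≪ volume) : μ.real (Set.Iio (median μ)) = 1 / 2 := by
  rw [← cdf_median hμ, cdf_eq_real]
  exact congrArg ENNReal.toReal (measure_congr (hμ.ae_eq Iio_ae_eq_Iic))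

lemma real_Ici_median (hμ : μ ≪ volume) : μ.real (Set.Ici (median μ)) = 1 / 2 := by
  have h := probReal_add_probReal_compl (μ := μ) (s := Set.Iio (median μ)) measurableSet_Iio
  rw [real_Iio_median hμ, Set.compl_Iio] at h
  linarith

/-- Were the median outside, one of the two half-lines it cuts off, of mass 1/2, would lie in the
complement. -/
lemma median_mem_Ioo (hμ : μ ≪ volume) {lo hi : ℝ} (h : μ.real (Set.Ioo lo hi)ᶜ < 1 / 2) :
    median μ ∈ Set.Ioo lo hi := by
  by_contra hmem
  rw [Set.mem_Ioo, not_and_or, not_lt, not_lt] at hmem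
  rcases hmem with h1 | h1
  · have : μ.real (Set.Iio (median μ)) ≤ μ.real (Set.Ioo lo hi)ᶜ :=
      measureReal_mono fun x hx hx' => by
        have hx1 : x < median μ := hx
        linarith [hx'.1]
    rw [real_Iio_median hμ] at this
    linarith
  · have : μ.real (Set.Ici (median μ)) ≤ μ.real (Set.Ioo lo hi)ᶜ :=
      measureReal_mono fun x hx hx' => by
        have hx1 : median μ ≤ x := hx
        linarith [hx'.2]
    rw [real_Ici_median hμ] at this
    linarith

end Median

lemma median_map_add (c : ℝ) (μ : Measure ℝ) [IsProbabilityMeasure μ] :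
    median (μ.map (c + ·)) = c + median μ := by
  have hm : Measurable fun x : ℝ => c + x := by fun_prop
  have : IsProbabilityMeasure (μ.map (c + ·)) := Measure.isProbabilityMeasure_map hm.aemeasurable
  have hcdf : ∀ x, cdf (μ.map (c + ·)) x = cdf μ (x - c) := by
    intro x
    rw [cdf_eq_real, cdf_eq_real, map_measureReal_apply hm measurableSet_Iic]
    congr 1
    ext y
    simp only [Set.mem_preimage, Set.mem_Iic]
    constructor <;> intro h <;> linarith
  refine (isGLB_median (μ.map (c + ·))).unique ⟨fun x hx => ?_, fun y hy => ?_⟩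
  · rw [Set.mem_ofPred_eq, hcdf] at hx
    linarith [(isGLB_median μ).1 (show x - c ∈ {x | 1 / 2 ≤ cdf μ x} from hx)]
  · have : y - c ≤ median μ := (isGLB_median μ).2 fun x hx => by
      have h1 : c + x ∈ {x | 1 / 2 ≤ cdf (μ.map (c + ·)) x} := by
        rw [Set.mem_ofPred_eq, hcdf, add_sub_cancel_left]; exact hx
      linarith [hy h1]
    linarith

/-! ### Mass and translation behaviour of the posterior update. -/

section Update

variable {p t : ℝ} {μ : Measure ℝ} {up : Prop}

lemma posteriorUpdate_absolutelyContinuous : posteriorUpdate p up t μ ≪ μ :=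
  withDensity_absolutelyContinuous _ _

lemma posteriorUpdate_real_toward_right (hp : 0 ≤ p) (hup : up) {A : Set ℝ}
    (hA : MeasurableSet A) (hAt : A ⊆ Set.Ici t) :
    (posteriorUpdate p up t μ).real A = 2 * p * μ.real A := by
  classical
  rw [Measure.real, posteriorUpdate, withDensity_apply _ hA,
    setLIntegral_congr_fun (g := fun _ => ENNReal.ofReal (2 * p)) hA fun x hx => by
      simp only [if_pos (show (up ↔ t ≤ x) from ⟨fun _ => hAt hx, fun _ => hup⟩)],
    setLIntegral_const, ENNReal.toReal_mul, ENNReal.toReal_ofReal (by linarith)]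
  rfl

lemma posteriorUpdate_real_away_left (hp : p ≤ 1) (hup : up) {A : Set ℝ}
    (hA : MeasurableSet A) (hAt : A ⊆ Set.Iio t) :
    (posteriorUpdate p up t μ).real A = 2 * (1 - p) * μ.real A := by
  classical
  rw [Measure.real, posteriorUpdate, withDensity_apply _ hA,
    setLIntegral_congr_fun (g := fun _ => ENNReal.ofReal (2 * (1 - p))) hA fun x hx => by
      simp only [if_neg (show ¬ (up ↔ t ≤ x) from fun h => absurd (h.1 hup) (not_le.2 (hAt hx)))],
    setLIntegral_const, ENNReal.toReal_mul, ENNReal.toReal_ofReal (by linarith)]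
  rfl

lemma posteriorUpdate_real_toward_left (hp : 0 ≤ p) (hup : ¬ up) {A : Set ℝ}
    (hA : MeasurableSet A) (hAt : A ⊆ Set.Iio t) :
    (posteriorUpdate p up t μ).real A = 2 * p * μ.real A := by
  classical
  rw [Measure.real, posteriorUpdate, withDensity_apply _ hA,
    setLIntegral_congr_fun (g := fun _ => ENNReal.ofReal (2 * p)) hA fun x hx => by
      simp only [if_pos (show (up ↔ t ≤ x) from
        ⟨fun h => absurd h hup, fun h => absurd h (not_le.2 (hAt hx))⟩)],
    setLIntegral_const, ENNReal.toReal_mul, ENNReal.toReal_ofReal (by linarith)]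
  rfl

lemma posteriorUpdate_real_away_right (hp : p ≤ 1) (hup : ¬ up) {A : Set ℝ}
    (hA : MeasurableSet A) (hAt : A ⊆ Set.Ici t) :
    (posteriorUpdate p up t μ).real A = 2 * (1 - p) * μ.real A := by
  classical
  rw [Measure.real, posteriorUpdate, withDensity_apply _ hA,
    setLIntegral_congr_fun (g := fun _ => ENNReal.ofReal (2 * (1 - p))) hA fun x hx => by
      simp only [if_neg (show ¬ (up ↔ t ≤ x) from fun h => hup (h.2 (hAt hx)))],
    setLIntegral_const, ENNReal.toReal_mul, ENNReal.toReal_ofReal (by linarith)]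
  rfl

lemma isFiniteMeasure_posteriorUpdate [IsFiniteMeasure μ] :
    IsFiniteMeasure (posteriorUpdate p up t μ) := by
  classical
  refine isFiniteMeasure_withDensity (ne_of_lt ?_)
  calc _ ≤ ∫⁻ _, (ENNReal.ofReal (2 * p) + ENNReal.ofReal (2 * (1 - p))) ∂μ := by
        refine lintegral_mono fun x => ?_
        split_ifs
        · exact le_self_add
        · exact le_add_self
    _ < ⊤ := by
        rw [lintegral_const]
        exact ENNReal.mul_lt_top
          (ENNReal.add_lt_top.2 ⟨ENNReal.ofReal_lt_top, ENNReal.ofReal_lt_top⟩) (measure_lt_top _ _)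

/-- No renormalization is needed because the query point is the median: the two halves get mass `p`
and `1 - p`. -/
lemma isProbabilityMeasure_posteriorUpdate [IsProbabilityMeasure μ] (hp0 : 0 ≤ p) (hp1 : p ≤ 1)
    (hμ : μ ≪ volume) : IsProbabilityMeasure (posteriorUpdate p up (median μ) μ) := by
  have := isFiniteMeasure_posteriorUpdate (p := p) (t := median μ) (μ := μ) (up := up)
  rw [isProbabilityMeasure_iff_real]
  have h1 : (posteriorUpdate p up (median μ) μ).real Set.univ
      = (posteriorUpdate p up (median μ) μ).real (Set.Iio (median μ))
        + (posteriorUpdate p up (median μ) μ).real (Set.Ici (median μ)) := by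
    rw [← measureReal_union (by
      rw [Set.disjoint_left]; exact fun x hx hx' => (not_lt.2 (Set.mem_Ici.1 hx')) (Set.mem_Iio.1 hx)) measurableSet_Ici,
      Set.Iio_union_Ici]
  rw [h1]
  by_cases hup : up
  · rw [posteriorUpdate_real_away_left hp1 hup measurableSet_Iio subset_rfl,
      posteriorUpdate_real_toward_right hp0 hup measurableSet_Ici subset_rfl,
      real_Iio_median hμ, real_Ici_median hμ]
    ring
  · rw [posteriorUpdate_real_toward_left hp0 hup measurableSet_Iio subset_rfl,
      posteriorUpdate_real_away_right hp1 hup measurableSet_Ici subset_rfl,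
      real_Iio_median hμ, real_Ici_median hμ]
    ring

lemma posteriorUpdate_map_add (c : ℝ) :
    posteriorUpdate p up (c + t) (μ.map (c + ·)) = (posteriorUpdate p up t μ).map (c + ·) := by
  classical
  have hm : Measurable fun x : ℝ => c + x := by fun_prop
  ext A hA
  have hf : Measurable fun x : ℝ =>
      ENNReal.ofReal (if (up ↔ c + t ≤ x) then 2 * p else 2 * (1 - p)) := by
    refine Measurable.ennreal_ofReal (Measurable.ite ?_ measurable_const measurable_const)
    by_cases hup : up
    · simp only [hup, true_iff]; exact measurableSet_Ici
    · simp only [hup, false_iff, not_le]; exact measurableSet_Iio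
  rw [Measure.map_apply hm hA, posteriorUpdate, posteriorUpdate, withDensity_apply _ hA,
    withDensity_apply _ (hm hA), setLIntegral_map hA hf hm]
  simp only [add_le_add_iff_left]

end Update

/-! ### Bisection as a walk on sign sequences -/

/-- The posterior after the moves `l` (latest first), for the uniform prior of radius `r` at `c`. -/
noncomputable def signPost (p c r : ℝ) : List Bool → Measure ℝ
  | [] => cond volume (Set.Icc (c - r) (c + r))
  | b :: l => posteriorUpdate p (b = true) (median (signPost p c r l)) (signPost p c r l)

/-- The query point after the moves `l`. -/
noncomputable def signQuery (p c r : ℝ) (l : List Bool) : ℝ := median (signPost p c r l)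

section SignPost

variable {p c r : ℝ}

lemma prior_ac : (cond volume (Set.Icc (c - r) (c + r)) : Measure ℝ) ≪ volume :=
  cond_absolutelyContinuous

lemma prior_prob (hr : 0 < r) :
    IsProbabilityMeasure (cond volume (Set.Icc (c - r) (c + r)) : Measure ℝ) := by
  refine cond_isProbabilityMeasure_of_finite ?_ ?_
  · rw [Real.volume_Icc, ne_eq, ENNReal.ofReal_eq_zero, not_le]; linarith
  · rw [Real.volume_Icc]; exact ENNReal.ofReal_ne_top

lemma signPost_prob_ac (hp0 : 0 ≤ p) (hp1 : p ≤ 1) (hr : 0 < r) (l : List Bool) :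
    IsProbabilityMeasure (signPost p c r l) ∧ signPost p c r l ≪ volume := by
  induction l with
  | nil => exact ⟨prior_prob hr, prior_ac⟩
  | cons b l ih =>
    have := ih.1
    exact ⟨isProbabilityMeasure_posteriorUpdate hp0 hp1 ih.2,
      posteriorUpdate_absolutelyContinuous.trans ih.2⟩

lemma signPost_ac_prior (l : List Bool) :
    signPost p c r l ≪ cond volume (Set.Icc (c - r) (c + r)) := by
  induction l with
  | nil => exact Measure.AbsolutelyContinuous.rfl
  | cons b l ih => exact posteriorUpdate_absolutelyContinuous.trans ih

lemma prior_real_of_subset (hr : 0 < r) {A : Set ℝ} (hA : A ⊆ Set.Ioo (c - r) (c + r)) :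
    (cond volume (Set.Icc (c - r) (c + r)) : Measure ℝ).real A = 1 / (2 * r) * volume.real A := by
  have h : Set.Icc (c - r) (c + r) ∩ A = A :=
    Set.inter_eq_right.2 (hA.trans Set.Ioo_subset_Icc_self)
  rw [Measure.real, cond_apply measurableSet_Icc, h, Real.volume_Icc, ENNReal.toReal_mul,
    ENNReal.toReal_inv, ENNReal.toReal_ofReal (by linarith)]
  rw [show c + r - (c - r) = 2 * r by ring, one_div]
  rfl

lemma prior_compl_Ioo (hr : 0 < r) :
    (cond volume (Set.Icc (c - r) (c + r)) : Measure ℝ) (Set.Ioo (c - r) (c + r))ᶜ = 0 := by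
  have := prior_prob (c := c) hr
  rw [prob_compl_eq_zero_iff measurableSet_Ioo]
  have h := prior_real_of_subset (c := c) hr (subset_refl (Set.Ioo (c - r) (c + r)))
  rw [Real.volume_real_Ioo_of_le (by linarith)] at h
  have h1 : 1 / (2 * r) * (c + r - (c - r)) = 1 := by field_simp; ring
  rw [h1, Measure.real] at h
  exact (ENNReal.toReal_eq_one_iff _).1 h

/-- Updates never create mass outside the prior interval, so the query stays inside it whatever the
answers are. Feasibility of all queries rests on this. -/
lemma signQuery_mem (hp0 : 0 ≤ p) (hp1 : p ≤ 1) (hr : 0 < r) (l : List Bool) :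
    signQuery p c r l ∈ Set.Ioo (c - r) (c + r) := by
  have := (signPost_prob_ac (c := c) hp0 hp1 hr l).1
  refine median_mem_Ioo (signPost_prob_ac hp0 hp1 hr l).2 ?_
  rw [Measure.real, signPost_ac_prior l (prior_compl_Ioo hr)]
  norm_num

lemma signPost_translate (hp0 : 0 ≤ p) (hp1 : p ≤ 1) (hr : 0 < r) (l : List Bool) :
    signPost p c r l = (signPost p 0 r l).map (c + ·) := by
  induction l with
  | nil =>
    have hm : Measurable fun x : ℝ => c + x := by fun_prop
    ext A hA
    rw [Measure.map_apply hm hA]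
    simp only [signPost]
    rw [cond_apply measurableSet_Icc, cond_apply measurableSet_Icc, Real.volume_Icc,
      Real.volume_Icc]
    congr 1
    · congr 2; ring
    · rw [← measure_preimage_add volume c (Set.Icc (c - r) (c + r) ∩ A)]
      congr 1
      ext x
      simp only [Set.mem_inter_iff, Set.mem_preimage, Set.mem_Icc]
      constructor
      · rintro ⟨⟨h1, h2⟩, h3⟩; exact ⟨⟨by linarith, by linarith⟩, h3⟩
      · rintro ⟨⟨h1, h2⟩, h3⟩; exact ⟨⟨by linarith, by linarith⟩, h3⟩
  | cons b l ih =>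
    have := (signPost_prob_ac (c := 0) hp0 hp1 hr l).1
    simp only [signPost]
    rw [ih, median_map_add, posteriorUpdate_map_add]

/-- Separates the real centre from the discrete history of moves, which makes measurability in the
Lasso estimate easy. -/
lemma signQuery_translate (hp0 : 0 ≤ p) (hp1 : p ≤ 1) (hr : 0 < r) (l : List Bool) :
    signQuery p c r l = c + signQuery p 0 r l := by
  have := (signPost_prob_ac (c := 0) hp0 hp1 hr l).1
  rw [signQuery, signPost_translate hp0 hp1 hr, median_map_add]
  rfl

/-- All moves were towards `x`. -/
def MovesToward (p c r x : ℝ) : List Bool → Prop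
  | [] => True
  | b :: l => (b = true → signQuery p c r l ≤ x) ∧ (b = false → x ≤ signQuery p c r l) ∧
      MovesToward p c r x l

/-- If all moves were towards `x`, most of the posterior mass sits on an interval containing `x`
on which the density is `(2p)^k / (2r)`. -/
lemma exists_interval_of_movesToward (hp0 : 1 / 2 < p) (hp1 : p ≤ 1) (hr : 0 < r) {x : ℝ}
    (hx : x ∈ Set.Icc (c - r) (c + r)) :
    ∀ l : List Bool, (1 - p) * (2 ^ l.length - 1) < 1 / 2 → MovesToward p c r x l →
      ∃ lo hi, x ∈ Set.Icc lo hi ∧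
        (∀ A, MeasurableSet A → A ⊆ Set.Ioo lo hi →
          (signPost p c r l).real A = (2 * p) ^ l.length / (2 * r) * volume.real A) ∧
        (signPost p c r l).real (Set.Ioo lo hi)ᶜ ≤ (1 - p) * (2 ^ l.length - 1) := by
  intro l
  induction l with
  | nil =>
    intro _ _
    refine ⟨c - r, c + r, hx, fun A _ hA => ?_, ?_⟩
    · rw [List.length_nil, pow_zero]
      exact prior_real_of_subset hr hA
    · rw [signPost, Measure.real, prior_compl_Ioo hr]; simp
  | cons b l ih =>
    intro hlen hmoves
    obtain ⟨hb1, hb2, hl⟩ := hmoves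
    rw [List.length_cons, pow_succ] at hlen
    have h2k : (1 : ℝ) ≤ 2 ^ l.length := one_le_pow₀ (by norm_num)
    have hlen' : (1 - p) * (2 ^ l.length - 1) < 1 / 2 := by nlinarith
    obtain ⟨lo, hi, hxm, hdens, hout⟩ := ih hlen' hl
    set μ := signPost p c r l with hμ
    have hprob : IsProbabilityMeasure μ := (signPost_prob_ac (by linarith) hp1 hr l).1
    have hac : μ ≪ volume := (signPost_prob_ac (by linarith) hp1 hr l).2
    have hprob' : IsProbabilityMeasure (signPost p c r (b :: l)) :=
      (signPost_prob_ac (by linarith) hp1 hr (b :: l)).1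
    set t := signQuery p c r l with ht
    have htmed : t = median μ := rfl
    have htmem : t ∈ Set.Ioo lo hi := median_mem_Ioo hac (lt_of_le_of_lt hout hlen')
    have hnew : signPost p c r (b :: l) = posteriorUpdate p (b = true) t μ := rfl
    -- If `o` is the old mass outside the interval, the half towards `x` keeps at least `1/2 - o`
    -- inside it, so the new outside mass is at most `1 - 2p(1/2 - o) ≤ (1 - p) + 2o`. This
    -- recursion is solved by `(1 - p) * (2 ^ k - 1)`.
    have houtbound : ∀ I : Set ℝ, MeasurableSet I →
        (signPost p c r (b :: l)).real I = 2 * p * μ.real I →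
        1 / 2 ≤ μ.real I + μ.real (Set.Ioo lo hi)ᶜ →
        (signPost p c r (b :: l)).real Iᶜ ≤ (1 - p) * (2 ^ (b :: l).length - 1) := by
      intro I hI h1 h2
      rw [probReal_compl_eq_one_sub hI, h1, List.length_cons, pow_succ]
      have h3 : 0 ≤ μ.real (Set.Ioo lo hi)ᶜ := measureReal_nonneg
      have h4 : 2 * p * (1 / 2 - μ.real (Set.Ioo lo hi)ᶜ) ≤ 2 * p * μ.real I := by
        gcongr; linarith
      nlinarith
    cases b with
    | true =>
      refine ⟨t, hi, ⟨hb1 rfl, hxm.2⟩, fun A hA hAs => ?_, ?_⟩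
      · rw [hnew, posteriorUpdate_real_toward_right (by linarith) rfl hA
          (hAs.trans (Set.Ioo_subset_Ioi_self.trans Set.Ioi_subset_Ici_self)),
          hdens A hA (hAs.trans (Set.Ioo_subset_Ioo_left htmem.1.le)), List.length_cons, pow_succ]
        ring
      · refine houtbound _ measurableSet_Ioo ?_ ?_
        · rw [hnew, posteriorUpdate_real_toward_right (by linarith) rfl measurableSet_Ioo
            (Set.Ioo_subset_Ioi_self.trans Set.Ioi_subset_Ici_self)]
        · have h1 : μ.real (Set.Ioi t) = 1 / 2 := by
            rw [← real_Ici_median hac, ← htmed]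
            exact congrArg ENNReal.toReal (measure_congr (hac.ae_eq Ioi_ae_eq_Ici))
          rw [← h1]
          refine (measureReal_mono (fun y hy => ?_)).trans (measureReal_union_le _ _)
          by_cases hyh : y < hi
          · exact Or.inl ⟨hy, hyh⟩
          · exact Or.inr fun h => hyh h.2
    | false =>
      have hf : ¬ (false = true) := by simp
      refine ⟨lo, t, ⟨hxm.1, hb2 rfl⟩, fun A hA hAs => ?_, ?_⟩
      · rw [hnew, posteriorUpdate_real_toward_left (by linarith) hf hA
          (hAs.trans Set.Ioo_subset_Iio_self),
          hdens A hA (hAs.trans (Set.Ioo_subset_Ioo_right htmem.2.le)), List.length_cons, pow_succ]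
        ring
      · refine houtbound _ measurableSet_Ioo ?_ ?_
        · rw [hnew, posteriorUpdate_real_toward_left (by linarith) hf measurableSet_Ioo
            Set.Ioo_subset_Iio_self]
        · rw [← real_Iio_median hac, ← htmed]
          refine (measureReal_mono (fun y hy => ?_)).trans (measureReal_union_le _ _)
          by_cases hyl : lo < y
          · exact Or.inl ⟨hyl, hy⟩
          · exact Or.inr fun h => hyl h.1

/-- If all moves were towards `x`, the query point converges to `x` geometrically. -/
lemma abs_signQuery_sub_le (hp0 : 1 / 2 < p) (hp1 : p ≤ 1) (hr : 0 < r) {x : ℝ}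
    (hx : x ∈ Set.Icc (c - r) (c + r)) {l : List Bool}
    (hlen : (1 - p) * (2 ^ l.length - 1) < 1 / 2) (hl : MovesToward p c r x l) :
    |signQuery p c r l - x| ≤ 2 * r / (2 * p) ^ l.length := by
  obtain ⟨lo, hi, hxm, hdens, hout⟩ := exists_interval_of_movesToward hp0 hp1 hr hx l hlen hl
  have hprob : IsProbabilityMeasure (signPost p c r l) :=
    (signPost_prob_ac (by linarith) hp1 hr l).1
  have htmem : signQuery p c r l ∈ Set.Ioo lo hi :=
    median_mem_Ioo (signPost_prob_ac (by linarith) hp1 hr l).2 (lt_of_le_of_lt hout hlen)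
  have h1 := hdens _ measurableSet_Ioo subset_rfl
  rw [Real.volume_real_Ioo_of_le (hxm.1.trans hxm.2)] at h1
  have h2 : (signPost p c r l).real (Set.Ioo lo hi) ≤ 1 := measureReal_le_one
  have hpk : 0 < (2 * p) ^ l.length := pow_pos (by linarith) _
  have h3 : hi - lo ≤ 2 * r / (2 * p) ^ l.length := by
    rw [h1, div_mul_eq_mul_div, div_le_one (by positivity)] at h2
    rw [le_div_iff₀ hpk]
    linarith
  refine le_trans ?_ h3
  rw [abs_le]
  constructor <;> linarith [htmem.1, htmem.2, hxm.1, hxm.2]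

end SignPost

/-- The walk reaches the boundary after `m` comparisons. -/
def Crosses (η : ℝ) (z : ℕ → ℤ) (m : ℕ) : Prop := testBoundary η m ≤ |(walk z m : ℝ)|

/-- The direction in which the walk first reaches the boundary within the first `N` comparisons,
if it does. -/
noncomputable def verdict (η : ℝ) (z : ℕ → ℤ) : ℕ → Option Bool
  | 0 => none
  | m + 1 =>
    open Classical in
    match verdict η z m with
    | some b => some b
    | none => if Crosses η z (m + 1) then some (decide (0 < walk z (m + 1))) else none

lemma not_crosses_of_verdict_eq_none {η : ℝ} {z : ℕ → ℤ} {N : ℕ} (h : verdict η z N = none) :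
    ∀ m, 1 ≤ m → m ≤ N → ¬ Crosses η z m := by
  induction N with
  | zero => intro m h1 h2; omega
  | succ N ih =>
    intro m h1 h2
    rw [verdict] at h
    cases hv : verdict η z N with
    | some b => rw [hv] at h; simp at h
    | none =>
      rw [hv] at h
      rcases Nat.lt_or_ge m (N + 1) with h3 | h3
      · exact ih hv m h1 (by omega)
      · obtain rfl : m = N + 1 := by omega
        intro hc
        simp [hc] at h

lemma exists_crosses_of_verdict_eq_some {η : ℝ} {z : ℕ → ℤ} {N : ℕ} {b : Bool}
    (h : verdict η z N = some b) :
    ∃ m, 1 ≤ m ∧ m ≤ N ∧ Crosses η z m ∧ (∀ j, 1 ≤ j → j < m → ¬ Crosses η z j) ∧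
      (b = true ↔ 0 < walk z m) := by
  induction N with
  | zero => simp [verdict] at h
  | succ N ih =>
    rw [verdict] at h
    cases hv : verdict η z N with
    | some b' =>
      rw [hv] at h
      obtain rfl : b' = b := by simpa using h
      obtain ⟨m, h1, h2, h3⟩ := ih hv
      exact ⟨m, h1, by omega, h3⟩
    | none =>
      rw [hv] at h
      by_cases hc : Crosses η z (N + 1)
      · simp only [hc, if_true, Option.some.injEq] at h
        refine ⟨N + 1, by omega, le_rfl, hc, fun j hj hjN =>
          not_crosses_of_verdict_eq_none hv j hj (by omega), ?_⟩
        rw [← h]; simp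
      · simp [hc] at h

/-- One horizontal step on the level of sign sequences; the flag records termination. -/
def signStep (st : List Bool × Bool) (o : Option Bool) : List Bool × Bool :=
  if st.2 then st else
    match o with
    | some b => (b :: st.1, false)
    | none => (st.1, true)

lemma signStep_of_stopped {st : List Bool × Bool} (h : st.2 = true) (o : Option Bool) :
    signStep st o = st := by
  simp [signStep, h]

lemma signStep_some {st : List Bool × Bool} (h : ¬ st.2 = true) (b : Bool) :
    signStep st (some b) = (b :: st.1, false) := by
  simp [signStep, h]

lemma signStep_none {st : List Bool × Bool} (h : ¬ st.2 = true) :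
    signStep st none = (st.1, true) := by
  simp [signStep, h]

/-- The bisection on the level of sign sequences. -/
noncomputable def signRun (η p c r : ℝ) (M : ℕ) (ans : ℝ → ℕ → ℕ → ℤ) : ℕ → List Bool × Bool
  | 0 => ([], false)
  -- The horizon is `M - 1`, not `M`: at comparison `M` the cap ends the search and the query is
  -- returned, even if the walk crosses at that very moment.
  | k + 1 => signStep (signRun η p c r M ans k)
      (verdict η (ans (signQuery p c r (signRun η p c r M ans k).1) k) (M - 1))

/-! ### The algorithm coincides with the recursion on sign sequences. -/

section Run

variable {P : BisectionParams} {c r : ℝ} {ans : ℝ → ℕ → ℕ → ℤ}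

/-- The prior of the bisection around `c`. -/
noncomputable abbrev bisPrior (c r : ℝ) : Measure ℝ := cond volume (Set.Icc (c - r) (c + r))

/-- With the cap in force from step 0, every vertical move ends after at most `cap` comparisons.
Hence the branch of infinite cost never occurs, and a step is decided by whether the first crossing
comes strictly before the cap. -/
lemma bisectionRun_eq (hloc : P.localSteps = 0) (hcap : 1 ≤ P.cap) (k : ℕ) :
    (bisectionRun P (bisPrior c r) ans k).post
        = signPost P.p c r (signRun P.η P.p c r P.cap ans k).1 ∧
      (bisectionRun P (bisPrior c r) ans k).result
        = (if (signRun P.η P.p c r P.cap ans k).2 then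
            some (signQuery P.p c r (signRun P.η P.p c r P.cap ans k).1) else none) ∧
      (bisectionRun P (bisPrior c r) ans k).cost ≤ (k * P.cap : ℕ) := by
  classical
  induction k with
  | zero => simp [bisectionRun, signRun, signPost]
  | succ k ih =>
    obtain ⟨h1, h2, h3⟩ := ih
    set st := bisectionRun P (bisPrior c r) ans k with hst
    set ss := signRun P.η P.p c r P.cap ans k with hss
    have hk : ((k * P.cap : ℕ) : ℝ≥0∞) ≤ ((k + 1) * P.cap : ℕ) := by
      exact_mod_cast Nat.mul_le_mul_right _ (Nat.le_succ k)
    have hrun : bisectionRun P (bisPrior c r) ans (k + 1) = bisectionStep P ans k st := rfl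
    have hsrun : signRun P.η P.p c r P.cap ans (k + 1)
        = signStep ss (verdict P.η (ans (signQuery P.p c r ss.1) k) (P.cap - 1)) := rfl
    rw [hrun, hsrun]
    by_cases hhalt : ss.2 = true
    · rw [if_pos hhalt] at h2
      have hs1 : signStep ss (verdict P.η (ans (signQuery P.p c r ss.1) k) (P.cap - 1)) = ss :=
        signStep_of_stopped hhalt _
      have hs2 : bisectionStep P ans k st = st := by
        rw [bisectionStep, h2]
      rw [hs1, hs2, if_pos hhalt]
      exact ⟨h1, h2, h3.trans hk⟩
    · rw [if_neg hhalt] at h2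
      set t := signQuery P.p c r ss.1 with ht
      have htm : median st.post = t := by rw [h1, ht, signQuery]
      set z := ans t k with hz
      have hcapiff : ∀ m, capReached P k m ↔ P.cap ≤ m := fun m => by
        simp [capReached, hloc]
      have hex : ∃ m, verticalStop P z k m := ⟨P.cap, hcap, Or.inl ((hcapiff _).2 le_rfl)⟩
      have hvs : ∀ m, verticalStop P z k m ↔ 1 ≤ m ∧ (P.cap ≤ m ∨ Crosses P.η z m) := fun m => by
        rw [verticalStop, hcapiff]; rfl
      have hs2 : bisectionStep P ans k st
          = if capReached P k (Nat.find hex) then ⟨st.post, st.cost + Nat.find hex, some t⟩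
            else ⟨posteriorUpdate P.p (0 < walk z (Nat.find hex)) t st.post,
              st.cost + Nat.find hex, none⟩ := by
        rw [bisectionStep, h2]
        simp only [htm]
        rw [dif_pos hex]
      have hfle : Nat.find hex ≤ P.cap :=
        Nat.find_min' hex ⟨hcap, Or.inl ((hcapiff _).2 le_rfl)⟩
      have hcost : st.cost + (Nat.find hex : ℝ≥0∞) ≤ ((k + 1) * P.cap : ℕ) := by
        calc st.cost + (Nat.find hex : ℝ≥0∞) ≤ ((k * P.cap : ℕ) : ℝ≥0∞) + (P.cap : ℝ≥0∞) := by
              gcongr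
          _ = ((k + 1) * P.cap : ℕ) := by push_cast; ring
      cases hv : verdict P.η z (P.cap - 1) with
      | none =>
        have hno := not_crosses_of_verdict_eq_none hv
        have hf : P.cap ≤ Nat.find hex := by
          by_contra! hlt
          have h4 := (hvs _).1 (Nat.find_spec hex)
          rcases h4.2 with h5 | h5
          · omega
          · exact hno _ h4.1 (by omega) h5
        have hs1 := signStep_none hhalt
        rw [hs1, hs2, if_pos ((hcapiff _).2 hf)]
        refine ⟨h1, by simp [ht], hcost⟩
      | some b =>
        obtain ⟨m, hm1, hm2, hm3, hm4, hmb⟩ := exists_crosses_of_verdict_eq_some hv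
        have hf : Nat.find hex = m := by
          rw [Nat.find_eq_iff]
          refine ⟨(hvs _).2 ⟨hm1, Or.inr hm3⟩, fun j hj hjs => ?_⟩
          have h4 := (hvs _).1 hjs
          rcases h4.2 with h5 | h5
          · omega
          · exact hm4 j h4.1 hj h5
        have hs1 := signStep_some hhalt b
        have hncap : ¬ capReached P k (Nat.find hex) := by
          rw [hcapiff, hf]; omega
        rw [hs1, hs2, if_neg hncap]
        refine ⟨?_, by simp, hcost⟩
        have hprop : (0 < walk z (Nat.find hex)) = (b = true) := by rw [hf]; exact propext hmb.symm
        simp only [hprop, h1, signPost]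
        rfl

/-- With the cap in force from the start, the bisection returns the last query point after at most
`maxSteps * cap` comparisons. -/
lemma bisection_eq (hloc : P.localSteps = 0) (hcap : 1 ≤ P.cap) :
    (bisection P (bisPrior c r) ans).1
        = signQuery P.p c r (signRun P.η P.p c r P.cap ans P.maxSteps).1 ∧
      (bisection P (bisPrior c r) ans).2 ≤ (P.maxSteps * P.cap : ℕ) := by
  obtain ⟨h1, h2, h3⟩ := bisectionRun_eq (P := P) (c := c) (r := r) (ans := ans) hloc hcap
    P.maxSteps
  refine ⟨?_, h3⟩
  simp only [bisection]
  rw [h2]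
  split_ifs
  · rfl
  · rw [h1]; rfl

/-- If the answers to all queries are faithful, the bisection succeeds. -/
lemma abs_signQuery_run_sub_le {η p x ε : ℝ} {M K : ℕ} (hp0 : 1 / 2 < p) (hp1 : p ≤ 1)
    (hr : 0 < r) (hM : 2 ≤ M) (hx : x ∈ Set.Icc (c - r) (c + r))
    (hK : (1 - p) * (2 ^ K - 1) < 1 / 2) (hKε : 2 * r / (2 * p) ^ K ≤ ε)
    (hans : ∀ k < K, Faithful η M x ε (signQuery p c r (signRun η p c r M ans k).1)
      (ans (signQuery p c r (signRun η p c r M ans k).1) k)) :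
    |signQuery p c r (signRun η p c r M ans K).1 - x| ≤ ε := by
  -- Invariant: all moves so far were correct; a running search has made exactly `k` moves; a
  -- stopped search sits within `ε` of `x`, since the walk of a far query would have crossed before
  -- the cap.
  have key : ∀ k ≤ K, MovesToward p c r x (signRun η p c r M ans k).1 ∧
      ((signRun η p c r M ans k).2 = false → (signRun η p c r M ans k).1.length = k) ∧
      ((signRun η p c r M ans k).2 = true →
        |signQuery p c r (signRun η p c r M ans k).1 - x| ≤ ε) := by
    intro k
    induction k with
    | zero => intro _; simp [signRun, MovesToward]
    | succ k ih =>
      intro hk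
      obtain ⟨h1, h2, h3⟩ := ih (by omega)
      have hF := hans k (by omega)
      have hsrun : signRun η p c r M ans (k + 1) = signStep (signRun η p c r M ans k)
        (verdict η (ans (signQuery p c r (signRun η p c r M ans k).1) k) (M - 1)) := rfl
      rw [hsrun]
      set ss := signRun η p c r M ans k with hss
      set t := signQuery p c r ss.1 with ht
      by_cases hhalt : ss.2 = true
      · rw [signStep_of_stopped hhalt]
        exact ⟨h1, fun h => by rw [hhalt] at h; simp at h, h3⟩
      · cases hv : verdict η (ans t k) (M - 1) with
        | none =>
          rw [signStep_none hhalt]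
          refine ⟨h1, fun h => by simp at h, fun _ => ?_⟩
          by_contra! hfar
          exact not_crosses_of_verdict_eq_none hv (M - 1) (by omega) le_rfl (hF.cross hfar)
        | some b =>
          rw [signStep_some hhalt]
          obtain ⟨m, hm1, hm2, hm3, -, hmb⟩ := exists_crosses_of_verdict_eq_some hv
          refine ⟨⟨fun hb => ?_, fun hb => ?_, h1⟩, fun _ => ?_, fun h => by simp at h⟩
          · by_contra! hlt
            have h4 := hF.of_gt hlt m hm1 (by omega)
            have h5 : (0 : ℝ) < walk (ans t k) m := by exact_mod_cast hmb.1 hb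
            have h6 : testBoundary η m ≤ |(walk (ans t k) m : ℝ)| := hm3
            rw [abs_of_pos h5] at h6
            linarith
          · by_contra! hlt
            have h4 := hF.of_lt hlt m hm1 (by omega)
            have h5 : (walk (ans t k) m : ℝ) ≤ 0 := by
              have : ¬ 0 < walk (ans t k) m := fun h => by rw [hmb.2 h] at hb; simp at hb
              exact_mod_cast not_lt.1 this
            have h6 : testBoundary η m ≤ |(walk (ans t k) m : ℝ)| := hm3
            rw [abs_of_nonpos h5] at h6
            linarith
          · rw [List.length_cons, h2 (by simpa using hhalt)]
  obtain ⟨h1, h2, h3⟩ := key K le_rfl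
  by_cases hhalt : (signRun η p c r M ans K).2 = true
  · exact h3 hhalt
  · have hlen := h2 (by simpa using hhalt)
    refine (abs_signQuery_sub_le hp0 hp1 hr hx (by rw [hlen]; exact hK) h1).trans ?_
    rw [hlen]; exact hKε

end Run

/-! ### Measurability of the refinement -/

/-- Histories form a countable discrete space, so measurability of the adaptive procedure is checked
one history at a time, without a σ-algebra on posterior measures. -/
instance : MeasurableSpace (List Bool) := ⊤
instance : DiscreteMeasurableSpace (List Bool) := ⟨fun _ => trivial⟩
instance : MeasurableSpace (Option Bool) := ⊤
instance : DiscreteMeasurableSpace (Option Bool) := ⟨fun _ => trivial⟩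

section Measurability

variable {Ω : Type*} [MeasurableSpace Ω] {d : ℕ}

lemma measurable_pi_update (i : Fin d) {v : Ω → Fin d → ℝ} {t : Ω → ℝ} (hv : Measurable v)
    (ht : Measurable t) : Measurable fun ω => Function.update (v ω) i (t ω) := by
  refine measurable_pi_lambda _ fun j => ?_
  rcases eq_or_ne j i with rfl | h
  · simpa using ht
  · simp only [Function.update_of_ne h]
    exact (measurable_pi_apply j).comp hv

lemma measurable_answer (H : HumanModel d) (θ : Fin d → ℝ) (i : Fin d) (k m : ℕ)
    {v : Ω → Fin d → ℝ} {t : Ω → ℝ} {ξ : Ω → NoiseIndex d → ℝ} (hv : Measurable v)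
    (ht : Measurable t) (hξ : Measurable ξ) :
    Measurable fun ω => answer H θ (ξ ω) i (v ω) (t ω) k m := by
  classical
  have hq := measurable_pi_update i hv ht
  have hminus : Measurable fun ω => H.utility θ (H.cMinus (Function.update (v ω) i (t ω)) i) :=
    ((H.measurable_dist θ).comp
      (measurable_pi_update i hq ((H.measurable_lo i).comp hq))).neg
  have hplus : Measurable fun ω => H.utility θ (H.cPlus (Function.update (v ω) i (t ω)) i) :=
    ((H.measurable_dist θ).comp
      (measurable_pi_update i hq ((H.measurable_hi i).comp hq))).neg
  unfold answer
  refine Measurable.ite (measurableSet_lt (hminus.add ((measurable_pi_apply _).comp hξ))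
    (hplus.add ((measurable_pi_apply _).comp hξ))) measurable_const measurable_const

lemma measurable_walk {z : Ω → ℕ → ℤ} (hz : ∀ m, Measurable fun ω => z ω m) (m : ℕ) :
    Measurable fun ω => walk (z ω) m := by
  unfold walk
  exact Finset.measurable_fun_sum _ fun j _ => hz j

lemma measurableSet_crosses (η : ℝ) {z : Ω → ℕ → ℤ} (hz : ∀ m, Measurable fun ω => z ω m)
    (m : ℕ) : MeasurableSet {ω | Crosses η (z ω) m} := by
  have h : Measurable fun ω => |(walk (z ω) m : ℝ)| :=
    (measurable_from_top (f := fun n : ℤ => |(n : ℝ)|)).comp (measurable_walk hz m)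
  exact h measurableSet_Ici

lemma measurable_verdict (η : ℝ) {z : Ω → ℕ → ℤ} (hz : ∀ m, Measurable fun ω => z ω m)
    (N : ℕ) : Measurable fun ω => verdict η (z ω) N := by
  classical
  induction N with
  | zero => exact measurable_const
  | succ N ih =>
    have h1 : Measurable fun ω => if Crosses η (z ω) (N + 1) then
        some (decide (0 < walk (z ω) (N + 1))) else none :=
      Measurable.ite (measurableSet_crosses η hz (N + 1))
        ((measurable_from_top (f := fun n : ℤ => some (decide (0 < n)))).comp
          (measurable_walk hz (N + 1))) measurable_const
    have h2 : Measurable fun q : Option Bool × Option Bool =>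
        (match q.1 with | some b => some b | none => q.2 : Option Bool) :=
      Measurable.of_discrete
    exact h2.comp (ih.prodMk h1)

/-- By translation the query is the centre plus a function of a discrete variable. -/
lemma measurable_signQuery {p r : ℝ} (hp0 : 0 ≤ p) (hp1 : p ≤ 1) (hr : 0 < r) {c : Ω → ℝ}
    (hc : Measurable c) {l : Ω → List Bool} (hl : Measurable l) :
    Measurable fun ω => signQuery p (c ω) r (l ω) := by
  simp only [signQuery_translate hp0 hp1 hr (c := c _)]
  exact hc.add ((measurable_from_top (f := signQuery p 0 r)).comp hl)

/-- For a fixed previous state the query is measurable in `ω`, and there are only countably many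
states. -/
lemma measurable_signRun (H : HumanModel d) (θ : Fin d → ℝ) (i : Fin d) {η p r : ℝ} (M : ℕ)
    (hp0 : 0 ≤ p) (hp1 : p ≤ 1) (hr : 0 < r) {c : Ω → ℝ} {v : Ω → Fin d → ℝ}
    {ξ : Ω → NoiseIndex d → ℝ} (hc : Measurable c) (hv : Measurable v) (hξ : Measurable ξ)
    (k : ℕ) :
    Measurable fun ω => signRun η p (c ω) r M (answer H θ (ξ ω) i (v ω)) k := by
  induction k with
  | zero => exact measurable_const
  | succ k ih =>
    have h1 : Measurable fun q : (List Bool × Bool) × Ω =>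
        signStep q.1 (verdict η (answer H θ (ξ q.2) i (v q.2) (signQuery p (c q.2) r q.1.1) k)
          (M - 1)) := by
      refine measurable_from_prod_countable_right fun st => ?_
      have hverdict : Measurable fun ω =>
          verdict η (answer H θ (ξ ω) i (v ω) (signQuery p (c ω) r st.1) k) (M - 1) :=
        measurable_verdict η (fun m => measurable_answer H θ i k m hv
          (measurable_signQuery hp0 hp1 hr hc measurable_const) hξ) (M - 1)
      exact (Measurable.of_discrete (f := signStep st)).comp hverdict
    exact h1.comp (ih.prodMk measurable_id)

end Measurability

/-! ### The models visited by the refinement -/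

section Model

variable {d : ℕ}

/-- Refinement of the coordinate `i` of the model `v`. -/
noncomputable def modelStep (T : Tuning) (H : HumanModel d) (θ : Fin d → ℝ)
    (ξ : NoiseIndex d → ℝ) (θ₀ v : Fin d → ℝ) (i : Fin d) : Fin d → ℝ :=
  open Classical in
  if θ₀ i = 0 then v else Function.update v i (signQuery T.bis.p (θ₀ i) T.radius
    (signRun T.bis.η T.bis.p (θ₀ i) T.radius T.bis.cap (answer H θ ξ i v) T.bis.maxSteps).1)

/-- The model after the refinement of the coordinates in `l`. -/
noncomputable def modelAfter (T : Tuning) (H : HumanModel d) (θ : Fin d → ℝ)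
    (ξ : NoiseIndex d → ℝ) (θ₀ : Fin d → ℝ) (l : List (Fin d)) : Fin d → ℝ :=
  l.foldl (modelStep T H θ ξ θ₀) θ₀

variable {T : Tuning} {H : HumanModel d} {θ : Fin d → ℝ}

lemma modelAfter_append_singleton (ξ : NoiseIndex d → ℝ) (θ₀ : Fin d → ℝ) (l : List (Fin d))
    (i : Fin d) : modelAfter T H θ ξ θ₀ (l ++ [i])
      = modelStep T H θ ξ θ₀ (modelAfter T H θ ξ θ₀ l) i := by
  simp [modelAfter]

/-- Each selected coordinate runs one capped bisection, so the comparisons are bounded surely by the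
number of nonzero entries of `θ₀` times the cost of one bisection. -/
lemma refine_eq (hloc : T.bis.localSteps = 0) (hcap : 1 ≤ T.bis.cap) (ξ : NoiseIndex d → ℝ)
    (θ₀ : Fin d → ℝ) :
    (refine T H θ ξ θ₀).1 = modelAfter T H θ ξ θ₀ (List.finRange d) ∧
    ∀ S : Finset (Fin d), (∀ j, j ∉ S → θ₀ j = 0) →
      (refine T H θ ξ θ₀).2 ≤ (S.card * (T.bis.maxSteps * T.bis.cap) : ℕ) := by
  classical
  let f : (Fin d → ℝ) × ℝ≥0∞ → Fin d → (Fin d → ℝ) × ℝ≥0∞ := fun st i =>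
    if θ₀ i = 0 then st
    else
      let r := bisection T.bis
        (ProbabilityTheory.cond volume (Set.Icc (θ₀ i - T.radius) (θ₀ i + T.radius)))
        (answer H θ ξ i st.1)
      (Function.update st.1 i r.1, st.2 + r.2)
  have key : ∀ (l : List (Fin d)) (st : (Fin d → ℝ) × ℝ≥0∞),
      (l.foldl f st).1 = l.foldl (modelStep T H θ ξ θ₀) st.1 ∧
      (l.foldl f st).2 ≤ st.2 + ((l.filter fun i => θ₀ i ≠ 0).length
        * (T.bis.maxSteps * T.bis.cap) : ℕ) := by
    intro l
    induction l with
    | nil => intro st; simp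
    | cons i l ih =>
      intro st
      rw [List.foldl_cons, List.foldl_cons]
      obtain ⟨h1, h2⟩ := ih (f st i)
      by_cases hi : θ₀ i = 0
      · have hf : f st i = st := if_pos hi
        have hg : modelStep T H θ ξ θ₀ st.1 i = st.1 := if_pos hi
        rw [hf] at h1 h2 ⊢
        rw [hg, List.filter_cons_of_neg (by simpa using hi)]
        exact ⟨h1, h2⟩
      · obtain ⟨hb1, hb2⟩ := bisection_eq (P := T.bis) (c := θ₀ i) (r := T.radius)
          (ans := answer H θ ξ i st.1) hloc hcap
        have hf : f st i = (Function.update st.1 i (bisection T.bis (bisPrior (θ₀ i) T.radius)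
          (answer H θ ξ i st.1)).1, st.2 + (bisection T.bis (bisPrior (θ₀ i) T.radius)
          (answer H θ ξ i st.1)).2) := if_neg hi
        have hg : modelStep T H θ ξ θ₀ st.1 i = (f st i).1 := by
          rw [hf, hb1]; exact if_neg hi
        rw [hg, List.filter_cons_of_pos (by simpa using hi)]
        refine ⟨h1, h2.trans ?_⟩
        rw [hf, List.length_cons]
        calc _ ≤ st.2 + ((T.bis.maxSteps * T.bis.cap : ℕ) : ℝ≥0∞)
              + ((l.filter fun i => θ₀ i ≠ 0).length * (T.bis.maxSteps * T.bis.cap) : ℕ) :=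
              add_le_add (add_le_add le_rfl hb2) le_rfl
          _ = _ := by push_cast; ring
  have hdef : refine T H θ ξ θ₀ = (List.finRange d).foldl f (θ₀, 0) := by
    unfold refine
    congr 1
  obtain ⟨h1, h2⟩ := key (List.finRange d) (θ₀, 0)
  refine ⟨by rw [hdef, h1]; rfl, fun S hS => ?_⟩
  rw [hdef]
  refine h2.trans ?_
  rw [zero_add]
  have hlen : ((List.finRange d).filter fun i => θ₀ i ≠ 0).length ≤ S.card := by
    have hnd : ((List.finRange d).filter fun i => θ₀ i ≠ 0).Nodup :=
      (List.nodup_finRange d).filter _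
    rw [← List.toFinset_card_of_nodup hnd]
    refine Finset.card_le_card fun i hi => ?_
    by_contra hiS
    simp [hS i hiS] at hi
  exact_mod_cast Nat.mul_le_mul_right _ hlen

lemma measurable_modelAfter (hp0 : 0 ≤ T.bis.p) (hp1 : T.bis.p ≤ 1) (hr : 0 < T.radius)
    (H : HumanModel d) (θ : Fin d → ℝ) (l : List (Fin d)) :
    Measurable fun q : (Fin d → ℝ) × (NoiseIndex d → ℝ) => modelAfter T H θ q.2 q.1 l := by
  classical
  induction l using List.reverseRecOn with
  | nil => exact measurable_fst
  | append_singleton l i ih =>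
    simp only [modelAfter_append_singleton]
    unfold modelStep
    have hc : Measurable fun q : (Fin d → ℝ) × (NoiseIndex d → ℝ) => q.1 i :=
      (measurable_pi_apply i).comp measurable_fst
    refine Measurable.ite (hc (measurableSet_singleton 0)) ih ?_
    exact measurable_pi_update i ih (measurable_signQuery hp0 hp1 hr hc
      (measurable_fst.comp (measurable_signRun H θ i _ hp0 hp1 hr hc ih measurable_snd _)))

/-- The run is adapted: the state before step `K` uses only answers of earlier steps, so the noise
of step `K` is still fresh. -/
lemma signRun_congr {η p c r : ℝ} {M K : ℕ} {ans ans' : ℝ → ℕ → ℕ → ℤ}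
    (h : ∀ t, ∀ k < K, ans t k = ans' t k) :
    signRun η p c r M ans K = signRun η p c r M ans' K := by
  induction K with
  | zero => rfl
  | succ K ih =>
    rw [signRun, signRun, ih fun t k hk => h t k (by omega), h _ K (by omega)]

lemma answer_congr {ξ ξ' : NoiseIndex d → ℝ} {i : Fin d} {k : ℕ}
    (h : ∀ m b, ξ (i, k, m, b) = ξ' (i, k, m, b)) (v : Fin d → ℝ) (t : ℝ) :
    answer H θ ξ i v t k = answer H θ ξ' i v t k := by
  funext m
  unfold answer
  rw [h m false, h m true]

lemma modelStep_congr {ξ ξ' : NoiseIndex d → ℝ} {θ₀ : Fin d → ℝ} {i : Fin d}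
    (h : ∀ k m b, ξ (i, k, m, b) = ξ' (i, k, m, b)) (v : Fin d → ℝ) :
    modelStep T H θ ξ θ₀ v i = modelStep T H θ ξ' θ₀ v i := by
  have hans : answer H θ ξ i v = answer H θ ξ' i v := by
    funext t k
    exact answer_congr (h k) v t
  unfold modelStep
  rw [hans]

/-- Coordinates use disjoint blocks of noise, so the model entering the refinement of a new
coordinate is independent of that coordinate's noise. -/
lemma modelAfter_congr {ξ ξ' : NoiseIndex d → ℝ} {θ₀ : Fin d → ℝ} {l : List (Fin d)}
    (h : ∀ j ∈ l, ∀ k m b, ξ (j, k, m, b) = ξ' (j, k, m, b)) :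
    modelAfter T H θ ξ θ₀ l = modelAfter T H θ ξ' θ₀ l := by
  induction l using List.reverseRecOn with
  | nil => simp only [modelAfter, List.foldl_nil]
  | append_singleton l i ih =>
    have hi : i ∈ l ++ [i] := List.mem_append_right _ (List.mem_singleton_self i)
    rw [modelAfter_append_singleton, modelAfter_append_singleton,
      ih fun j hj => h j (List.mem_append_left _ hj), modelStep_congr (h i hi)]

lemma modelStep_of_ne {ξ : NoiseIndex d → ℝ} {θ₀ v : Fin d → ℝ} {i j : Fin d} (h : j ≠ i) :
    modelStep T H θ ξ θ₀ v i j = v j := by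
  unfold modelStep
  split_ifs
  · rfl
  · exact Function.update_of_ne h _ _

lemma modelAfter_of_eq_zero {ξ : NoiseIndex d → ℝ} {θ₀ : Fin d → ℝ} {j : Fin d} (h : θ₀ j = 0)
    (l : List (Fin d)) : modelAfter T H θ ξ θ₀ l j = 0 := by
  induction l using List.reverseRecOn with
  | nil => exact h
  | append_singleton l i ih =>
    rw [modelAfter_append_singleton]
    rcases eq_or_ne j i with rfl | hji
    · rw [modelStep, if_pos h, ih]
    · rw [modelStep_of_ne hji, ih]

/-- Holds for every noise realization: even a failed refinement leaves its coordinate inside the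
prior interval, so later queries remain feasible and no conditioning on earlier successes is
required. -/
lemma abs_modelAfter_sub_le (hp0 : 0 ≤ T.bis.p) (hp1 : T.bis.p ≤ 1) (hr : 0 < T.radius)
    (ξ : NoiseIndex d → ℝ) (θ₀ : Fin d → ℝ) (l : List (Fin d)) (j : Fin d) :
    |modelAfter T H θ ξ θ₀ l j - θ₀ j| ≤ T.radius := by
  induction l using List.reverseRecOn with
  | nil => simpa [modelAfter] using hr.le
  | append_singleton l i ih =>
    rw [modelAfter_append_singleton]
    rcases eq_or_ne j i with rfl | hji
    · unfold modelStep
      split_ifs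
      · exact ih
      · rw [Function.update_self, abs_le]
        have := signQuery_mem (c := θ₀ j) hp0 hp1 hr
          (signRun T.bis.η T.bis.p (θ₀ j) T.radius T.bis.cap
            (answer H θ ξ j (modelAfter T H θ ξ θ₀ l)) T.bis.maxSteps).1
        constructor <;> linarith [this.1, this.2]
    · rw [modelStep_of_ne hji]; exact ih

end Model

/-! ### Resampling a block of the utility noises -/

section Resample

variable {ι E : Type*} [MeasurableSpace E]

/-- Replace the coordinates in `B` of the first family by those of the second. -/
noncomputable def splice (B : Set ι) (q : (ι → E) × (ι → E)) : ι → E :=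
  open Classical in fun j => if j ∈ B then q.2 j else q.1 j

lemma measurable_splice (B : Set ι) : Measurable (splice (E := E) B) := by
  classical
  unfold splice
  refine measurable_pi_lambda _ fun j => ?_
  split_ifs <;> fun_prop

/-- Blocks of a product measure are independent: a finite box splits into constraints on and off
`B`, and its probability factors accordingly. -/
lemma map_splice_infinitePi (μ : ι → Measure E) [∀ i, IsProbabilityMeasure (μ i)] (B : Set ι) :
    ((Measure.infinitePi μ).prod (Measure.infinitePi μ)).map (splice B) = Measure.infinitePi μ := by
  classical
  refine Measure.eq_infinitePi μ fun s t ht => ?_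
  have hpre : splice B ⁻¹' (Set.pi s t)
      = (Set.pi (s.filter fun j => j ∉ B) t) ×ˢ (Set.pi (s.filter fun j => j ∈ B) t) := by
    ext ⟨x, y⟩
    simp only [Set.mem_preimage, Set.mem_pi, Set.mem_prod, Finset.coe_filter, Set.mem_ofPred_eq,
      Finset.mem_coe, splice]
    constructor
    · intro h
      refine ⟨fun j hj => ?_, fun j hj => ?_⟩
      · have := h j hj.1
        rwa [if_neg hj.2] at this
      · have := h j hj.1
        rwa [if_pos hj.2] at this
    · rintro ⟨h1, h2⟩ j hj
      by_cases hjB : j ∈ B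
      · rw [if_pos hjB]; exact h2 j ⟨hj, hjB⟩
      · rw [if_neg hjB]; exact h1 j ⟨hj, hjB⟩
  rw [Measure.map_apply (measurable_splice B)
    (MeasurableSet.pi s.countable_toSet fun j _ => ht j), hpre, Measure.prod_prod,
    Measure.infinitePi_pi μ fun j _ => ht j, Measure.infinitePi_pi μ fun j _ => ht j, mul_comm]
  exact Finset.prod_filter_mul_prod_filter_not s (fun j => j ∈ B) _

/-- An event that depends on the coordinates in `B` only through its second argument has
probability at most `b` as soon as this holds with the first argument frozen. -/
lemma infinitePi_diagonal_le (μ : ι → Measure E) [∀ i, IsProbabilityMeasure (μ i)] (B : Set ι)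
    {A : Set ((ι → E) × (ι → E))} (hA : MeasurableSet A)
    (hcongr : ∀ x y x' y', (∀ j, j ∉ B → x j = x' j) → (∀ j, j ∈ B → y j = y' j) →
      ((x, y) ∈ A ↔ (x', y') ∈ A)) {b : ℝ≥0∞}
    (hb : ∀ x, Measure.infinitePi μ {y | (x, y) ∈ A} ≤ b) :
    Measure.infinitePi μ {x | (x, x) ∈ A} ≤ b := by
  classical
  have hdiag : MeasurableSet {x : ι → E | (x, x) ∈ A} :=
    (measurable_id.prodMk measurable_id) hA
  have hpre : splice B ⁻¹' {x : ι → E | (x, x) ∈ A} = A := by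
    ext ⟨x, y⟩
    refine hcongr _ _ x y (fun j hj => ?_) fun j hj => ?_
    · simp [splice, hj]
    · simp [splice, hj]
  have h := Measure.map_apply (μ := (Measure.infinitePi μ).prod (Measure.infinitePi μ))
    (measurable_splice B) hdiag
  rw [map_splice_infinitePi, hpre, Measure.prod_apply hA] at h
  rw [h]
  calc _ ≤ ∫⁻ _, b ∂(Measure.infinitePi μ) := lintegral_mono hb
    _ = b := by rw [lintegral_const, measure_univ, mul_one]

end Resample

lemma measurableSet_faithful {Ω : Type*} [MeasurableSpace Ω] (η : ℝ) (M : ℕ) (x ε : ℝ)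
    {t : Ω → ℝ} {z : Ω → ℕ → ℤ} (ht : Measurable t) (hz : ∀ m, Measurable fun ω => z ω m) :
    MeasurableSet {ω | Faithful η M x ε (t ω) (z ω)} := by
  have hw : ∀ m, Measurable fun ω => (walk (z ω) m : ℝ) := fun m =>
    (measurable_from_top (f := fun n : ℤ => (n : ℝ))).comp (measurable_walk hz m)
  have h1 : {ω | Faithful η M x ε (t ω) (z ω)}
      = ({ω | t ω < x}ᶜ ∪ ⋂ m ∈ Finset.Ico 1 M, {ω | -testBoundary η m < (walk (z ω) m : ℝ)})
        ∩ ({ω | x < t ω}ᶜ ∪ ⋂ m ∈ Finset.Ico 1 M, {ω | (walk (z ω) m : ℝ) < testBoundary η m})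
        ∩ ({ω | ε < |t ω - x|}ᶜ ∪ {ω | testBoundary η (M - 1) ≤ |(walk (z ω) (M - 1) : ℝ)|}) := by
    ext ω
    simp only [Set.mem_ofPred_eq, Set.mem_inter_iff, Set.mem_union, Set.mem_compl_iff,
      Set.mem_iInter, Finset.mem_Ico]
    constructor
    · rintro ⟨a1, a2, a3⟩
      exact ⟨⟨not_or_of_imp fun h m hm => a1 h m hm.1 hm.2,
        not_or_of_imp fun h m hm => a2 h m hm.1 hm.2⟩, not_or_of_imp a3⟩
    · rintro ⟨⟨a1, a2⟩, a3⟩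
      exact ⟨fun h m hm hmM => (a1.resolve_left (not_not.2 h)) m ⟨hm, hmM⟩,
        fun h m hm hmM => (a2.resolve_left (not_not.2 h)) m ⟨hm, hmM⟩,
        fun h => a3.resolve_left (not_not.2 h)⟩
  rw [h1]
  refine ((MeasurableSet.union (measurableSet_lt ht measurable_const).compl
    (Finset.measurableSet_biInter _ fun m _ => measurableSet_lt measurable_const (hw m))).inter
    (MeasurableSet.union (measurableSet_lt measurable_const ht).compl
    (Finset.measurableSet_biInter _ fun m _ => measurableSet_lt (hw m) measurable_const))).inter
    (MeasurableSet.union (measurableSet_lt measurable_const ?_).compl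
    (measurableSet_le measurable_const ?_))
  · fun_prop
  · exact (hw (M - 1)).abs

/-! ### Success of the refinement from a good initial estimate -/

section Success

variable {d : ℕ} {T : Tuning} {H : HumanModel d} {θ : Fin d → ℝ} {S : Finset (Fin d)}
  {β a lam κ ν : ℝ}

/-- The utility gaps at feasible query points have the right sign and are not too small. -/
lemma utilityGap_feasible (hH : H.Accurate S θ β a lam κ ν) {q : Fin d → ℝ}
    (hq : q ∈ HumanModel.feasible S β θ) {i : Fin d} (hi : i ∈ S) {ε : ℝ} (hε : 0 ≤ ε)
    (hκ : 0 < κ) (hlam : 0 < lam) (hν : lam * ε ^ κ ≤ ν) :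
    (q i < θ i → 0 ≤ utilityGap H θ q i) ∧ (θ i < q i → utilityGap H θ q i ≤ 0) ∧
      (ε < |q i - θ i| → lam * ε ^ κ ≤ |utilityGap H θ q i|) := by
  have hpair := hH.pair q hq i hi
  have hgap : utilityGap H θ q i = H.dist θ (H.cMinus q i) - H.dist θ (H.cPlus q i) := by
    rw [utilityGap, HumanModel.utility, HumanModel.utility, H.dist_comm θ, H.dist_comm θ]
    ring
  refine ⟨fun h => ?_, fun h => ?_, fun h => ?_⟩
  · rw [hgap]; linarith [(hpair.above θ).2 h]
  · rw [hgap]; linarith [(hpair.below θ).2 h]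
  · rcases le_total |q i - θ i| a with h1 | h1
    · refine le_trans ?_ (hH.near q hq i hi h1)
      gcongr
    · exact hν.trans (hH.far q hq i hi h1)

/-- The conditions on the tuning under which the answers to each query are faithful with
probability at least `1 - M η`, and the bisection converges. -/
structure Tuning.Suits (T : Tuning) (γ β lam κ ν ε : ℝ) : Prop where
  η_pos : 0 < T.bis.η
  η_lt_one : T.bis.η < 1
  half_lt_p : 1 / 2 < T.bis.p
  p_le_one : T.bis.p ≤ 1
  radius_pos : 0 < T.radius
  two_radius : 2 * T.radius = β
  localSteps_eq : T.bis.localSteps = 0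
  two_le_cap : 2 ≤ T.bis.cap
  ε_nonneg : 0 ≤ ε
  gap_le : lam * ε ^ κ ≤ 2 * γ
  gap_le_far : lam * ε ^ κ ≤ ν
  boundary_le : 2 * testBoundary T.bis.η (T.bis.cap - 1)
    ≤ ((T.bis.cap - 1 : ℕ) : ℝ) * (lam * ε ^ κ / (4 * γ))
  mass_lt : (1 - T.bis.p) * (2 ^ T.bis.maxSteps - 1) < 1 / 2
  width_le : 2 * T.radius / (2 * T.bis.p) ^ T.bis.maxSteps ≤ ε

variable {γ ε : ℝ}

/-- Refinement of one coordinate succeeds with high probability. -/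
lemma humanLaw_coordinate_le (hT : T.Suits γ β lam κ ν ε) (hγ : 0 < γ) (hκ : 0 < κ)
    (hlam : 0 < lam) (hH : H.Accurate S θ β a lam κ ν) {i : Fin d} (hi : i ∈ S) {c : ℝ}
    (hc : |c - θ i| ≤ T.radius) {V : (NoiseIndex d → ℝ) → Fin d → ℝ} (hVm : Measurable V)
    (hVc : ∀ ξ ξ' : NoiseIndex d → ℝ, (∀ j, j.1 ≠ i → ξ j = ξ' j) → V ξ = V ξ')
    (hVf : ∀ ξ t, |t - θ i| ≤ β → Function.update (V ξ) i t ∈ HumanModel.feasible S β θ) :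
    humanLaw d γ {ξ | ε < |signQuery T.bis.p c T.radius
      (signRun T.bis.η T.bis.p c T.radius T.bis.cap (answer H θ ξ i (V ξ)) T.bis.maxSteps).1
        - θ i|}
      ≤ T.bis.maxSteps * ENNReal.ofReal (T.bis.cap * T.bis.η) := by
  have hp0 : 0 ≤ T.bis.p := by linarith [hT.half_lt_p]
  set R : (NoiseIndex d → ℝ) → ℕ → List Bool × Bool := fun ξ k =>
    signRun T.bis.η T.bis.p c T.radius T.bis.cap (answer H θ ξ i (V ξ)) k with hR
  set Q : (NoiseIndex d → ℝ) → ℕ → ℝ := fun ξ k => signQuery T.bis.p c T.radius (R ξ k).1 with hQ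
  have hRm : ∀ k, Measurable fun ξ => R ξ k := fun k =>
    measurable_signRun H θ i _ hp0 hT.p_le_one hT.radius_pos measurable_const hVm measurable_id k
  have hQm : ∀ k, Measurable fun ξ => Q ξ k := fun k =>
    measurable_signQuery hp0 hT.p_le_one hT.radius_pos measurable_const
      (measurable_fst.comp (hRm k))
  have hsub : {ξ | ε < |Q ξ T.bis.maxSteps - θ i|} ⊆ ⋃ k ∈ Finset.range T.bis.maxSteps,
      {ξ | ¬ Faithful T.bis.η T.bis.cap (θ i) ε (Q ξ k) (answer H θ ξ i (V ξ) (Q ξ k) k)} := by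
    intro ξ hξ
    by_contra hcon
    simp only [Set.mem_iUnion, Finset.mem_range, Set.mem_ofPred_eq, not_exists,
      not_not] at hcon
    have hξ' : ε < |Q ξ T.bis.maxSteps - θ i| := hξ
    refine absurd hξ' (not_lt.2 ?_)
    refine abs_signQuery_run_sub_le hT.half_lt_p hT.p_le_one hT.radius_pos hT.two_le_cap ?_
      hT.mass_lt hT.width_le hcon
    constructor <;> linarith [(abs_le.1 hc).1, (abs_le.1 hc).2]
  have hstep : ∀ k, humanLaw d γ
      {ξ | ¬ Faithful T.bis.η T.bis.cap (θ i) ε (Q ξ k) (answer H θ ξ i (V ξ) (Q ξ k) k)}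
      ≤ ENNReal.ofReal (T.bis.cap * T.bis.η) := by
    intro k
    -- The noise of this one horizontal step. Model and query point are functions of the remaining
    -- noise only, so they are frozen and the bound for a fixed query applies.
    set B : Set (NoiseIndex d) := {j | j.1 = i ∧ j.2.1 = k} with hB
    set A : Set ((NoiseIndex d → ℝ) × (NoiseIndex d → ℝ)) :=
      {q | ¬ Faithful T.bis.η T.bis.cap (θ i) ε (Q q.1 k)
        (answer H θ q.2 i (V q.1) (Q q.1 k) k)} with hA
    have hAm : MeasurableSet A :=
      (measurableSet_faithful _ _ _ _ ((hQm k).comp measurable_fst) fun m =>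
        measurable_answer H θ i k m (hVm.comp measurable_fst) ((hQm k).comp measurable_fst)
          measurable_snd).compl
    refine infinitePi_diagonal_le (fun _ : NoiseIndex d => gumbelMeasure γ) B hAm ?_ ?_
    · intro x y x' y' hx hy
      have hV : V x = V x' := hVc x x' fun j hj => hx j fun h => hj h.1
      have hRk : R x k = R x' k := by
        simp only [hR]
        rw [hV]
        refine signRun_congr fun t k' hk' => answer_congr (fun m b => hx _ ?_) _ _
        rintro ⟨-, h2⟩
        simp only at h2
        omega
      have hQk : Q x k = Q x' k := by simp only [hQ, hRk]
      have hans : answer H θ y i (V x') (Q x' k) k = answer H θ y' i (V x') (Q x' k) k :=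
        answer_congr (fun m b => hy _ ⟨rfl, rfl⟩) _ _
      simp only [hA, Set.mem_ofPred_eq]
      rw [hV, hQk, hans]
    · intro x
      have hmem := signQuery_mem (c := c) hp0 hT.p_le_one hT.radius_pos (R x k).1
      -- The query is within `radius` of the Lasso estimate, which is within `radius` of the truth;
      -- twice the radius is `β`.
      have hfeas : Function.update (V x) i (Q x k) ∈ HumanModel.feasible S β θ := by
        refine hVf x _ ?_
        rw [abs_le]
        have h1 := abs_le.1 hc
        have h2 := hT.two_radius
        constructor <;> linarith [hmem.1, hmem.2, h1.1, h1.2]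
      obtain ⟨g1, g2, g3⟩ := utilityGap_feasible hH hfeas hi hT.ε_nonneg hκ hlam hT.gap_le_far
      rw [Function.update_self] at g1 g2 g3
      exact humanLaw_not_faithful_le hγ hT.η_pos hT.η_lt_one
        (mul_nonneg hlam.le (Real.rpow_nonneg hT.ε_nonneg κ)) hT.gap_le hT.two_le_cap
        hT.boundary_le H θ i (V x) k hT.ε_nonneg g1 g2 g3
  calc _ ≤ ∑ k ∈ Finset.range T.bis.maxSteps, humanLaw d γ
        {ξ | ¬ Faithful T.bis.η T.bis.cap (θ i) ε (Q ξ k) (answer H θ ξ i (V ξ) (Q ξ k) k)} :=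
        (measure_mono hsub).trans (measure_biUnion_finset_le _ _)
    _ ≤ ∑ _k ∈ Finset.range T.bis.maxSteps, ENNReal.ofReal (T.bis.cap * T.bis.η) :=
        Finset.sum_le_sum fun k _ => hstep k
    _ = _ := by rw [Finset.sum_const, Finset.card_range, nsmul_eq_mul]

/-- Refinement of the coordinates in a list succeeds with high probability. -/
lemma humanLaw_modelAfter_le (hT : T.Suits γ β lam κ ν ε) (hγ : 0 < γ) (hκ : 0 < κ)
    (hlam : 0 < lam) (hH : H.Accurate S θ β a lam κ ν) (hθ : θ ∈ sparseClass S β)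
    {θ₀ : Fin d → ℝ} (hS : ∀ j, j ∉ S → θ₀ j = 0) (hθ₀ : ∀ j, |θ₀ j - θ j| ≤ T.radius)
    {l : List (Fin d)} (hl : l.Nodup) :
    humanLaw d γ {ξ | ∃ j ∈ l, j ∈ S ∧ ε < |modelAfter T H θ ξ θ₀ l j - θ j|}
      ≤ l.length * (T.bis.maxSteps * ENNReal.ofReal (T.bis.cap * T.bis.η)) := by
  have hp0 : 0 ≤ T.bis.p := by linarith [hT.half_lt_p]
  have hrβ : T.radius < β := by linarith [hT.two_radius, hT.radius_pos]
  induction l using List.reverseRecOn with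
  | nil => simp
  | append_singleton l i ih =>
    rw [List.nodup_append] at hl
    obtain ⟨hl1, -, hl2⟩ := hl
    have hil : i ∉ l := fun h => hl2 i h i (List.mem_singleton_self i) rfl
    set b := T.bis.maxSteps * ENNReal.ofReal (T.bis.cap * T.bis.η) with hb
    -- This bound is unconditional on earlier coordinates: whatever their outcome, the current model
    -- is a feasible starting point. A relevant coordinate is indeed selected, as its modulus is at
    -- least `β > radius`.
    have hone : humanLaw d γ {ξ | i ∈ S ∧ ε < |modelAfter T H θ ξ θ₀ (l ++ [i]) i - θ i|} ≤ b := by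
      by_cases hi : i ∈ S
      · have hne : θ₀ i ≠ 0 := by
          intro h0
          have h1 := hθ₀ i
          rw [h0, zero_sub, abs_neg] at h1
          linarith [hθ.1 i hi]
        have hval : ∀ ξ : NoiseIndex d → ℝ, modelAfter T H θ ξ θ₀ (l ++ [i]) i
            = signQuery T.bis.p (θ₀ i) T.radius
              (signRun T.bis.η T.bis.p (θ₀ i) T.radius T.bis.cap
                (answer H θ ξ i (modelAfter T H θ ξ θ₀ l)) T.bis.maxSteps).1 := by
          intro ξ
          rw [modelAfter_append_singleton, modelStep, if_neg hne, Function.update_self]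
        simp only [hi, true_and, hval]
        refine humanLaw_coordinate_le hT hγ hκ hlam hH hi (hθ₀ i)
          ((measurable_modelAfter hp0 hT.p_le_one hT.radius_pos H θ l).comp
            (measurable_const.prodMk measurable_id)) ?_ ?_
        · intro ξ ξ' h
          exact modelAfter_congr fun j hj k m b => h _ fun hji => hil (hji ▸ hj)
        · intro ξ t ht
          refine ⟨fun j hj => ?_, fun j => ?_⟩
          · have hji : j ≠ i := fun h => hj (by rw [h]; exact hi)
            rw [Function.update_of_ne hji]
            exact modelAfter_of_eq_zero (hS j hj) l
          · rcases eq_or_ne j i with rfl | hji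
            · rwa [Function.update_self]
            · rw [Function.update_of_ne hji]
              have h1 := abs_le.1 (abs_modelAfter_sub_le (H := H) (θ := θ) hp0 hT.p_le_one
                hT.radius_pos ξ θ₀ l j)
              have h2 := abs_le.1 (hθ₀ j)
              have h3 := hT.two_radius
              rw [abs_le]
              constructor <;> linarith [h1.1, h1.2, h2.1, h2.2]
      · simp [hi]
    have hsub : {ξ | ∃ j ∈ l ++ [i], j ∈ S ∧ ε < |modelAfter T H θ ξ θ₀ (l ++ [i]) j - θ j|}
        ⊆ {ξ | ∃ j ∈ l, j ∈ S ∧ ε < |modelAfter T H θ ξ θ₀ l j - θ j|}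
          ∪ {ξ | i ∈ S ∧ ε < |modelAfter T H θ ξ θ₀ (l ++ [i]) i - θ i|} := by
      rintro ξ ⟨j, hj, hjS, hjε⟩
      rcases eq_or_ne j i with rfl | hji
      · exact Or.inr ⟨hjS, hjε⟩
      · left
        refine ⟨j, (List.mem_append.1 hj).resolve_right (by simpa using hji), hjS, ?_⟩
        rwa [modelAfter_append_singleton, modelStep_of_ne hji] at hjε
    refine (measure_mono hsub).trans ((measure_union_le _ _).trans ?_)
    refine (add_le_add (ih hl1) hone).trans (le_of_eq ?_)
    rw [List.length_append, List.length_singleton]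
    push_cast
    ring

end Success

/-! ### The two stages together -/

section Stages

lemma prod_measure_le_add {Ω Ω' : Type*} [MeasurableSpace Ω] [MeasurableSpace Ω'] {μ : Measure Ω}
    {μ' : Measure Ω'} [IsProbabilityMeasure μ] [IsProbabilityMeasure μ'] {A : Set (Ω × Ω')}
    (hA : MeasurableSet A) {B : Set Ω} (hB : MeasurableSet B) {b : ℝ≥0∞}
    (h : ∀ w, w ∉ B → μ' {x | (w, x) ∈ A} ≤ b) : μ.prod μ' A ≤ μ B + b := by
  rw [Measure.prod_apply hA]
  calc _ ≤ ∫⁻ w, (B.indicator 1 w + b) ∂μ := by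
        refine lintegral_mono fun w => ?_
        by_cases hw : w ∈ B
        · rw [Set.indicator_of_mem hw]
          exact prob_le_one.trans le_self_add
        · exact (h w hw).trans le_add_self
    _ = _ := by
        rw [lintegral_add_right _ measurable_const, lintegral_indicator_one hB, lintegral_const,
          measure_univ, mul_one]

/-- Domination by a two-valued measurable function; measurability of `f`, here the number of
comparisons, is not needed. -/
lemma prod_lintegral_le_add {Ω Ω' : Type*} [MeasurableSpace Ω] [MeasurableSpace Ω']
    {μ : Measure Ω} {μ' : Measure Ω'} [IsProbabilityMeasure μ] [IsProbabilityMeasure μ']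
    {f : Ω × Ω' → ℝ≥0∞} {B : Set Ω} (hB : MeasurableSet B) {b c : ℝ≥0∞}
    (hb : ∀ w x, w ∉ B → f (w, x) ≤ b) (hc : ∀ w x, f (w, x) ≤ c) :
    ∫⁻ ω, f ω ∂(μ.prod μ') ≤ b + c * μ B := by
  calc _ ≤ ∫⁻ ω, (b + (B ×ˢ Set.univ).indicator (fun _ => c) ω) ∂(μ.prod μ') := by
        refine lintegral_mono fun ω => ?_
        obtain ⟨w, x⟩ := ω
        by_cases hw : w ∈ B
        · rw [Set.indicator_of_mem (by simpa using hw)]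
          exact (hc w x).trans le_add_self
        · exact (hb w x hw).trans le_self_add
    _ = _ := by
        rw [lintegral_add_left measurable_const, lintegral_const, measure_univ, mul_one,
          lintegral_indicator_const (hB.prod MeasurableSet.univ), Measure.prod_prod,
          measure_univ, mul_one]

variable {d : ℕ} {T : Tuning} {H : HumanModel d} {θ : Fin d → ℝ} {S : Finset (Fin d)}
  {β a lam κ ν γ ε ε' : ℝ}

lemma aligned_refine_iff (hloc : T.bis.localSteps = 0) (hcap : 1 ≤ T.bis.cap)
    (ξ : NoiseIndex d → ℝ) (θ₀ : Fin d → ℝ) :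
    Aligned ε θ (refine T H θ ξ θ₀)
      ↔ l2dist (modelAfter T H θ ξ θ₀ (List.finRange d)) θ ≤ ε := by
  obtain ⟨h1, h2⟩ := refine_eq (H := H) (θ := θ) hloc hcap ξ θ₀
  have h3 : (refine T H θ ξ θ₀).2 < ⊤ :=
    (h2 Finset.univ fun j hj => absurd (Finset.mem_univ j) hj).trans_lt
      (ENNReal.natCast_lt_top _)
  rw [Aligned, h1]
  exact and_iff_right h3

lemma l2dist_le_of_coord {x y : Fin d → ℝ} (hS : ∀ j, j ∉ S → x j = y j)
    (h : ∀ j ∈ S, |x j - y j| ≤ ε') (hε : 0 ≤ ε) (hcard : S.card * ε' ^ 2 ≤ ε ^ 2) :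
    l2dist x y ≤ ε := by
  rw [l2dist]
  refine (Real.sqrt_le_left hε).2 ?_
  rw [← Finset.sum_subset (Finset.subset_univ S) fun j _ hj => by rw [hS j hj]; ring]
  refine le_trans ?_ hcard
  rw [← nsmul_eq_mul]
  exact Finset.sum_le_card_nsmul _ _ _ fun j hj => sq_le_sq' (abs_le.1 (h j hj)).1
    (abs_le.1 (h j hj)).2

lemma humanLaw_not_aligned_le (hT : T.Suits γ β lam κ ν ε') (hγ : 0 < γ) (hκ : 0 < κ)
    (hlam : 0 < lam) (hH : H.Accurate S θ β a lam κ ν) (hθ : θ ∈ sparseClass S β)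
    {θ₀ : Fin d → ℝ} (hS : ∀ j, j ∉ S → θ₀ j = 0) (hθ₀ : ∀ j, |θ₀ j - θ j| ≤ T.radius)
    (hε : 0 ≤ ε) (hcard : S.card * ε' ^ 2 ≤ ε ^ 2) :
    humanLaw d γ {ξ | ¬ Aligned ε θ (refine T H θ ξ θ₀)}
      ≤ d * (T.bis.maxSteps * ENNReal.ofReal (T.bis.cap * T.bis.η)) := by
  have h := humanLaw_modelAfter_le hT hγ hκ hlam hH hθ hS hθ₀ (List.nodup_finRange d)
  rw [List.length_finRange] at h
  refine le_trans (measure_mono fun ξ hξ => ?_) h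
  by_contra hcon
  simp only [Set.mem_ofPred_eq, not_exists, not_and, not_lt] at hcon hξ
  refine hξ ((aligned_refine_iff hT.localSteps_eq (one_le_two.trans hT.two_le_cap) ξ θ₀).2 ?_)
  refine l2dist_le_of_coord (fun j hj => ?_) (fun j hj => hcon j (List.mem_finRange j) hj) hε hcard
  rw [modelAfter_of_eq_zero (hS j hj), hθ.2 j hj]

variable {X : Matrix (Fin T.labels) (Fin d) ℝ} {est : (Fin T.labels → ℝ) → Fin d → ℝ}
  {ρ : Measure ℝ}

lemma measurableSet_not_aligned (hT : T.Suits γ β lam κ ν ε') (hest : Measurable est) :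
    MeasurableSet {ω | ¬ Aligned ε θ (twoStage T X est H θ ω)} := by
  unfold twoStage
  simp only [aligned_refine_iff hT.localSteps_eq (one_le_two.trans hT.two_le_cap)]
  have h1 : Measurable fun ω : (Fin T.labels → ℝ) × (NoiseIndex d → ℝ) =>
      (est (X.mulVec θ + ω.1), ω.2) :=
    (hest.comp (measurable_const.add measurable_fst)).prodMk measurable_snd
  have h2 := (measurable_modelAfter (by linarith [hT.half_lt_p]) hT.p_le_one hT.radius_pos H θ
    (List.finRange d)).comp h1
  exact (measurableSet_le (measurable_l2dist.comp (h2.prodMk measurable_const))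
    measurable_const).compl

/-- On the event that the correlations of the noise with the columns are small, the first stage
selects the relevant features and locates their coefficients. -/
structure Tuning.Recovers (T : Tuning) (X : Matrix (Fin T.labels) (Fin d) ℝ)
    (est : (Fin T.labels → ℝ) → Fin d → ℝ) (θ : Fin d → ℝ) (S : Finset (Fin d))
    (B : Set (Fin T.labels → ℝ)) : Prop where
  measurableSet : MeasurableSet B
  support : ∀ w, w ∉ B → ∀ j, j ∉ S → est (X.mulVec θ + w) j = 0
  close : ∀ w, w ∉ B → ∀ j, |est (X.mulVec θ + w) j - θ j| ≤ T.radius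

variable {B : Set (Fin T.labels → ℝ)}

lemma jointLaw_not_aligned_le [IsProbabilityMeasure (noiseLaw T.labels ρ)]
    (hT : T.Suits γ β lam κ ν ε') (hγ : 0 < γ) (hκ : 0 < κ)
    (hlam : 0 < lam) (hH : H.Accurate S θ β a lam κ ν) (hθ : θ ∈ sparseClass S β)
    (hest : Measurable est) (hB : T.Recovers X est θ S B)
    (hε : 0 ≤ ε) (hcard : S.card * ε' ^ 2 ≤ ε ^ 2) :
    jointLaw T.labels d ρ γ {ω | ¬ Aligned ε θ (twoStage T X est H θ ω)}
      ≤ noiseLaw T.labels ρ B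
        + d * (T.bis.maxSteps * ENNReal.ofReal (T.bis.cap * T.bis.η)) :=
  prod_measure_le_add (measurableSet_not_aligned hT hest) hB.measurableSet fun w hw =>
    humanLaw_not_aligned_le hT hγ hκ hlam hH hθ (hB.support w hw) (hB.close w hw) hε hcard

/-- Off the bad event only coordinates of `S` are selected. On it at most all `d` are, which is paid
for with its small probability. -/
lemma expectedSamples_le [IsProbabilityMeasure (noiseLaw T.labels ρ)]
    (hloc : T.bis.localSteps = 0) (hcap : 1 ≤ T.bis.cap) (hB : T.Recovers X est θ S B) :
    expectedSamples T X est H θ ρ γ ≤ T.labels + ((S.card * (T.bis.maxSteps * T.bis.cap) : ℕ)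
      + (d * (T.bis.maxSteps * T.bis.cap) : ℕ) * noiseLaw T.labels ρ B) := by
  refine add_le_add le_rfl (prod_lintegral_le_add hB.measurableSet (fun w ξ hw => ?_)
    fun w ξ => ?_)
  · exact (refine_eq hloc hcap ξ _).2 S (hB.support w hw)
  · have h := (refine_eq (H := H) (θ := θ) hloc hcap ξ (est (X.mulVec θ + w))).2 Finset.univ
      fun j hj => absurd (Finset.mem_univ j) hj
    rwa [Finset.card_fin] at h

end Stages

/-! ### Combined guarantee for an explicit Lasso event. -/

section Guarantee

variable {d : ℕ} {T : Tuning} {H : HumanModel d} {θ : Fin d → ℝ} {S : Finset (Fin d)}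
  {β a lam κ ν γ ε ε' α₁ α₂ α' cmin Ccol τ α σ : ℝ}
  {X : Matrix (Fin T.labels) (Fin d) ℝ} {est : (Fin T.labels → ℝ) → Fin d → ℝ} {ρ : Measure ℝ}

lemma recovers_of_lassoDesign (hX : LassoDesign X S α₁ α₂ α' cmin Ccol)
    (hcmin : 0 < cmin) (hα₂ : 0 < α₂) (hα' : 0 ≤ α') (hreg : 0 < T.reg)
    (hα : α₁ ≤ α) (hτ : τ * (1 + α) < T.reg * (1 - α)) (hτ0 : 0 ≤ τ)
    (hrad : (T.reg + τ) / α₂ ≤ T.radius) (hest : IsLassoEstimator X T.reg est)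
    (hθ : θ ∈ sparseClass S β) : T.Recovers X est θ S {w | ∃ j, τ < |colCorr X w j|} := by
  have h : ∀ w, w ∉ {w | ∃ j, τ < |colCorr X w j|} →
      (∀ j, j ∉ S → est (X.mulVec θ + w) j = 0)
        ∧ ∀ j, |est (X.mulVec θ + w) j - θ j| ≤ (T.reg + τ) / α₂ := fun w hw => by
    simp only [Set.mem_ofPred_eq, not_exists, not_lt] at hw
    exact lasso_recovery hX hcmin hα₂ hα' hreg hα hτ hτ0 hθ.2 hw (hest.2 _)
  refine ⟨?_, fun w hw => (h w hw).1, fun w hw j => ((h w hw).2 j).trans hrad⟩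
  simp only [Set.ofPred_exists]
  exact MeasurableSet.iUnion fun j =>
    measurableSet_lt measurable_const (measurable_colCorr X j).abs

/-- Success probability and expected cost of the two-stage procedure in terms of its tuning. -/
lemma twoStage_guarantee (hT : T.Suits γ β lam κ ν ε') (hγ : 0 < γ) (hκ : 0 < κ)
    (hlam : 0 < lam) (hH : H.Accurate S θ β a lam κ ν) (hθ : θ ∈ sparseClass S β)
    (hε : 0 ≤ ε) (hcard : S.card * ε' ^ 2 ≤ ε ^ 2)
    (hX : LassoDesign X S α₁ α₂ α' cmin Ccol)
    (hcmin : 0 < cmin) (hα₂ : 0 < α₂) (hα' : 0 ≤ α') (hCcol : 0 < Ccol) (hreg : 0 < T.reg)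
    (hα : α₁ ≤ α) (hτ : τ * (1 + α) < T.reg * (1 - α)) (hτ0 : 0 < τ)
    (hrad : (T.reg + τ) / α₂ ≤ T.radius) (hest : IsLassoEstimator X T.reg est)
    (hσ : 0 < σ) (hρ : IsLabelNoise ρ σ) (hn : 0 < T.labels) {b : ℝ}
    (hb : 2 * d * Real.exp (-(T.labels * τ ^ 2 / (2 * (σ ^ 2 * Ccol ^ 2)))) ≤ b) :
    jointLaw T.labels d ρ γ {ω | ¬ Aligned ε θ (twoStage T X est H θ ω)}
        ≤ ENNReal.ofReal (b + d * (T.bis.maxSteps * (T.bis.cap * T.bis.η))) ∧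
      expectedSamples T X est H θ ρ γ ≤ ENNReal.ofReal (T.labels
        + (S.card * (T.bis.maxSteps * T.bis.cap) + d * (T.bis.maxSteps * T.bis.cap) * b)) := by
  have := hρ.prob
  have : IsProbabilityMeasure (noiseLaw T.labels ρ) := by unfold noiseLaw; infer_instance
  have hB := recovers_of_lassoDesign hX hcmin hα₂ hα' hreg hα hτ hτ0.le hrad hest hθ
  have hprob := (measure_colCorr_gt_le hρ hσ hCcol hτ0 hn hX.columns).trans
    (ENNReal.ofReal_le_ofReal hb)
  have hb0 : 0 ≤ b := le_trans (by positivity) hb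
  have hη := hT.η_pos
  constructor
  · refine (jointLaw_not_aligned_le hT hγ hκ hlam hH hθ hest.1 hB hε hcard).trans ?_
    rw [ENNReal.ofReal_add hb0 (by positivity), ENNReal.ofReal_mul (p := (d : ℝ)) (by positivity),
      ENNReal.ofReal_mul (p := (T.bis.maxSteps : ℝ)) (by positivity), ENNReal.ofReal_natCast,
      ENNReal.ofReal_natCast]
    gcongr
  · refine (expectedSamples_le hT.localSteps_eq (one_le_two.trans hT.two_le_cap) hB).trans ?_
    rw [ENNReal.ofReal_add (by positivity) (by positivity),
      ENNReal.ofReal_add (by positivity) (by positivity), ENNReal.ofReal_mul (by positivity) (q := b),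
      ENNReal.ofReal_natCast]
    have h1 : ENNReal.ofReal (S.card * (T.bis.maxSteps * T.bis.cap))
        = ((S.card * (T.bis.maxSteps * T.bis.cap) : ℕ) : ℝ≥0∞) := by
      rw [← ENNReal.ofReal_natCast]; push_cast; rfl
    have h2 : ENNReal.ofReal (d * (T.bis.maxSteps * T.bis.cap))
        = ((d * (T.bis.maxSteps * T.bis.cap) : ℕ) : ℝ≥0∞) := by
      rw [← ENNReal.ofReal_natCast]; push_cast; rfl
    rw [h1, h2]
    gcongr

end Guarantee

/-! ### The choice of the tuning -/

section Choice

lemma self_le_exp (x : ℝ) : x ≤ Real.exp x := by linarith [Real.add_one_le_exp x]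

lemma exp_neg_sixteen_mul (x : ℝ) : Real.exp (-(16 * x)) = (Real.exp x ^ 16)⁻¹ := by
  rw [Real.exp_neg, ← Real.exp_nat_mul]; norm_num

/-- Failure probability of the first stage. -/
lemma mul_exp_neg_le {Ccol τ σ L : ℝ} {n d : ℕ} (hCcol : 0 < Ccol) (hτ : 0 < τ) (hσ : 0 < σ)
    (hn : 8 * Ccol ^ 2 / τ ^ 2 * (σ ^ 2 * L) ≤ n) :
    2 * d * Real.exp (-(n * τ ^ 2 / (2 * (σ ^ 2 * Ccol ^ 2)))) ≤ 2 * d * (Real.exp L ^ 4)⁻¹ := by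
  rw [← Real.exp_nat_mul, ← Real.exp_neg]
  gcongr
  rw [le_div_iff₀ (by positivity)]
  calc ((4 : ℕ) : ℝ) * L * (2 * (σ ^ 2 * Ccol ^ 2))
      = 8 * Ccol ^ 2 / τ ^ 2 * (σ ^ 2 * L) * τ ^ 2 := by push_cast; field_simp; ring
    _ ≤ _ := by gcongr

/-- The tuning of the two-stage procedure for coordinatewise precision `ε` and logarithmic
factor `L`. -/
noncomputable def chosenTuning (A B reg β κ r σ ε L : ℝ) (s : ℕ) : Tuning where
  -- The three summands secure regularity of the design, concentration of the noise correlations,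
  -- and a positive sample size.
  labels := ⌈r * s⌉₊ + ⌈B * (σ ^ 2 * L)⌉₊ + 1
  reg := reg
  radius := β / 2
  bis :=
    -- The exponent 16 outweighs every union bound and the growth of `2 ^ maxSteps`. With `p = 1 -
    -- η` the update almost cuts the interval in half.
    { η := Real.exp (-(16 * L))
      p := 1 - Real.exp (-(16 * L))
      localSteps := 0
      maxSteps := ⌈8 * L⌉₊
      -- The number of comparisons needed to detect a drift proportional to `ε ^ κ`; the `+ 1`
      -- reflects that crossings count only before the cap.
      cap := ⌈A * L * ((ε ^ κ) ^ 2)⁻¹⌉₊ + 1 }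

/-- The precision `ε`, with logarithmic factor `L`, is small for sparsity `s` in dimension `d`. -/
structure SmallPrecision (A β κ ε δ L : ℝ) (s d : ℕ) : Prop where
  one_le_A : 1 ≤ A
  β_pos : 0 < β
  κ_pos : 0 < κ
  κ_le_one : κ ≤ 1
  one_le_s : 1 ≤ s
  s_le_d : s ≤ d
  ε_pos : 0 < ε
  ε_le_one : ε ≤ 1
  δ_pos : 0 < δ
  δ_le_one : δ ≤ 1
  exp_eq : Real.exp L * (ε * δ) = d
  one_le_L : 1 ≤ L
  le_exp : 9 + 3 * A + β ≤ Real.exp L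

/-! ### Estimates in powers of `exp L`, which dominates `d`, `1/ε` and `1/δ`. -/

namespace SmallPrecision

variable {A B reg β κ r σ ε δ L : ℝ} {s d : ℕ}

lemma one_le_sqrt (h : SmallPrecision A β κ ε δ L s d) : 1 ≤ Real.sqrt s := by
  rw [Real.one_le_sqrt]; exact_mod_cast h.one_le_s

lemma d_le (h : SmallPrecision A β κ ε δ L s d) : (d : ℝ) ≤ Real.exp L := by
  rw [← h.exp_eq]
  exact mul_le_of_le_one_right (Real.exp_pos _).le (mul_le_one₀ h.ε_le_one h.δ_pos.le h.δ_le_one)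

lemma d_div_le (h : SmallPrecision A β κ ε δ L s d) : (d : ℝ) ≤ Real.exp L * ε := by
  rw [← h.exp_eq, ← mul_assoc]
  exact mul_le_of_le_one_right (mul_nonneg (Real.exp_pos _).le h.ε_pos.le) h.δ_le_one

lemma one_le_d (h : SmallPrecision A β κ ε δ L s d) : (1 : ℝ) ≤ d := by exact_mod_cast h.one_le_s.trans h.s_le_d

lemma one_le_exp_mul (h : SmallPrecision A β κ ε δ L s d) : 1 ≤ Real.exp L * ε := h.one_le_d.trans h.d_div_le

lemma exp_neg_le (h : SmallPrecision A β κ ε δ L s d) : Real.exp (-L) ≤ δ := by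
  have h1 : 1 ≤ Real.exp L * δ := by
    refine h.one_le_d.trans ?_
    rw [← h.exp_eq]
    have := mul_le_of_le_one_left h.δ_pos.le h.ε_le_one
    exact mul_le_mul_of_nonneg_left this (Real.exp_pos _).le
  rw [Real.exp_neg, inv_le_iff_one_le_mul₀' (Real.exp_pos _)]
  exact h1

lemma nine_le (h : SmallPrecision A β κ ε δ L s d) : 9 ≤ Real.exp L := by linarith [h.le_exp, h.one_le_A, h.β_pos]

lemma coord_pos (h : SmallPrecision A β κ ε δ L s d) : 0 < ε / Real.sqrt s := div_pos h.ε_pos (by linarith [h.one_le_sqrt])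

lemma coord_le (h : SmallPrecision A β κ ε δ L s d) : ε / Real.sqrt s ≤ ε := div_le_self h.ε_pos.le h.one_le_sqrt

lemma coord_sq (h : SmallPrecision A β κ ε δ L s d) : s * (ε / Real.sqrt s) ^ 2 = ε ^ 2 := by
  have : (0 : ℝ) < s := by exact_mod_cast h.one_le_s
  rw [div_pow, Real.sq_sqrt this.le]
  field_simp

lemma gap_pos (h : SmallPrecision A β κ ε δ L s d) : 0 < (ε / Real.sqrt s) ^ κ := Real.rpow_pos_of_pos h.coord_pos κ

lemma gap_le_one (h : SmallPrecision A β κ ε δ L s d) : (ε / Real.sqrt s) ^ κ ≤ 1 :=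
  Real.rpow_le_one h.coord_pos.le (h.coord_le.trans h.ε_le_one) h.κ_pos.le

lemma one_le_inv_gap (h : SmallPrecision A β κ ε δ L s d) : 1 ≤ (((ε / Real.sqrt s) ^ κ) ^ 2)⁻¹ :=
  (one_le_inv₀ (pow_pos h.gap_pos 2)).2 (pow_le_one₀ h.gap_pos.le h.gap_le_one)

/-- Since `κ ≤ 1`, the inverse squared gap is at most `s / ε²`, and `s ≤ d ≤ exp L * ε` together
with `1 ≤ exp L * ε` finishes. -/
lemma inv_gap_le (h : SmallPrecision A β κ ε δ L s d) : (((ε / Real.sqrt s) ^ κ) ^ 2)⁻¹ ≤ Real.exp L ^ 2 := by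
  have h1 : ε / Real.sqrt s ≤ (ε / Real.sqrt s) ^ κ := by
    simpa using Real.rpow_le_rpow_of_exponent_ge h.coord_pos (h.coord_le.trans h.ε_le_one)
      h.κ_le_one
  have hs : (0 : ℝ) < s := by exact_mod_cast h.one_le_s
  have h2 : ((ε / Real.sqrt s) ^ 2) ≤ ((ε / Real.sqrt s) ^ κ) ^ 2 :=
    pow_le_pow_left₀ h.coord_pos.le h1 2
  refine (inv_anti₀ (pow_pos h.coord_pos 2) h2).trans ?_
  have h3 : (s : ℝ) ≤ Real.exp L * ε := le_trans (by exact_mod_cast h.s_le_d) h.d_div_le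
  rw [div_pow, Real.sq_sqrt hs.le, inv_div, div_le_iff₀ (pow_pos h.ε_pos 2), ← mul_pow]
  nlinarith [h.one_le_exp_mul]

lemma steps_le (h : SmallPrecision A β κ ε δ L s d) : (⌈8 * L⌉₊ : ℝ) ≤ 9 * L := by
  have := Nat.ceil_lt_add_one (a := 8 * L) (by linarith [h.one_le_L])
  linarith [h.one_le_L]

lemma cap_pos (h : SmallPrecision A β κ ε δ L s d) : 1 ≤ A * L * (((ε / Real.sqrt s) ^ κ) ^ 2)⁻¹ :=
  one_le_mul_of_one_le_of_one_le (one_le_mul_of_one_le_of_one_le h.one_le_A h.one_le_L)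
    h.one_le_inv_gap

lemma cap_le (h : SmallPrecision A β κ ε δ L s d) : ((⌈A * L * (((ε / Real.sqrt s) ^ κ) ^ 2)⁻¹⌉₊ + 1 : ℕ) : ℝ)
    ≤ 3 * (A * L * (((ε / Real.sqrt s) ^ κ) ^ 2)⁻¹) := by
  have h1 := h.cap_pos
  have := Nat.ceil_lt_add_one (zero_le_one.trans h1)
  push_cast
  linarith

lemma cap_le_exp (h : SmallPrecision A β κ ε δ L s d) : ((⌈A * L * (((ε / Real.sqrt s) ^ κ) ^ 2)⁻¹⌉₊ + 1 : ℕ) : ℝ)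
    ≤ Real.exp L ^ 4 := by
  refine h.cap_le.trans ?_
  have hA : 3 * A ≤ Real.exp L := by linarith [h.le_exp, h.β_pos]
  have hA1 := h.one_le_A
  have hL := h.one_le_L
  have hG := h.one_le_inv_gap
  calc _ = 3 * A * L * (((ε / Real.sqrt s) ^ κ) ^ 2)⁻¹ := by ring
    _ ≤ Real.exp L * Real.exp L * Real.exp L ^ 2 := by
        have := self_le_exp L
        have := h.inv_gap_le
        gcongr
    _ = _ := by ring

/-- Union bound over coordinates, horizontal steps and times: with `x = exp L` the four factors are
at most `x`, `x²`, `x⁴` and `x⁻¹⁶`, which leaves `x⁻⁹`. -/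
lemma failure_le (h : SmallPrecision A β κ ε δ L s d) : d * ((⌈8 * L⌉₊ : ℝ)
    * (((⌈A * L * (((ε / Real.sqrt s) ^ κ) ^ 2)⁻¹⌉₊ + 1 : ℕ) : ℝ) * Real.exp (-(16 * L))))
      ≤ δ / 2 := by
  set x := Real.exp L with hx
  have hx9 : 9 ≤ x := h.nine_le
  have hx0 : 0 < x := by linarith
  have hL := h.one_le_L
  have hK : (⌈8 * L⌉₊ : ℝ) ≤ x * x :=
    h.steps_le.trans (mul_le_mul hx9 (self_le_exp L) (by linarith) hx0.le)
  have hδ : x⁻¹ ≤ δ := by rw [hx, ← Real.exp_neg]; exact h.exp_neg_le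
  calc _ ≤ x * (x * x * (x ^ 4 * (x ^ 16)⁻¹)) := by
        rw [exp_neg_sixteen_mul]
        have := h.d_le
        have := h.cap_le_exp
        gcongr
    _ = x⁻¹ * (x ^ 8)⁻¹ := by field_simp
    _ ≤ δ * 2⁻¹ := by
        have h2 : 2 ≤ x ^ 8 := by
          calc (2 : ℝ) ≤ x := by linarith
            _ ≤ x ^ 8 := le_self_pow₀ (by linarith) (by norm_num)
        exact mul_le_mul hδ (inv_anti₀ two_pos h2) (by positivity) h.δ_pos.le
    _ = _ := by ring

lemma suits (h : SmallPrecision A β κ ε δ L s d) {γ lam ν : ℝ} (hγ : 0 < γ) (hlam : 0 < lam)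
    (hA : 2560 * (γ ^ 2 / lam ^ 2) ≤ A) (hgap : lam * ε ^ κ ≤ 2 * γ) (hgap' : lam * ε ^ κ ≤ ν) :
    (chosenTuning A B reg β κ r σ (ε / Real.sqrt s) L s).Suits γ β lam κ ν
      (ε / Real.sqrt s) := by
  have hL := h.one_le_L
  have hx9 := h.nine_le
  have hg : lam * (ε / Real.sqrt s) ^ κ ≤ lam * ε ^ κ :=
    mul_le_mul_of_nonneg_left (Real.rpow_le_rpow h.coord_pos.le h.coord_le h.κ_pos.le) hlam.le
  have hηle : Real.exp (-(16 * L)) ≤ 1 / 9 := by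
    rw [exp_neg_sixteen_mul, one_div]
    refine inv_anti₀ (by norm_num) (hx9.trans (le_self_pow₀ (by linarith) (by norm_num)))
  refine ⟨Real.exp_pos _, Real.exp_lt_one_iff.2 (by linarith), ?_, ?_, half_pos h.β_pos, ?_, rfl, ?_,
    h.coord_pos.le, hg.trans hgap, hg.trans hgap', ?_, ?_, ?_⟩
  · show 1 / 2 < 1 - Real.exp (-(16 * L))
    linarith
  · show 1 - Real.exp (-(16 * L)) ≤ 1
    linarith [Real.exp_pos (-(16 * L))]
  · show 2 * (β / 2) = β
    ring
  · show 2 ≤ ⌈A * L * (((ε / Real.sqrt s) ^ κ) ^ 2)⁻¹⌉₊ + 1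
    have : 0 < ⌈A * L * (((ε / Real.sqrt s) ^ κ) ^ 2)⁻¹⌉₊ :=
      Nat.ceil_pos.2 (zero_lt_one.trans_le h.cap_pos)
    omega
  -- After squaring, twice the boundary becomes at most `8 m (4L + 16L) = 160 L m`, because the cap
  -- is at most `exp (4L)`. The drift has denominator `4 * γ`, whence `2560 = 16 · 160` in the
  -- condition on `A`.
  · show 2 * testBoundary (Real.exp (-(16 * L)))
      (⌈A * L * (((ε / Real.sqrt s) ^ κ) ^ 2)⁻¹⌉₊ + 1 - 1) ≤
      ((⌈A * L * (((ε / Real.sqrt s) ^ κ) ^ 2)⁻¹⌉₊ + 1 - 1 : ℕ) : ℝ)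
        * (lam * (ε / Real.sqrt s) ^ κ / (4 * γ))
    rw [Nat.add_sub_cancel]
    have hcap := h.cap_le_exp
    have hceil := Nat.le_ceil (A * L * (((ε / Real.sqrt s) ^ κ) ^ 2)⁻¹)
    set m := ⌈A * L * (((ε / Real.sqrt s) ^ κ) ^ 2)⁻¹⌉₊ with hm
    set g := (ε / Real.sqrt s) ^ κ with hgdef
    have hg0 : 0 < g := h.gap_pos
    have hlog : Real.log (m + 1) ≤ 4 * L := by
      push_cast at hcap
      calc _ ≤ Real.log (Real.exp L ^ 4) := Real.log_le_log (by positivity) hcap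
        _ = 4 * L := by rw [Real.log_pow, Real.log_exp]; norm_num
    refine abs_le_of_sq_le_sq' ?_ (by positivity) |>.2
    rw [mul_pow, sq_testBoundary (Real.exp_pos _) (Real.exp_lt_one_iff.2 (by linarith)), Real.log_exp]
    have hmg : 160 * L ≤ m * (lam * g / (4 * γ)) ^ 2 := by
      calc 160 * L = 2560 * (γ ^ 2 / lam ^ 2) * L * (g ^ 2)⁻¹ * (lam * g / (4 * γ)) ^ 2 := by
            field_simp; norm_num
        _ ≤ A * L * (g ^ 2)⁻¹ * (lam * g / (4 * γ)) ^ 2 := by gcongr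
        _ ≤ _ := by gcongr
    calc 2 ^ 2 * (2 * m * (Real.log (m + 1) - -(16 * L)))
        ≤ 2 ^ 2 * (2 * m * (4 * L - -(16 * L))) := by gcongr
      _ = m * (160 * L) := by ring
      _ ≤ m * (m * (lam * g / (4 * γ)) ^ 2) := by gcongr
      _ = _ := by ring
  -- `2 ^ maxSteps ≤ exp (9L)` is beaten by `1 - p = exp (-16L)`.
  · show (1 - (1 - Real.exp (-(16 * L)))) * (2 ^ ⌈8 * L⌉₊ - 1) < 1 / 2
    have h2 : (2 : ℝ) ^ ⌈8 * L⌉₊ ≤ Real.exp L ^ 9 := by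
      calc (2 : ℝ) ^ ⌈8 * L⌉₊ ≤ Real.exp 1 ^ ⌈8 * L⌉₊ := by
            gcongr
            linarith [Real.add_one_le_exp (1 : ℝ)]
        _ = Real.exp ⌈8 * L⌉₊ := by rw [← Real.exp_nat_mul, mul_one]
        _ ≤ Real.exp (9 * L) := Real.exp_le_exp.2 h.steps_le
        _ = _ := by rw [← Real.exp_nat_mul]; norm_num
    set x := Real.exp L
    have hx0 : 0 < x := by linarith
    rw [sub_sub_cancel, exp_neg_sixteen_mul]
    calc (x ^ 16)⁻¹ * (2 ^ ⌈8 * L⌉₊ - 1) ≤ (x ^ 16)⁻¹ * x ^ 9 := by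
          gcongr; linarith
      _ = (x ^ 7)⁻¹ := by field_simp
      _ ≤ 9⁻¹ := inv_anti₀ (by norm_num)
          (hx9.trans (le_self_pow₀ (by linarith) (by norm_num)))
      _ < 1 / 2 := by norm_num
  -- As `2p ≥ 3/2` and `log (3/2) ≥ 1/3`, `8L` steps shrink the interval by at least `exp (2L)`,
  -- while only `β √s / ε ≤ exp (2L)` is required.
  · show 2 * (β / 2) / (2 * (1 - Real.exp (-(16 * L)))) ^ ⌈8 * L⌉₊ ≤ ε / Real.sqrt s
    have h1 : Real.exp L ^ 2 ≤ (2 * (1 - Real.exp (-(16 * L)))) ^ ⌈8 * L⌉₊ := by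
      have hlog : 1 / 3 ≤ Real.log (3 / 2) := by
        have := Real.one_sub_inv_le_log_of_pos (show (0 : ℝ) < 3 / 2 by norm_num)
        norm_num at this ⊢
        exact this
      calc Real.exp L ^ 2 = Real.exp (2 * L) := by rw [← Real.exp_nat_mul]; norm_num
        _ ≤ Real.exp (⌈8 * L⌉₊ * Real.log (3 / 2)) := by
            refine Real.exp_le_exp.2 ?_
            have := Nat.le_ceil (8 * L)
            nlinarith
        _ = (3 / 2) ^ ⌈8 * L⌉₊ := by rw [Real.exp_nat_mul, Real.exp_log (by norm_num)]
        _ ≤ _ := by gcongr; linarith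
    have hs : Real.sqrt s ≤ d := by
      refine (Real.sqrt_le_left (by linarith [h.one_le_d])).2 ?_
      have : (s : ℝ) ≤ d := by exact_mod_cast h.s_le_d
      nlinarith [h.one_le_d]
    have hs0 : 0 < Real.sqrt s := by linarith [h.one_le_sqrt]
    rw [mul_div_cancel₀ _ two_ne_zero, div_le_iff₀ (lt_of_lt_of_le (by positivity) h1)]
    refine le_trans ?_ (mul_le_mul_of_nonneg_left h1 h.coord_pos.le)
    rw [div_mul_eq_mul_div, le_div_iff₀ hs0]
    have hβ : β ≤ Real.exp L := by linarith [h.le_exp, h.one_le_A]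
    calc β * Real.sqrt s ≤ Real.exp L * (Real.exp L * ε) := by
          have := hs.trans h.d_div_le
          gcongr
      _ = _ := by ring

lemma valid (h : SmallPrecision A β κ ε δ L s d) (hreg : 0 < reg) :
    (chosenTuning A B reg β κ r σ (ε / Real.sqrt s) L s).Valid β := by
  have hη : Real.exp (-(16 * L)) < 1 / 2 := by
    rw [exp_neg_sixteen_mul, one_div]
    exact inv_strictAnti₀ (by norm_num) (lt_of_lt_of_le (by linarith [h.nine_le])
      (le_self_pow₀ (by linarith [h.nine_le]) (by norm_num : (16 : ℕ) ≠ 0)))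
  have hη0 := Real.exp_pos (-(16 * L))
  refine ⟨hreg, half_pos h.β_pos, half_le_self h.β_pos.le, hη0, ?_, ?_, ?_, Nat.zero_le _⟩
  · show Real.exp (-(16 * L)) < 1
    linarith
  · show 1 / 2 < 1 - Real.exp (-(16 * L))
    linarith
  · show 1 - Real.exp (-(16 * L)) < 1 - Real.exp (-(16 * L)) / 2
    linarith

/-- Failure probability of the first stage. -/
lemma first_failure_le (h : SmallPrecision A β κ ε δ L s d) : 2 * d * (Real.exp L ^ 4)⁻¹ ≤ δ / 2 := by
  set x := Real.exp L with hx
  have hx9 : 9 ≤ x := h.nine_le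
  have hx0 : 0 < x := by linarith
  have hδ : x⁻¹ ≤ δ := by rw [hx, ← Real.exp_neg]; exact h.exp_neg_le
  calc _ ≤ 2 * x * (x ^ 4)⁻¹ := by
        have := h.d_le
        gcongr
    _ = x⁻¹ * (2 * (x ^ 2)⁻¹) := by field_simp
    _ ≤ δ * (1 / 2) := by
        refine mul_le_mul hδ ?_ (by positivity) h.δ_pos.le
        rw [mul_inv_le_iff₀ (by positivity)]
        nlinarith
    _ = _ := by ring

/-- Makes a failed first stage, where up to `d` coordinates are refined, contribute no more to the
expected cost than one regular coordinate. -/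
lemma d_mul_first_failure_le (h : SmallPrecision A β κ ε δ L s d) : d * (2 * d * (Real.exp L ^ 4)⁻¹) ≤ 1 := by
  set x := Real.exp L with hx
  have hx9 : 9 ≤ x := h.nine_le
  have hx0 : 0 < x := by linarith
  calc _ ≤ x * (2 * x * (x ^ 4)⁻¹) := by
        have := h.d_le
        gcongr
    _ = 2 * (x ^ 2)⁻¹ := by field_simp
    _ ≤ 1 := by
        rw [mul_inv_le_iff₀ (by positivity)]
        nlinarith

/-- The inverse squared gap in terms of sparsity and precision. -/
lemma inv_gap_eq (h : SmallPrecision A β κ ε δ L s d) : (((ε / Real.sqrt s) ^ κ) ^ 2)⁻¹ = (s : ℝ) ^ κ * ε ^ (2 - 2 * κ) / ε ^ 2 := by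
  have hs : (0 : ℝ) < s := by exact_mod_cast h.one_le_s
  have h1 : ((ε / Real.sqrt s) ^ κ) ^ 2 = (ε ^ κ) ^ 2 / (s : ℝ) ^ κ := by
    rw [Real.div_rpow h.ε_pos.le (Real.sqrt_nonneg _), div_pow, ← Real.rpow_natCast
      (Real.sqrt s ^ κ), ← Real.rpow_mul (Real.sqrt_nonneg _), mul_comm κ,
      Real.rpow_mul (Real.sqrt_nonneg _), Real.rpow_natCast, Real.sq_sqrt hs.le]
  have h2 : ε ^ (2 - 2 * κ) = ε ^ 2 / (ε ^ κ) ^ 2 := by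
    rw [Real.rpow_sub h.ε_pos, mul_comm 2 κ, Real.rpow_mul h.ε_pos.le, Real.rpow_two,
      Real.rpow_two]
  have h3 : 0 < ε ^ κ := Real.rpow_pos_of_pos h.ε_pos _
  have h4 := h.ε_pos
  rw [h1, h2, inv_div]
  field_simp

/-- Total cost of the procedure against the lower bound for pure supervised learning. -/
lemma cost_le (h : SmallPrecision A β κ ε δ L s d) {c : ℝ} (hc : 0 < c) (hB : 0 < B) (hr : 0 < r) (hσ : 0 < σ)
    (hBε : B * (ε * L) ≤ c / 4) (hrL : r + 3 ≤ L)
    (hbig : 216 * A / c * L ^ 2 * ε ^ (2 - 2 * κ) ≤ σ ^ 2 / (s : ℝ) ^ κ) :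
    (((⌈r * s⌉₊ + ⌈B * (σ ^ 2 * L)⌉₊ + 1 : ℕ) : ℝ)
      + (s * ((⌈8 * L⌉₊ : ℝ) * ((⌈A * L * (((ε / Real.sqrt s) ^ κ) ^ 2)⁻¹⌉₊ + 1 : ℕ) : ℝ))
        + d * ((⌈8 * L⌉₊ : ℝ) * ((⌈A * L * (((ε / Real.sqrt s) ^ κ) ^ 2)⁻¹⌉₊ + 1 : ℕ) : ℝ))
          * (2 * d * (Real.exp L ^ 4)⁻¹)))
      ≤ c * (s * σ ^ 2 / ε ^ 2) := by
  have hs1 : (1 : ℝ) ≤ s := by exact_mod_cast h.one_le_s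
  have hs : (0 : ℝ) < s := by linarith
  have hε := h.ε_pos
  have hL := h.one_le_L
  have hA := h.one_le_A
  have hG1 := h.one_le_inv_gap
  have hGeq := h.inv_gap_eq
  have hcap := h.cap_le
  have hK := h.steps_le
  set M : ℝ := ((⌈A * L * (((ε / Real.sqrt s) ^ κ) ^ 2)⁻¹⌉₊ + 1 : ℕ) : ℝ) with hM
  set G := (((ε / Real.sqrt s) ^ κ) ^ 2)⁻¹ with hG
  set K : ℝ := (⌈8 * L⌉₊ : ℝ) with hKdef
  have hK0 : 0 ≤ K := Nat.cast_nonneg _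
  have hM0 : 0 ≤ M := Nat.cast_nonneg _
  set V := σ ^ 2 / ε ^ 2 with hV
  have hsκ : 0 < (s : ℝ) ^ κ := Real.rpow_pos_of_pos hs _
  -- The largeness assumption on `σ² / s^κ`, rewritten through the gap. As `216 = 8 · 27`, the
  -- comparisons on the good event use an eighth of the budget `s * (c * V)`, and those on the bad
  -- event at most another eighth.
  have hVG : 216 * A * L ^ 2 * G ≤ c * V := by
    rw [le_div_iff₀ hsκ] at hbig
    have h1 : 216 * A * L ^ 2 * G
        = c * ((216 * A / c * L ^ 2 * ε ^ (2 - 2 * κ) * (s : ℝ) ^ κ) / ε ^ 2) := by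
      rw [hGeq]; field_simp
    rw [h1, hV]
    gcongr
  have hcost : d * (K * M) * (2 * d * (Real.exp L ^ 4)⁻¹) ≤ s * (K * M) := by
    calc _ = K * M * (d * (2 * d * (Real.exp L ^ 4)⁻¹)) := by ring
      _ ≤ K * M * s := by
          have := h.d_mul_first_failure_le.trans hs1
          gcongr
      _ = _ := by ring
  have hKM : K * M ≤ 27 * A * L ^ 2 * G := by
    calc K * M ≤ 9 * L * (3 * (A * L * G)) := by gcongr
      _ = _ := by ring
  have hKM' : s * (K * M) ≤ s * (27 * A * L ^ 2 * G) := by gcongr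
  have hVG' : s * (216 * A * L ^ 2 * G) ≤ s * (c * V) := by gcongr
  have hc1 := (Nat.ceil_lt_add_one (a := r * s) (by positivity)).le
  have hc2 := (Nat.ceil_lt_add_one (a := B * (σ ^ 2 * L)) (by positivity)).le
  have hB2 : B * (σ ^ 2 * L) ≤ s * (c * V) / 4 := by
    have h1 : B * L * ε ^ 2 ≤ c / 4 := by
      calc B * L * ε ^ 2 = B * (ε * L) * ε := by ring
        _ ≤ c / 4 * 1 := by
            have := h.ε_le_one
            gcongr
        _ = _ := mul_one _
    calc B * (σ ^ 2 * L) = B * L * ε ^ 2 * V := by rw [hV]; field_simp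
      _ ≤ c / 4 * V := by gcongr
      _ = 1 * (c * V) / 4 := by ring
      _ ≤ _ := by gcongr
  -- The design labels and the rounding terms: `c * V / 4 ≥ 54 A L² G ≥ L`, and `L ≥ r + 3` by
  -- smallness of `ε`.
  have hr3 : r * s + 3 ≤ s * (c * V) / 4 := by
    have h1 : r + 3 ≤ c * V / 4 := by
      have h2 : L ≤ 54 * (A * L ^ 2 * G) := by
        have : 1 ≤ A * G := one_le_mul_of_one_le_of_one_le hA hG1
        nlinarith [mul_le_mul this hL zero_le_one (by linarith : 0 ≤ A * G)]
      linarith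
    calc r * s + 3 ≤ s * (r + 3) := by nlinarith
      _ ≤ s * (c * V / 4) := by gcongr
      _ = _ := by ring
  have hfin : c * (s * σ ^ 2 / ε ^ 2) = s * (c * V) := by rw [hV]; ring
  rw [hfin]
  push_cast
  have hpos : 0 ≤ s * (c * V) := by positivity
  linarith

end SmallPrecision

end Choice

theorem mainTheorem7
    (κ a lam γ β α₁ α₂ α' cmin Ccol δbar : ℝ)
    (hκ : 0 < κ) (hκ1 : κ ≤ 1) (ha : 0 < a) (hlam : 0 < lam) (hγ : 0 < γ) (hβ : 0 < β)
    (hα₁ : α₁ < 1) (hα₂ : 0 < α₂) (hα' : 0 ≤ α') (hcmin : 0 < cmin) (hCcol : 0 < Ccol)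
    (hδbar : δbar < 1) :
    ∃ C : ℝ, 0 < C ∧ ∃ m : ℕ, ∀ ν r : ℝ, 0 < ν → 0 < r → ∃ ε₀ : ℝ, 0 < ε₀ ∧
      ∀ (s d : ℕ) (σ ε δ : ℝ), 1 ≤ s → s ≤ d → 0 < σ → 0 < δ → δ ≤ δbar →
        0 < ε → ε ≤ ε₀ → ε * logFactor d ε δ ≤ ε₀ →
        C * logFactor d ε δ ^ m * ε ^ (2 - 2 * κ) ≤ σ ^ 2 / (s : ℝ) ^ κ →
        ∃ T : Tuning, T.Valid β ∧
          ∀ S : Finset (Fin d), S.card = s →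
          ∀ X : (n : ℕ) → Matrix (Fin n) (Fin d) ℝ,
            (∀ n : ℕ, r * s ≤ n → LassoDesign (X n) S α₁ α₂ α' cmin Ccol) →
          ∀ est : (Fin T.labels → ℝ) → (Fin d → ℝ), IsLassoEstimator (X T.labels) T.reg est →
          ∀ θ ∈ sparseClass S β, ∀ ρ : Measure ℝ, IsLabelNoise ρ σ →
          ∀ H : HumanModel d, H.Accurate S θ β a lam κ ν →
            jointLaw T.labels d ρ γ {ω | ¬ Aligned ε θ (twoStage T (X T.labels) est H θ ω)}
                ≤ ENNReal.ofReal δ ∧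
            ∀ (n : ℕ) (X' : Matrix (Fin n) (Fin d) ℝ),
              LassoDesign X' S α₁ α₂ α' cmin Ccol → PureSLSolves X' S β σ ε δ →
                expectedSamples T (X T.labels) est H θ ρ γ < (n : ℝ≥0∞) := by
  -- The lower bound wants a positive failure level, so `δbar` is raised to at least 1/2.
  obtain ⟨c, hc, hlower⟩ := pureSL_sample_lower_bound (Ccol := Ccol) (δbar := max δbar (1 / 2))
    hCcol (lt_max_of_lt_right (by norm_num)) (max_lt hδbar (by norm_num))
  set A : ℝ := 1 + 2560 * (γ ^ 2 / lam ^ 2) with hA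
  have hA1 : 1 ≤ A := le_add_of_nonneg_right (by positivity)
  set α := max α₁ 0 with hα
  have hα1 : α < 1 := max_lt hα₁ one_pos
  have hα0 : 0 ≤ α := le_max_right _ _
  -- With `τ ≤ reg` the sup-norm error `(reg + τ) / α₂` is at most the radius `β / 2`; `τ` is then
  -- taken small enough for the incoherence margin.
  set reg := α₂ * β / 4 with hreg
  have hreg0 : 0 < reg := by positivity
  set τ := reg * (1 - α) / 4 with hτ
  have hα1' : 0 < 1 - α := by linarith
  have hτ0 : 0 < τ := by positivity
  have hτα : τ * (1 + α) < reg * (1 - α) := by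
    have : 0 < reg * (1 - α) := by positivity
    rw [hτ]; nlinarith
  have hrad : (reg + τ) / α₂ ≤ β / 2 := by
    have h1 : τ ≤ reg := by rw [hτ]; nlinarith
    rw [div_le_iff₀ hα₂]
    linarith
  set B := 8 * Ccol ^ 2 / τ ^ 2 with hB
  have hB0 : 0 < B := by positivity
  refine ⟨216 * A / c, by positivity, 2, fun ν r hν hr => ?_⟩
  set e₁ := (min ν (2 * γ) / lam) ^ κ⁻¹ with he₁
  have he₁0 : 0 < e₁ := Real.rpow_pos_of_pos (by positivity) _
  -- In order: `ε ≤ 1`; the label budget through `ε L`; gaps below `ν` and `2γ`; `L ≥ r + 3`; and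
  -- `exp L` above the absolute constants. Only here do `ν` and `r` enter.
  refine ⟨min (min 1 (c / (4 * B))) (min e₁ (min (Real.exp (-(r + 3))) (9 + 3 * A + β)⁻¹)),
    by positivity, ?_⟩
  intro s d σ ε δ hs hsd hσ hδ hδle hε hε0 hεL hbig
  simp only [le_min_iff] at hε0 hεL
  obtain ⟨⟨hε1, -⟩, hε2, hε3, hε4⟩ := hε0
  obtain ⟨⟨-, hεL⟩, -⟩ := hεL
  set L := logFactor d ε δ with hL
  have hd : (1 : ℝ) ≤ d := by exact_mod_cast hs.trans hsd
  have hδ1 : δ ≤ 1 := by linarith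
  have hexp : Real.exp L = d / (ε * δ) := by
    rw [hL, logFactor, Real.exp_log (by positivity)]
  have hexp' : ε⁻¹ ≤ Real.exp L := by
    rw [hexp, inv_eq_one_div]
    exact div_le_div₀ (by positivity) hd (by positivity) (mul_le_of_le_one_right hε.le hδ1)
  have hrL : r + 3 ≤ L := by
    rw [← Real.exp_le_exp]
    refine le_trans ?_ hexp'
    rw [le_inv_comm₀ (Real.exp_pos _) hε, ← Real.exp_neg]
    exact hε3
  have hsmall : SmallPrecision A β κ ε δ L s d :=
    { one_le_A := hA1, β_pos := hβ, κ_pos := hκ, κ_le_one := hκ1, one_le_s := hs, s_le_d := hsd,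
      ε_pos := hε, ε_le_one := hε1, δ_pos := hδ, δ_le_one := hδ1
      exp_eq := by rw [hexp]; field_simp
      one_le_L := by linarith
      le_exp := ((le_inv_comm₀ hε (by positivity)).1 hε4).trans hexp' }
  have hgap : lam * ε ^ κ ≤ min ν (2 * γ) := by
    rw [mul_comm, ← le_div_iff₀ hlam]
    calc ε ^ κ ≤ e₁ ^ κ := Real.rpow_le_rpow hε.le hε2 hκ.le
      _ = _ := by rw [he₁, ← Real.rpow_mul (by positivity), inv_mul_cancel₀ hκ.ne', Real.rpow_one]
  have hbudget : B * (ε * L) ≤ c / 4 := by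
    calc B * (ε * L) ≤ B * (c / (4 * B)) := by gcongr
      _ = c / 4 := by field_simp
  set T := chosenTuning A B reg β κ r σ (ε / Real.sqrt s) L s with hT
  have hlabels : T.labels = ⌈r * s⌉₊ + ⌈B * (σ ^ 2 * L)⌉₊ + 1 := rfl
  refine ⟨T, hsmall.valid hreg0, fun S hS X hX est hest θ hθ ρ hρ H hH => ?_⟩
  have hdesign : LassoDesign (X T.labels) S α₁ α₂ α' cmin Ccol := by
    refine hX _ ((Nat.le_ceil (r * s)).trans ?_)
    rw [hlabels]; push_cast
    linarith [Nat.cast_nonneg (α := ℝ) ⌈B * (σ ^ 2 * L)⌉₊]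
  have hfirst := mul_exp_neg_le (d := d) (n := T.labels) hCcol hτ0 hσ (L := L) (by
    refine (Nat.le_ceil (B * (σ ^ 2 * L))).trans ?_
    rw [hlabels]; push_cast
    linarith [Nat.cast_nonneg (α := ℝ) ⌈r * s⌉₊])
  obtain ⟨h1, h2⟩ := twoStage_guarantee (T := T)
    (hsmall.suits hγ hlam (by rw [hA]; linarith) (hgap.trans (min_le_right _ _))
      (hgap.trans (min_le_left _ _))) hγ hκ hlam hH hθ hε.le
    (by rw [hS, hsmall.coord_sq]) hdesign hcmin hα₂ hα' hCcol hreg0 (le_max_left _ _) hτα hτ0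
    hrad hest hσ hρ (Nat.succ_pos _) hfirst
  refine ⟨h1.trans (ENNReal.ofReal_le_ofReal ?_), fun n X' hX' hsolve => h2.trans_lt ?_⟩
  · exact (add_le_add hsmall.first_failure_le hsmall.failure_le).trans (add_halves δ).le
  -- The final strict inequality is inherited from the strict lower bound on `n`.
  · have hn := hlower (hS ▸ hs) hβ hσ hε hδ (hδle.trans (le_max_left _ _)) hX'.columns hsolve
    rw [hS] at hn ⊢
    rw [← ENNReal.ofReal_natCast n]
    refine (ENNReal.ofReal_lt_ofReal_iff (lt_of_le_of_lt (by positivity) hn)).2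
      (lt_of_le_of_lt ?_ hn)
    exact hsmall.cost_le hc hB0 hr hσ hbudget hrL hbig
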